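/- **Definitions.** Let $m\ge 0$. *Essential cycles.* An essential $\mathbb Z_2$-$m$-cycle is a pair $(\tilde\Sigma,a)$ such that (i) $\tilde\Sigma$ is a finite simplicial complex that is the union of its $m$-simplices, and every $(m-1)$-simplex is a face of an even number of $m$-simplices; (ii) $a$ is a simplicial involution of $\tilde\Sigma$ without fixed points on $|\tilde\Sigma|$; (iii) there is a continuous map $\varphi\colon|\tilde\Sigma|\to S^m$ with $\varphi(a(x))=-\varphi(x)$ and $\deg\varphi=1\pmod 2$. Here $\deg\varphi \pmod 2$ is the number modulo $2$ of $m$-simplices of (a subdivision of) $\tilde\Sigma$ that a simplicial approximation of $\varphi$ maps onto a fixed $m$-simplex of a triangulated $S^m$. *Products.* Order the vertices of each simplicial complex so that the order is linear on every simplex. For two such complexes $K,L$, the product $K\times L$ is the standard triangulation of $|K|\times|L|$: its vertices are the pairs of vertices, and its simplices are the finite nonempty chains, in the product order, that project onto a simplex of $K$ and onto a simplex of $L$. *Proper obstructors.* Let $T$ be a simplicial complex, and let $d\colon T\to T^2=T\times T$ be the diagonal map. For an integer $r>0$, let $N_r(d(T))$ be the $r$-fold iterated closed star neighborhood of $d(T)$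 in $T^2$, and let $T_r$ be the closure of $T^2-N_r(d(T))$, with $\mathbb Z_2$ acting by exchange of factors. The complex $T$ is an $m$-proper obstructor if $|T|$ is contractible and $m$ is the largest integer such that for every $r>0$ there are an essential $\mathbb Z_2$-$m$-cycle $(\tilde\Sigma,a)$ and a continuous $\mathbb Z_2$-equivariant map $|\tilde\Sigma|\to T_r$. *Metric form.* A contractible metric space $(X,d)$ is a metric $m$-proper obstructor if $m$ is the largest integer such that for every real $r>0$ there are an essential $\mathbb Z_2$-$m$-cycle $(\tilde\Sigma,a)$ and a continuous $\mathbb Z_2$-equivariant map $|\tilde\Sigma|\to\{(x,y)\in X\times X : d(x,y)\ge r\}$. **Proposition.** Let $m_1,m_2\ge 0$. 1. If the simplicial complex $X_1$ is an $m_1$-proper obstructor and the simplicial complex $X_2$ is an $m_2$-proper obstructor, then $X_1\times X_2$ is an $(m_1+m_2+1)$-proper obstructor. 2. The same holds in the metric form: if the metric space $X_1$ is a metric $m_1$-proper obstructor and the metric space $X_2$ is a metric $m_2$-proper obstructor, then $X_1\times X_2$ with the sup metric $d_{\sup}((x_1,x_2),(y_1,y_2))=\max\{d_1(x_1,y_1),d_2(x_2,y_2)\}$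 is a metric $(m_1+m_2+1)$-proper obstructor. -/

import Mathlib

noncomputable section

namespace Obstructor

open Set

universe u v w

/-! ### Simplicial complexes and their geometric realizations -/

/-- A simplicial complex whose vertices lie in `V`: a downward closed family of nonempty finite
subsets of `V`, called simplices. An element `v` of `V` is a vertex if `{v}` is a simplex, so that
subcomplexes are complexes on the same type `V`. -/
abbrev Complex (V : Type u) := PreAbstractSimplicialComplex V

/-- The points of the geometric realization `|K|`, in barycentric coordinates. -/
def Realization {V : Type u} (K : Complex V) : Type u :=
  {x : V →₀ ℝ // (∀ v, 0 ≤ x v) ∧ (x.sum fun _ t => t) = 1 ∧ x.support ∈ K.faces}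

/-- The closed simplex of `|K|` spanned by the vertices in `s`. -/
def Cell {V : Type u} (K : Complex V) (s : Finset V) : Type u :=
  {x : Realization K // x.1.support ⊆ s}

/-- A closed simplex has the Euclidean topology, that of its barycentric coordinates. -/
instance {V : Type u} (K : Complex V) (s : Finset V) : TopologicalSpace (Cell K s) :=
  TopologicalSpace.induced (fun x (v : V) => x.1.1 v) inferInstance

/-- The realization has the weak topology: a set is closed if and only if it meets every closed
simplex in a closed set. -/
instance {V : Type u} (K : Complex V) : TopologicalSpace (Realization K) :=
  ⨆ s : K.faces, TopologicalSpace.coinduced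
    (fun x : Cell K s.1 => (x.1 : Realization K)) inferInstance

/-- Simplicial maps between complexes. -/
structure SimplicialMap {V : Type u} {W : Type v} (K : Complex V) (L : Complex W) where
  toFun : V → W
  image_mem : ∀ s ∈ K.faces, open Classical in s.image toFun ∈ L.faces

/-- The map of realizations induced by a simplicial map, affine on every simplex. -/
def SimplicialMap.realize {V : Type u} {W : Type v} {K : Complex V} {L : Complex W}
    (f : SimplicialMap K L) (x : Realization K) : Realization L :=
  ⟨x.1.mapDomain f.toFun, by
    classical
    obtain ⟨x, h0, h1, hs⟩ := x
    have hsum : ((x.mapDomain f.toFun).sum fun _ t => t) = 1 := by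
      rw [Finsupp.sum_mapDomain_index (fun _ => rfl) (fun _ _ _ => rfl)]
      exact h1
    refine ⟨fun w => ?_, hsum, ?_⟩
    · rw [Finsupp.mapDomain, Finsupp.sum, Finsupp.finsetSum_apply]
      refine Finset.sum_nonneg fun i _ => ?_
      rw [Finsupp.single_apply]
      split_ifs
      · exact h0 i
      · exact le_rfl
    · have hsub : (x.mapDomain f.toFun).support ⊆ x.support.image f.toFun := by
        convert Finsupp.mapDomain_support (f := f.toFun) (s := x)
      have him : x.support.image f.toFun ∈ L.faces := by
        convert f.image_mem _ hs
      refine (L.isRelLowerSet_faces him).2 hsub ?_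
      rw [Finset.nonempty_iff_ne_empty]
      intro h
      rw [Finsupp.support_eq_empty] at h
      rw [h] at hsum
      simp at hsum⟩

/-! ### Subdivisions and the degree modulo two -/

/-- The complex `K'`, with each vertex `v` placed at the point `p v` of `|K|`, is a subdivision of
the finite complex `K`: every simplex of `K'` lies in a simplex of `K`, and every point of `|K|` is
the image of a unique point of `|K'|` under the affine extension of `p`. -/
structure IsSubdivision {V : Type u} {V' : Type v} (K : Complex V) (K' : Complex V')
    (p : V' → Realization K) : Prop where
  finite : K'.faces.Finite
  carrier : ∀ s ∈ K'.faces, ∃ t ∈ K.faces, ∀ v ∈ s, (p v).1.support ⊆ t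
  bijective : ∀ x : Realization K, ∃! y : Realization K', (y.1.sum fun v t => t • (p v).1) = x.1

/-- The unit sphere `S^m` in `ℝ^(m+1)`. -/
abbrev Sphere (m : ℕ) := Metric.sphere (0 : EuclideanSpace ℝ (Fin (m + 1))) 1

/-- The map `φ : |K| → S^m` has degree `1` modulo `2`. Here `S^m` is triangulated (radially) as the
boundary of the cross-polytope: its vertices are the points `ε e_i`, encoded as pairs `(i, ε)` with
`ε = ±1`, and the open star of `ε e_i` consists of the points `z` with `ε z_i > 0`. For some
subdivision `K'` of `K` and some simplicial approximation `g` of `φ` on `K'` (each open star of a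
vertex `v` is mapped by `φ` into the open star of `g v`), the number of `m`-simplices of `K'` that
are mapped by `g` onto the simplex spanned by `e_0, …, e_m` is odd. -/
def HasOddDegree {V : Type u} {K : Complex V} (m : ℕ) (φ : Realization K → Sphere m) : Prop :=
  open Classical in
  ∃ (V' : Type u) (K' : Complex V') (p : V' → Realization K) (g : V' → Fin (m + 1) × ℤˣ),
    IsSubdivision K K' p ∧
    (∀ (x : Realization K) (y : Realization K'), (y.1.sum fun v t => t • (p v).1) = x.1 →
      ∀ v, 0 < y.1 v → 0 < (((g v).2 : ℤ) : ℝ) * (φ x).1 (g v).1) ∧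
    Odd {s | s ∈ K'.faces ∧ s.card = m + 1 ∧
      s.image g = Finset.univ.image fun i : Fin (m + 1) => (i, (1 : ℤˣ))}.ncard

/-! ### Essential cycles -/

/-- `(S, a)` is an essential `ℤ₂`-`m`-cycle. -/
structure IsEssentialCycle {V : Type u} (m : ℕ) (S : Complex V) (a : SimplicialMap S S) :
    Prop where
  finite : S.faces.Finite
  /-- `|S|` is the union of its `m`-simplices -/
  pure : ∀ s ∈ S.faces, ∃ t ∈ S.faces, s ⊆ t ∧ t.card = m + 1
  /-- each `(m-1)`-simplex is a face of an even number of `m`-simplices -/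
  even : ∀ s ∈ S.faces, s.card = m → Even {t | t ∈ S.faces ∧ s ⊆ t ∧ t.card = m + 1}.ncard
  involutive : ∀ x : Realization S, a.realize (a.realize x) = x
  free : ∀ x : Realization S, a.realize x ≠ x
  exists_odd : ∃ φ : C(Realization S, Sphere m),
    (∀ x, φ (a.realize x) = -φ x) ∧ HasOddDegree m φ

/-- There are an essential `ℤ₂`-`m`-cycle `(S, a)` and a continuous equivariant map from `|S|` to
`Y`, where `ℤ₂` acts on `Y` through `τ`, with values in the subset `F` of `Y`. -/
def HasEssentialCycleIn (m : ℕ) {Y : Type u} [TopologicalSpace Y] (τ : Y → Y) (F : Set Y) :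
    Prop :=
  ∃ (V : Type) (S : Complex V) (a : SimplicialMap S S), IsEssentialCycle m S a ∧
    ∃ f : C(Realization S, Y), (∀ x, f (a.realize x) = τ (f x)) ∧ ∀ x, f x ∈ F

/-! ### Products of ordered complexes -/

/-- The order on `V` restricts to a linear order on every simplex. -/
def IsOrdered {V : Type u} [PartialOrder V] (K : Complex V) : Prop :=
  ∀ s ∈ K.faces, IsChain (· ≤ ·) (s : Set V)

/-- The standard triangulation of `|K| × |L|` for ordered complexes `K` and `L`: its vertices are
the pairs of vertices, and its simplices are the chains (in the product order) that project onto
simplices of `K` and of `L`. Each product of two simplices is a subcomplex. -/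
def prod {V : Type u} {W : Type v} [PartialOrder V] [PartialOrder W]
    (K : Complex V) (L : Complex W) : Complex (V × W) where
  faces := open Classical in {s | IsChain (· ≤ ·) (s : Set (V × W)) ∧
    s.image Prod.fst ∈ K.faces ∧ s.image Prod.snd ∈ L.faces}
  isRelLowerSet_faces := by
    classical
    intro s hs
    obtain ⟨hc, h1, h2⟩ := hs
    refine ⟨by simpa using (K.isRelLowerSet_faces h1).1, fun t hts ht => ⟨?_, ?_, ?_⟩⟩
    · exact hc.mono (by exact_mod_cast hts)
    · exact (K.isRelLowerSet_faces h1).2 (Finset.image_subset_image hts) (ht.image _)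
    · exact (L.isRelLowerSet_faces h2).2 (Finset.image_subset_image hts) (ht.image _)

/-- The exchange of factors of `K × K`. -/
def swap {V : Type u} [PartialOrder V] (K : Complex V) : SimplicialMap (prod K K) (prod K K) where
  toFun := Prod.swap
  image_mem := by
    classical
    rintro s ⟨hc, h1, h2⟩
    refine ⟨?_, ?_, ?_⟩
    · intro x hx y hy hxy
      simp only [Finset.coe_image, Set.mem_image, Finset.mem_coe] at hx hy
      obtain ⟨x, hx, rfl⟩ := hx
      obtain ⟨y, hy, rfl⟩ := hy
      have := hc hx hy (fun h => hxy (by rw [h]))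
      simpa [Prod.le_def, and_comm] using this
    · convert h2 using 1
      ext v
      simp
    · convert h1 using 1
      ext v
      simp

/-- The image of the diagonal map, a subcomplex of `K × K`. -/
def diagonal {V : Type u} [PartialOrder V] (K : Complex V) : Complex (V × V) where
  faces := {s | s ∈ (prod K K).faces ∧ ∀ z ∈ s, z.1 = z.2}
  isRelLowerSet_faces := fun _ hs =>
    ⟨((prod K K).isRelLowerSet_faces hs.1).1, fun _ hts ht =>
      ⟨((prod K K).isRelLowerSet_faces hs.1).2 hts ht, fun z hz => hs.2 z (hts hz)⟩⟩

/-- The closed star neighborhood in `K` of a subcomplex `L`: the union of all closed simplices of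
`K` that meet `L`. -/
def starNbhd {V : Type u} (K L : Complex V) : Complex V where
  faces := {s | s.Nonempty ∧ ∃ t ∈ K.faces, s ⊆ t ∧ ∃ v ∈ t, {v} ∈ L.faces}
  isRelLowerSet_faces := fun _ ⟨hs, t, ht, hst, hv⟩ =>
    ⟨hs, fun _ hrs hr => ⟨hr, t, ht, Finset.Subset.trans hrs hst, hv⟩⟩

/-- The combinatorial `r`-tubular neighborhood in `K` of a subcomplex `L`. -/
def tubularNbhd {V : Type u} (K L : Complex V) (r : ℕ) : Complex V :=
  (starNbhd K)^[r] L

/-- The underlying set, in `|K|`, of a subcomplex `L`. -/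
def underlyingSet {V : Type u} (K L : Complex V) : Set (Realization K) :=
  {x | x.1.support ∈ L.faces}

/-- `T_r`, the closure of the complement of the `r`-tubular neighborhood of the diagonal in
`T × T`. -/
def farSet {V : Type u} [PartialOrder V] (T : Complex V) (r : ℕ) : Set (Realization (prod T T)) :=
  closure (underlyingSet (prod T T) (tubularNbhd (prod T T) (diagonal T) r))ᶜ

/-! ### Proper obstructors -/

/-- The simplicial complex `T` is an `m`-proper obstructor: it is contractible, and `m` is the
largest integer such that for every `r > 0` there are an essential `ℤ₂`-`m`-cycle and an
equivariant map from it to `T_r`. -/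
def IsProperObstructor {V : Type u} [PartialOrder V] (m : ℕ) (T : Complex V) : Prop :=
  ContractibleSpace (Realization T) ∧
    IsGreatest {k : ℕ | ∀ r : ℕ, 0 < r →
      HasEssentialCycleIn k (swap T).realize (farSet T r)} m

/-- The metric form of the notion, in which `T_r` is replaced by the set of pairs of points at
distance at least `r`. -/
def IsMetricProperObstructor (m : ℕ) (X : Type u) [MetricSpace X] : Prop :=
  ContractibleSpace X ∧
    IsGreatest {k : ℕ | ∀ r : ℝ, 0 < r →
      HasEssentialCycleIn k (Prod.swap : X × X → X × X) {z | r ≤ dist z.1 z.2}} m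

end Obstructor

end

/-!
# Products of proper obstructors

The degree of an equivariant map from a free `ℤ₂`-cycle to the sphere with the antipodal action is,
modulo two, a characteristic number of the cycle: the value on the quotient cycle of the `m`-th
power of the first Stiefel-Whitney class of the double cover. Here it is computed upstairs by a dual
Smith sequence (`IsDualSmith`), a sequence of cochains `θ₋₁ = 1, θ₀, θ₁, …` with
`θᵢ + A^* θᵢ = δ θᵢ₋₁`. All such sequences take the same value on an invariant cycle
(`IsDualSmith.eval_eq`), they pull back along equivariant chain maps (`IsDualSmith.comp`), and the
boundary of the cross-polytope carries an explicit one, which counts a single facet in the top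
degree (`isDualSmith_fanCochain`, the cochain of Ky Fan's lemma). An invariant cycle of value `1` is
called an odd cycle (`IsOddCycle`). Up to equivariant maps, odd cycles and essential cycles are the
same:

* An essential cycle carries an odd cycle (`IsEssentialCycle.exists_isOddCycle`). A fine iterated
  barycentric subdivision, labelled by large coordinates of the map to the sphere, pulls back the
  cochain of the cross-polytope. Its value at the fundamental chain is the given degree, because the
  subdivision in the definition of the degree induces a chain map (`IsFan.bd_chainMap`) and because
  chain maps with a common carrier agree on top cycles (`eq_of_carried`).
* The complex of flags of an odd cycle is an essential cycle (`isEssentialCycle_flagComplex`); its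
  map to the sphere sends the barycenter of an `i`-simplex `s` to `±e_i`, where the sign is reversed
  by the involution.

*The product has cycles of dimension `m₁ + m₂ + 1`.* The join of an odd `m₁`-cycle and an odd
`m₂`-cycle is an odd cycle (`IsOddCycle.join`), by a product formula for dual Smith sequences
(`IsDualSmith.join`). Let the two cycles map to pairs of distant points of `X₁` and of `X₂`. As `X₁`
and `X₂` are contractible, the first components of the pairs extend over the join, constantly far
from the respective end, and equivariance determines the second components. Every point of the join
is in the half close to one of its ends, where the corresponding pair is the value of the given map
at the projection to this end (`HasEssentialCycleIn.join`).

*It has none of larger dimension.* Pairs that are distant in `X₁ × X₂` are distant in `X₁` or in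
`X₂`, so an essential `(p + q)`-cycle with `p > m₁` and `q > m₂` is covered by two invariant open
sets. If the first contained no odd `p`-cycle and the second no odd `q`-cycle, then dual Smith
sequences of the two parts could be chosen to vanish in degrees from `p` and from `q` on
(`IsDualSmith.exists_truncated`, by linear duality). Their join, on a subdivision so fine that each
vertex can be assigned to one of the sets together with its neighbors, vanishes in degree `p + q`,
although the cycle is odd (`IsEssentialCycle.exists_of_cover`).

In the simplicial form, a point of the product of two ordered complexes is a pair of points of the
factors (`exists_pair`, `eq_of_proj`), and a map from a compact space to it is continuous if both
components are (`continuous_of_proj`). Simplicial maps respect tubular neighborhoods of the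
diagonals, and a point of the square of the product whose projections are in the `r₁`- and in the
`r₂`-neighborhood is in the `(r₁ + r₂ + 1)`-neighborhood (`mem_tubularNbhd_of_square`).
-/

noncomputable section

set_option linter.unusedSectionVars false

namespace Obstructor

/-! ### Chains modulo two -/

/-- The augmented simplicial chains modulo two on the full simplex with vertex set `X`: finite
formal sums of finite subsets of `X`. The empty set is the generator of degree `-1`; a set with `n`
elements has degree `n - 1`. -/
abbrev Chain (X : Type*) := Finset X →₀ ZMod 2

/-- A finite set of vertices, as a chain. -/
abbrev simplex {X : Type*} (s : Finset X) : Chain X := Finsupp.single s 1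

/-- The chains that are sums of members of `G`. -/
abbrev chainsIn {X : Type*} (G : Set (Finset X)) : Submodule (ZMod 2) (Chain X) :=
  Finsupp.supported (ZMod 2) (ZMod 2) G

section Chains

variable {X Y Z M : Type*} [AddCommGroup M] [Module (ZMod 2) M]

lemma simplex_mem {G : Set (Finset X)} {s : Finset X} (hs : s ∈ G) : simplex s ∈ chainsIn G :=
  Finsupp.single_mem_supported _ _ hs

lemma chainsIn_mono {G H : Set (Finset X)} {c : Chain X} (hc : c ∈ chainsIn G) (h : G ⊆ H) :
    c ∈ chainsIn H :=
  Finsupp.supported_mono h hc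

lemma chainsIn_induction {G : Set (Finset X)} {p : Chain X → Prop} {c : Chain X}
    (hc : c ∈ chainsIn G) (h0 : p 0) (hadd : ∀ a b, p a → p b → p (a + b))
    (hs : ∀ s ∈ G, p (simplex s)) : p c := by
  rw [chainsIn, Finsupp.supported_eq_span_single] at hc
  induction hc using Submodule.span_induction with
  | mem x hx => obtain ⟨s, hs', rfl⟩ := hx; exact hs s hs'
  | zero => exact h0
  | add a b _ _ ha hb => exact hadd a b ha hb
  | smul t a _ ha =>
    rcases (show t = 0 ∨ t = 1 by revert t; decide) with rfl | rfl
    · rwa [zero_smul]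
    · rwa [one_smul]

lemma map_mem_of_chainsIn {G : Set (Finset X)} {c : Chain X} (hc : c ∈ chainsIn G)
    (F : Chain X →ₗ[ZMod 2] M) {N : Submodule (ZMod 2) M} (h : ∀ s ∈ G, F (simplex s) ∈ N) :
    F c ∈ N := by
  refine chainsIn_induction (p := fun c => F c ∈ N) hc ?_ ?_ h
  · simp
  · intro a b ha hb
    rw [map_add]
    exact N.add_mem ha hb

lemma eqOn_chainsIn {G : Set (Finset X)} {c : Chain X} (hc : c ∈ chainsIn G)
    {F F' : Chain X →ₗ[ZMod 2] M} (h : ∀ s ∈ G, F (simplex s) = F' (simplex s)) :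
    F c = F' c := by
  refine chainsIn_induction (p := fun c => F c = F' c) hc ?_ ?_ h
  · simp
  · intro a b ha hb
    rw [map_add, map_add, ha, hb]

lemma mem_chainsIn_univ (c : Chain X) : c ∈ chainsIn (Set.univ : Set (Finset X)) := by
  simp [chainsIn]

lemma chain_hom_ext {F F' : Chain X →ₗ[ZMod 2] M} (h : ∀ s, F (simplex s) = F' (simplex s)) :
    F = F' :=
  LinearMap.ext fun c => eqOn_chainsIn (mem_chainsIn_univ c) fun s _ => h s

lemma eq_of_simplex {F F' : Chain X →ₗ[ZMod 2] M} (h : ∀ s, F (simplex s) = F' (simplex s))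
    (c : Chain X) : F c = F' c := by
  rw [chain_hom_ext h]

/-- The linear extension of a function on simplices. -/
def chainLift (F : Finset X → M) : Chain X →ₗ[ZMod 2] M := Finsupp.linearCombination (ZMod 2) F

@[simp] lemma chainLift_simplex (F : Finset X → M) (s : Finset X) :
    chainLift F (simplex s) = F s := by
  simp [chainLift]

lemma chainLift_eq_sum (F : Finset X → M) (c : Chain X) :
    chainLift F c = ∑ s ∈ c.support, F s := by
  rw [chainLift, Finsupp.linearCombination_apply, Finsupp.sum]
  refine Finset.sum_congr rfl fun s hs => ?_
  have h : c s = 1 := by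
    exact (show ∀ t : ZMod 2, t ≠ 0 → t = 1 by decide) _ (Finsupp.mem_support_iff.1 hs)
  rw [h, one_smul]

variable [DecidableEq X] [DecidableEq Y] [DecidableEq Z]

/-- The boundary. -/
def bd : Chain X →ₗ[ZMod 2] Chain X := chainLift fun s => ∑ v ∈ s, simplex (s.erase v)

lemma bd_simplex (s : Finset X) : bd (simplex s) = ∑ v ∈ s, simplex (s.erase v) := by
  simp [bd]

@[simp] lemma bd_simplex_empty : bd (simplex (∅ : Finset X)) = 0 := by
  simp [bd_simplex]

/-- The cone with apex `v`; it vanishes on the simplices that contain `v`. -/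
def cone (v : X) : Chain X →ₗ[ZMod 2] Chain X :=
  chainLift fun s => if v ∈ s then 0 else simplex (insert v s)

lemma cone_simplex_of_mem {v : X} {s : Finset X} (h : v ∈ s) : cone v (simplex s) = 0 := by
  simp [cone, h]

lemma cone_simplex_of_notMem {v : X} {s : Finset X} (h : v ∉ s) :
    cone v (simplex s) = simplex (insert v s) := by
  simp [cone, h]

lemma bd_cone (v : X) (c : Chain X) : bd (cone v c) = c + cone v (bd c) := by
  refine eq_of_simplex (F := bd ∘ₗ cone v) (F' := LinearMap.id + cone v ∘ₗ bd) (fun s => ?_) c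
  simp only [LinearMap.comp_apply, LinearMap.add_apply, LinearMap.id_apply]
  by_cases h : v ∈ s
  · rw [cone_simplex_of_mem h, map_zero, bd_simplex, map_sum, Finset.sum_eq_single v,
      cone_simplex_of_notMem (Finset.notMem_erase v s), Finset.insert_erase h, ZModModule.add_self]
    · intro u hu huv
      exact cone_simplex_of_mem (Finset.mem_erase.2 ⟨huv.symm, h⟩)
    · exact fun h' => absurd h h'
  · rw [cone_simplex_of_notMem h, bd_simplex, Finset.sum_insert h, Finset.erase_insert h,
      bd_simplex, map_sum]
    congr 1
    refine Finset.sum_congr rfl fun u hu => ?_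
    have huv : v ≠ u := fun e => h (e ▸ hu)
    rw [cone_simplex_of_notMem fun h' => h (Finset.mem_of_mem_erase h'),
      Finset.erase_insert_of_ne huv]

lemma bd_bd (c : Chain X) : bd (bd c) = 0 := by
  suffices h : bd ∘ₗ bd = (0 : Chain X →ₗ[ZMod 2] Chain X) from LinearMap.congr_fun h c
  refine chain_hom_ext fun s => ?_
  simp only [LinearMap.comp_apply, LinearMap.zero_apply]
  induction s using Finset.induction_on with
  | empty => simp
  | insert v s h ih =>
    rw [← cone_simplex_of_notMem h, bd_cone, map_add, bd_cone, ih, map_zero, add_zero,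
      ZModModule.add_self]

lemma bd_apply (c : Chain X) (t : Finset X) :
    bd c t = ((c.support.filter fun s => t ⊆ s ∧ s.card = t.card + 1).card : ZMod 2) := by
  rw [bd, chainLift_eq_sum, Finsupp.finsetSum_apply, Finset.card_filter, Nat.cast_sum]
  refine Finset.sum_congr rfl fun s _ => ?_
  rw [Finsupp.finsetSum_apply]
  split_ifs with h
  · obtain ⟨h, hc⟩ := h
    obtain ⟨v, hv⟩ : ∃ v, s \ t = {v} := by
      rw [← Finset.card_eq_one, Finset.card_sdiff_of_subset h, hc]
      omega
    have hvs : v ∈ s \ t := hv ▸ Finset.mem_singleton_self v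
    have ht : s.erase v = t := by
      rw [← Finset.sdiff_singleton_eq_erase, ← hv, Finset.sdiff_sdiff_eq_self h]
    rw [Finset.sum_eq_single v, ht]
    · simp
    · intro u hu huv
      rw [Finsupp.single_apply, if_neg]
      intro e
      have hut : u ∈ t := by
        by_contra hut
        have : u ∈ s \ t := Finset.mem_sdiff.2 ⟨hu, hut⟩
        rw [hv, Finset.mem_singleton] at this
        exact huv this
      rw [← e] at hut
      exact Finset.notMem_erase u s hut
    · exact fun h' => absurd (Finset.mem_sdiff.1 hvs).1 h'
  · rw [Nat.cast_zero]
    refine Finset.sum_eq_zero fun v hv => ?_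
    rw [Finsupp.single_apply, if_neg]
    rintro rfl
    refine h ⟨Finset.erase_subset _ _, ?_⟩
    rw [Finset.card_erase_of_mem hv]
    have := Finset.card_pos.2 ⟨v, hv⟩
    omega

lemma bd_mem {G H : Set (Finset X)} (hG : ∀ s ∈ G, ∀ v ∈ s, s.erase v ∈ H) {c : Chain X}
    (hc : c ∈ chainsIn G) : bd c ∈ chainsIn H :=
  map_mem_of_chainsIn hc bd fun s hs => by
    rw [bd_simplex]
    exact Submodule.sum_mem _ fun v hv => simplex_mem (hG s hs v hv)

/-- The chain map induced by a map of vertices; it vanishes on the simplices on which the map is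
not injective. -/
def push (f : X → Y) : Chain X →ₗ[ZMod 2] Chain Y :=
  chainLift fun s => if (s.image f).card = s.card then simplex (s.image f) else 0

lemma push_simplex_of_injOn {f : X → Y} {s : Finset X} (h : Set.InjOn f s) :
    push f (simplex s) = simplex (s.image f) := by
  simp [push, Finset.card_image_of_injOn h]

lemma push_simplex_of_not_injOn {f : X → Y} {s : Finset X} (h : ¬ Set.InjOn f s) :
    push f (simplex s) = 0 := by
  have : (s.image f).card ≠ s.card := fun e => h (Finset.injOn_of_card_image_eq e)
  simp [push, this]

@[simp] lemma push_simplex_empty (f : X → Y) : push f (simplex ∅) = simplex ∅ := by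
  simp [push]

lemma push_simplex_mem (f : X → Y) (s : Finset X) :
    push f (simplex s) ∈ chainsIn {t | t = s.image f ∧ t.card = s.card} := by
  by_cases h : Set.InjOn f s
  · rw [push_simplex_of_injOn h]
    exact simplex_mem ⟨rfl, Finset.card_image_of_injOn h⟩
  · rw [push_simplex_of_not_injOn h]
    exact Submodule.zero_mem _

lemma push_cone (f : X → Y) (v : X) (c : Chain X) :
    push f (cone v c) = cone (f v) (push f c) := by
  refine eq_of_simplex (F := push f ∘ₗ cone v) (F' := cone (f v) ∘ₗ push f) (fun s => ?_) c
  simp only [LinearMap.comp_apply]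
  by_cases h : v ∈ s
  · rw [cone_simplex_of_mem h, map_zero]
    by_cases hf : Set.InjOn f s
    · rw [push_simplex_of_injOn hf, cone_simplex_of_mem (Finset.mem_image_of_mem f h)]
    · rw [push_simplex_of_not_injOn hf, map_zero]
  · rw [cone_simplex_of_notMem h]
    have hi : Set.InjOn f (insert v s : Finset X) ↔ Set.InjOn f s ∧ f v ∉ s.image f := by
      rw [Finset.coe_insert, Set.injOn_insert (by exact_mod_cast h)]
      simp
    by_cases hf : Set.InjOn f s
    · by_cases hv : f v ∈ s.image f
      · rw [push_simplex_of_injOn hf, cone_simplex_of_mem hv,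
          push_simplex_of_not_injOn fun h' => (hi.1 h').2 hv]
      · rw [push_simplex_of_injOn hf, cone_simplex_of_notMem hv,
          push_simplex_of_injOn (hi.2 ⟨hf, hv⟩), Finset.image_insert]
    · rw [push_simplex_of_not_injOn hf, map_zero,
        push_simplex_of_not_injOn fun h' => hf (hi.1 h').1]

lemma bd_push (f : X → Y) (c : Chain X) : bd (push f c) = push f (bd c) := by
  refine eq_of_simplex (F := bd ∘ₗ push f) (F' := push f ∘ₗ bd) (fun s => ?_) c
  simp only [LinearMap.comp_apply]
  induction s using Finset.induction_on with
  | empty => simp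
  | insert v s h ih =>
    rw [← cone_simplex_of_notMem h, push_cone, bd_cone, bd_cone, map_add, push_cone, ih]

lemma push_push (f : X → Y) (g : Y → Z) (c : Chain X) :
    push g (push f c) = push (g ∘ f) c := by
  refine eq_of_simplex (F := push g ∘ₗ push f) (F' := push (g ∘ f)) (fun s => ?_) c
  simp only [LinearMap.comp_apply]
  induction s using Finset.induction_on with
  | empty => simp
  | insert v s h ih =>
    rw [← cone_simplex_of_notMem h, push_cone, push_cone, push_cone, ih, Function.comp_apply]

lemma push_congr {f g : X → Y} {s : Finset X} (h : ∀ v ∈ s, f v = g v) :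
    push f (simplex s) = push g (simplex s) := by
  simp only [push, chainLift_simplex, Finset.image_congr (fun v hv => h v hv)]

@[simp] lemma push_id (c : Chain X) : push (fun x : X => x) c = c := by
  refine eq_of_simplex (F := push fun x : X => x) (F' := LinearMap.id) (fun s => ?_) c
  rw [push_simplex_of_injOn fun _ _ _ _ h => h]
  simp

lemma push_mem {f : X → Y} {G : Set (Finset X)} {H : Set (Finset Y)}
    (h : ∀ s ∈ G, s.image f ∈ H) {c : Chain X} (hc : c ∈ chainsIn G) : push f c ∈ chainsIn H :=
  map_mem_of_chainsIn hc _ fun s hs => Finsupp.supported_mono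
    (by rintro t ⟨rfl, -⟩; exact h s hs) (push_simplex_mem f s)

lemma push_apply (f : X → Y) (c : Chain X) (t : Finset Y) :
    push f c t
      = ((c.support.filter fun s => s.image f = t ∧ s.card = t.card).card : ZMod 2) := by
  rw [push, chainLift_eq_sum, Finsupp.finsetSum_apply, Finset.card_filter, Nat.cast_sum]
  refine Finset.sum_congr rfl fun s _ => ?_
  split_ifs with h1 h2 h2
  · simp [h2.1]
  · rw [Finsupp.single_apply, if_neg]
    · simp
    · rintro rfl
      exact h2 ⟨rfl, h1.symm⟩
  · exact absurd (by rw [h2.1, h2.2]) h1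
  · simp

/-! ### Chain maps and homotopies built by coning -/

/-- Auxiliary recursion for `coneExt`, on the number of vertices. -/
def coneExtAux (w : Finset X → Y) (e : Chain Y) (b : Finset X → Chain Y) :
    ℕ → Finset X → Chain Y
  | 0, _ => e
  | n + 1, s => cone (w s) (b s + ∑ v ∈ s, coneExtAux w e b n (s.erase v))

/-- The linear map `T` with `T ∅ = e` and `T s = w(s) * (b(s) + T(∂s))` for nonempty `s`, where
`w(s) *` denotes the cone with apex `w(s)`. -/
def coneExt (w : Finset X → Y) (e : Chain Y) (b : Finset X → Chain Y) :
    Chain X →ₗ[ZMod 2] Chain Y :=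
  chainLift fun s => coneExtAux w e b s.card s

@[simp] lemma coneExt_empty (w : Finset X → Y) (e : Chain Y) (b : Finset X → Chain Y) :
    coneExt w e b (simplex ∅) = e := by
  simp [coneExt, coneExtAux]

lemma coneExt_simplex (w : Finset X → Y) (e : Chain Y) (b : Finset X → Chain Y) {s : Finset X}
    (hs : s.Nonempty) :
    coneExt w e b (simplex s) = cone (w s) (b s + coneExt w e b (bd (simplex s))) := by
  obtain ⟨n, hn⟩ : ∃ n, s.card = n + 1 := ⟨s.card - 1, by have := hs.card_pos; omega⟩
  rw [bd_simplex, map_sum, coneExt, chainLift_simplex, hn, coneExtAux]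
  congr 2
  refine Finset.sum_congr rfl fun v hv => ?_
  rw [chainLift_simplex, Finset.card_erase_of_mem hv, hn, Nat.add_sub_cancel]

/-- The chain map `Φ` with `Φ ∅ = ∅` and `Φ s = w(s) * Φ(∂s)`. If `w s` is the barycenter of `s`,
it is the barycentric subdivision operator; if `w s = s`, it sends a simplex to the sum of its full
flags. -/
def subdiv (w : Finset X → Y) : Chain X →ₗ[ZMod 2] Chain Y :=
  coneExt w (simplex ∅) fun _ => 0

@[simp] lemma subdiv_empty (w : Finset X → Y) : subdiv w (simplex ∅) = simplex ∅ :=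
  coneExt_empty _ _ _

lemma subdiv_simplex (w : Finset X → Y) {s : Finset X} (hs : s.Nonempty) :
    subdiv w (simplex s) = cone (w s) (subdiv w (bd (simplex s))) := by
  rw [subdiv, coneExt_simplex w _ _ hs, zero_add]

lemma map_bd_simplex_congr {F F' : Chain X →ₗ[ZMod 2] M} {s : Finset X}
    (h : ∀ t ⊂ s, F (simplex t) = F' (simplex t)) : F (bd (simplex s)) = F' (bd (simplex s)) := by
  rw [bd_simplex, map_sum, map_sum]
  exact Finset.sum_congr rfl fun v hv => h _ (Finset.erase_ssubset hv)

lemma bd_subdiv (w : Finset X → Y) (c : Chain X) : bd (subdiv w c) = subdiv w (bd c) := by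
  refine eq_of_simplex (F := bd ∘ₗ subdiv w) (F' := subdiv w ∘ₗ bd) (fun s => ?_) c
  induction s using Finset.strongInduction with
  | H s ih =>
  rcases s.eq_empty_or_nonempty with rfl | hs
  · simp
  · have := map_bd_simplex_congr ih
    simp only [LinearMap.comp_apply] at this ⊢
    rw [subdiv_simplex w hs, bd_cone, this, bd_bd, map_zero, map_zero, add_zero]

lemma push_subdiv (w : Finset X → Y) (f : Y → Z) (c : Chain X) :
    push f (subdiv w c) = subdiv (fun s => f (w s)) c := by
  refine eq_of_simplex (F := push f ∘ₗ subdiv w) (F' := subdiv fun s => f (w s)) (fun s => ?_) c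
  induction s using Finset.strongInduction with
  | H s ih =>
  rcases s.eq_empty_or_nonempty with rfl | hs
  · simp
  · have := map_bd_simplex_congr ih
    simp only [LinearMap.comp_apply] at this ⊢
    rw [subdiv_simplex w hs, push_cone, this, subdiv_simplex _ hs]

/-- Naturality of `subdiv` with respect to maps of vertices. -/
lemma subdiv_push {w : Finset X → Y} {w' : Finset Z → Y} {f : X → Z} {s : Finset X}
    (h : ∀ t ⊆ s, t.Nonempty → w' (t.image f) = w t) :
    subdiv w' (push f (simplex s)) = subdiv w (simplex s) := by
  induction s using Finset.strongInduction with
  | H s ih =>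
  rcases s.eq_empty_or_nonempty with rfl | hs
  · simp
  have h1 : subdiv w' (push f (bd (simplex s))) = subdiv w (bd (simplex s)) :=
    map_bd_simplex_congr (F := subdiv w' ∘ₗ push f) (F' := subdiv w) fun t ht =>
      ih t ht fun r hr => h r (hr.trans ht.subset)
  rw [subdiv_simplex w hs, ← h1, ← bd_push]
  by_cases hf : Set.InjOn f s
  · rw [push_simplex_of_injOn hf, subdiv_simplex _ (hs.image f), h s subset_rfl hs]
  · simp only [push_simplex_of_not_injOn hf, map_zero]

lemma cone_mem {v : Y} {G H : Set (Finset Y)} (h : ∀ t ∈ G, v ∉ t → insert v t ∈ H) {c : Chain Y}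
    (hc : c ∈ chainsIn G) : cone v c ∈ chainsIn H :=
  map_mem_of_chainsIn hc _ fun t ht => by
    by_cases hv : v ∈ t
    · rw [cone_simplex_of_mem hv]
      exact Submodule.zero_mem _
    · rw [cone_simplex_of_notMem hv]
      exact simplex_mem (h t ht hv)

/-- `t` is the image under `w` of a flag of nonempty subsets of `s`. -/
def IsFlagImage (w : Finset X → Y) (s : Finset X) (t : Finset Y) : Prop :=
  ∃ F : Finset (Finset X), (∀ r ∈ F, r ⊆ s ∧ r.Nonempty) ∧
    IsChain (· ⊆ ·) (F : Set (Finset X)) ∧ t = F.image w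

lemma subdiv_mem (w : Finset X → Y) (s : Finset X) :
    subdiv w (simplex s) ∈ chainsIn {t | IsFlagImage w s t ∧ t.card = s.card} := by
  induction s using Finset.strongInduction with
  | H s ih =>
  rcases s.eq_empty_or_nonempty with rfl | hs
  · rw [subdiv_empty]
    exact simplex_mem ⟨⟨∅, by simp, by simp, by simp⟩, by simp⟩
  rw [subdiv_simplex w hs, bd_simplex, map_sum, map_sum]
  refine Submodule.sum_mem _ fun v hv => ?_
  refine cone_mem ?_ (ih _ (Finset.erase_ssubset hv))
  rintro t ⟨⟨F, h1, h2, rfl⟩, hc⟩ hn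
  refine ⟨⟨insert s F, ?_, ?_, ?_⟩, ?_⟩
  · intro r hr
    rcases Finset.mem_insert.1 hr with rfl | hr
    · exact ⟨subset_rfl, hs⟩
    · exact ⟨(h1 r hr).1.trans (Finset.erase_subset _ _), (h1 r hr).2⟩
  · rw [Finset.coe_insert]
    exact h2.insert fun r hr _ => Or.inr ((h1 r hr).1.trans (Finset.erase_subset _ _))
  · rw [Finset.image_insert]
  · rw [Finset.card_insert_of_notMem hn, hc, Finset.card_erase_of_mem hv]
    have := hs.card_pos
    omega

/-- The cone construction of a chain homotopy between two chain maps `F` and `F'` that agree on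
the empty simplex; `w` chooses the apexes. -/
def homotopy (F F' : Chain X →ₗ[ZMod 2] Chain Y) (w : Finset X → Y) :
    Chain X →ₗ[ZMod 2] Chain Y :=
  coneExt w 0 fun s => F (simplex s) + F' (simplex s)

lemma bd_homotopy {G : Set (Finset X)} (hG : ∀ s ∈ G, ∀ v ∈ s, s.erase v ∈ G)
    {F F' : Chain X →ₗ[ZMod 2] Chain Y} (w : Finset X → Y)
    (hF : ∀ s ∈ G, bd (F (simplex s)) = F (bd (simplex s)))
    (hF' : ∀ s ∈ G, bd (F' (simplex s)) = F' (bd (simplex s)))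
    (h0 : F (simplex ∅) = F' (simplex ∅)) {c : Chain X} (hc : c ∈ chainsIn G) :
    bd (homotopy F F' w c) = F c + F' c + homotopy F F' w (bd c) := by
  refine eqOn_chainsIn (F := bd ∘ₗ homotopy F F' w) (F' := F + F' + homotopy F F' w ∘ₗ bd) hc ?_
  intro s
  induction s using Finset.strongInduction with
  | H s ih =>
  intro hsG
  simp only [LinearMap.comp_apply, LinearMap.add_apply] at ih ⊢
  rcases s.eq_empty_or_nonempty with rfl | hs
  · simp [homotopy, h0, ZModModule.add_self]
  have h1 : bd (homotopy F F' w (bd (simplex s)))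
      = F (bd (simplex s)) + F' (bd (simplex s)) + homotopy F F' w (bd (bd (simplex s))) := by
    rw [bd_simplex]
    simp only [map_sum]
    rw [← Finset.sum_add_distrib, ← Finset.sum_add_distrib]
    exact Finset.sum_congr rfl fun v hv => ih _ (Finset.erase_ssubset hv) (hG s hsG v hv)
  rw [bd_bd, map_zero, add_zero] at h1
  rw [homotopy, coneExt_simplex w _ _ hs, bd_cone, ← homotopy, map_add, map_add, h1,
    map_add, hF s hsG,
    hF' s hsG, ZModModule.add_self]
  rw [add_zero]

/-- The homotopy between two chain maps with a common carrier `κ` has this carrier as well. -/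
lemma homotopy_mem {F F' : Chain X →ₗ[ZMod 2] Chain Y} {w : Finset X → Y} {G : Set (Finset X)}
    (hG : ∀ s ∈ G, ∀ v ∈ s, s.erase v ∈ G) {κ : Finset X → Set Y}
    (hκ : ∀ s ∈ G, ∀ v ∈ s, κ (s.erase v) ⊆ κ s)
    (hw : ∀ s ∈ G, s.Nonempty → w s ∈ κ s)
    (hF : ∀ s ∈ G, F (simplex s) ∈ chainsIn {t | (t : Set Y) ⊆ κ s ∧ t.card = s.card})
    (hF' : ∀ s ∈ G, F' (simplex s) ∈ chainsIn {t | (t : Set Y) ⊆ κ s ∧ t.card = s.card})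
    {s : Finset X} (hsG : s ∈ G) :
    homotopy F F' w (simplex s) ∈ chainsIn {t | (t : Set Y) ⊆ κ s ∧ t.card = s.card + 1} := by
  induction s using Finset.strongInduction with
  | H s ih =>
  rcases s.eq_empty_or_nonempty with rfl | hs
  · simp [homotopy]
  rw [homotopy, coneExt_simplex w _ _ hs, ← homotopy]
  refine cone_mem (G := {t | (t : Set Y) ⊆ κ s ∧ t.card = s.card}) ?_ ?_
  · rintro t ⟨h1, h2⟩ hn
    refine ⟨?_, by rw [Finset.card_insert_of_notMem hn, h2]⟩
    rw [Finset.coe_insert]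
    exact Set.insert_subset (hw s hsG hs) h1
  · refine Submodule.add_mem _ (Submodule.add_mem _ (hF s hsG) (hF' s hsG)) ?_
    rw [bd_simplex, map_sum]
    refine Submodule.sum_mem _ fun v hv => ?_
    refine Finsupp.supported_mono ?_ (ih _ (Finset.erase_ssubset hv) (hG s hsG v hv))
    rintro t ⟨h1, h2⟩
    refine ⟨h1.trans (hκ s hsG v hv), ?_⟩
    rw [h2, Finset.card_erase_of_mem hv]
    have := hs.card_pos
    omega

/-- Two chain maps with a common carrier agree on the cycles of a degree in which the carriers have
no simplices of one dimension more. -/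
lemma eq_of_carried {F F' : Chain X →ₗ[ZMod 2] Chain Y} {w : Finset X → Y} {G : Set (Finset X)}
    (hG : ∀ s ∈ G, ∀ v ∈ s, s.erase v ∈ G) {κ : Finset X → Set Y}
    (hκ : ∀ s ∈ G, ∀ v ∈ s, κ (s.erase v) ⊆ κ s)
    (hw : ∀ s ∈ G, s.Nonempty → w s ∈ κ s)
    (hF : ∀ s ∈ G, F (simplex s) ∈ chainsIn {t | (t : Set Y) ⊆ κ s ∧ t.card = s.card})
    (hF' : ∀ s ∈ G, F' (simplex s) ∈ chainsIn {t | (t : Set Y) ⊆ κ s ∧ t.card = s.card})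
    (hbF : ∀ s ∈ G, bd (F (simplex s)) = F (bd (simplex s)))
    (hbF' : ∀ s ∈ G, bd (F' (simplex s)) = F' (bd (simplex s)))
    (h0 : F (simplex ∅) = F' (simplex ∅)) {n : ℕ}
    (hn : ∀ s ∈ G, ∀ t : Finset Y, (t : Set Y) ⊆ κ s → t.card ≤ n) {c : Chain X}
    (hc : c ∈ chainsIn (G ∩ {s | s.card = n})) (hbc : bd c = 0) : F c = F' c := by
  have h1 := bd_homotopy hG w hbF hbF' h0 (Finsupp.supported_mono Set.inter_subset_left hc)
  have h2 : homotopy F F' w c = 0 := by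
    refine eqOn_chainsIn (F' := 0) hc fun s hs => ?_
    have h3 := homotopy_mem hG hκ hw hF hF' hs.1
    have h4 : {t : Finset Y | (t : Set Y) ⊆ κ s ∧ t.card = s.card + 1} = ∅ := by
      ext t
      simp only [Set.mem_ofPred_eq, Set.mem_empty_iff_false, iff_false, not_and]
      intro ht hc'
      have h5 := hn s hs.1 t ht
      have h6 : s.card = n := hs.2
      omega
    rw [h4] at h3
    simpa using h3
  rw [h2, hbc, map_zero, map_zero, add_zero] at h1
  rw [← sub_eq_zero, ZModModule.sub_eq_add, ← h1]

end Chains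

/-! ### Dual Smith sequences -/

section Smith

variable {X Y : Type*} [DecidableEq X] [DecidableEq Y]

/-- A family of finite sets, closed under passing to subsets, on whose nonempty members the
involution `A` of the vertex set acts freely. -/
structure IsFreeFamily (G : Set (Finset X)) (A : X → X) : Prop where
  involutive : Function.Involutive A
  subset : ∀ s ∈ G, ∀ t ⊆ s, t ∈ G
  image : ∀ s ∈ G, s.image A ∈ G
  free : ∀ s ∈ G, s.Nonempty → s.image A ≠ s

lemma IsFreeFamily.erase {G : Set (Finset X)} {A : X → X} (h : IsFreeFamily G A) :
    ∀ s ∈ G, ∀ v ∈ s, s.erase v ∈ G :=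
  fun s hs v _ => h.subset s hs _ (Finset.erase_subset v s)

lemma IsFreeFamily.mono {G H : Set (Finset X)} {A : X → X} (h : IsFreeFamily G A) (hH : H ⊆ G)
    (h1 : ∀ s ∈ H, ∀ t ⊆ s, t ∈ H) (h2 : ∀ s ∈ H, s.image A ∈ H) : IsFreeFamily H A :=
  ⟨h.involutive, h1, h2, fun s hs => h.free s (hH hs)⟩

/-- A sequence of cochains `θ₀, θ₁, …`, written as a single function on finite sets (which
remembers the degree), with `θ₋₁ = 1` and `θᵢ + A^* θᵢ = δ θᵢ₋₁`. On the quotient by the free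
involution `A`, the cochain `θᵢ` represents a transfer preimage of the `i`-th power of the
characteristic class; its value on an invariant cycle is the characteristic number of the
quotient cycle. -/
structure IsDualSmith (G : Set (Finset X)) (A : X → X) (θ : Finset X → ZMod 2) : Prop where
  empty : θ ∅ = 1
  add : ∀ s ∈ G, θ s + θ (s.image A) = chainLift θ (bd (simplex s))

lemma IsDualSmith.mono {G H : Set (Finset X)} {A : X → X} {θ : Finset X → ZMod 2}
    (h : IsDualSmith G A θ) (hH : H ⊆ G) : IsDualSmith H A θ :=
  ⟨h.empty, fun s hs => h.add s (hH hs)⟩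

lemma push_simplex_of_injective {f : X → Y} (hf : Function.Injective f) (s : Finset X) :
    push f (simplex s) = simplex (s.image f) :=
  push_simplex_of_injOn hf.injOn

lemma image_image_of_involutive {A : X → X} (hA : Function.Involutive A) (s : Finset X) :
    (s.image A).image A = s := by
  rw [Finset.image_image, hA.comp_self, Finset.image_id]

lemma push_involutive {A : X → X} (hA : Function.Involutive A) (c : Chain X) :
    push A (push A c) = c := by
  rw [push_push, hA.comp_self]
  exact push_id c

lemma push_involutive_apply {A : X → X} (hA : Function.Involutive A) (c : Chain X)
    (t : Finset X) : push A c t = c (t.image A) := by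
  have h : ∀ c : Chain X, (Finsupp.lapply t ∘ₗ push A) c
      = (Finsupp.lapply (t.image A) : Chain X →ₗ[ZMod 2] ZMod 2) c := by
    refine eq_of_simplex fun s => ?_
    rw [LinearMap.comp_apply, push_simplex_of_injective hA.injective, Finsupp.lapply_apply,
      Finsupp.lapply_apply, Finsupp.single_apply, Finsupp.single_apply]
    refine if_congr ⟨?_, ?_⟩ rfl rfl
    · rintro rfl
      rw [image_image_of_involutive hA]
    · rintro rfl
      rw [image_image_of_involutive hA]
  exact h c

lemma IsDualSmith.eval_add {G : Set (Finset X)} {A : X → X} {θ : Finset X → ZMod 2}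
    (h : IsDualSmith G A θ) (hA : Function.Involutive A) {x : Chain X} (hx : x ∈ chainsIn G) :
    chainLift θ (x + push A x) = chainLift θ (bd x) := by
  refine eqOn_chainsIn (F := chainLift θ ∘ₗ (LinearMap.id + push A)) (F' := chainLift θ ∘ₗ bd) hx
    fun s hs => ?_
  simp only [LinearMap.comp_apply, LinearMap.add_apply, LinearMap.id_apply, map_add]
  rw [push_simplex_of_injective hA.injective, chainLift_simplex, chainLift_simplex, h.add s hs]

/-- An involution admits a sign function that it reverses off its fixed points. -/
lemma exists_sign {Y : Type*} {f : Y → Y} (hf : Function.Involutive f) :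
    ∃ ε : Y → ℤˣ, ∀ y, f y ≠ y → ε (f y) = -ε y := by
  classical
  let _ : LinearOrder Y := linearOrderOfSTO WellOrderingRel
  refine ⟨fun y => if y < f y then 1 else -1, fun y hy => ?_⟩
  rcases lt_or_gt_of_ne hy with h | h
  · simp [hf y, h, h.not_gt]
  · simp [hf y, h, h.not_gt]

/-- An invariant chain of free simplices is a transfer. -/
lemma exists_eq_add_push {A : X → X} (hA : Function.Involutive A) {z : Chain X}
    (hfree : ∀ s ∈ z.support, s.image A ≠ s) (hz : push A z = z) :
    ∃ x : Chain X, x.support ⊆ z.support ∧ z = x + push A x := by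
  classical
  obtain ⟨ε, hε⟩ := exists_sign (f := Finset.image A) (image_image_of_involutive hA)
  refine ⟨z.filter fun s => ε s = 1, by simp [Finsupp.support_filter], ?_⟩
  ext t
  have hzt : z (t.image A) = z t := by rw [← push_involutive_apply hA, hz]
  rw [Finsupp.add_apply, push_involutive_apply hA, Finsupp.filter_apply, Finsupp.filter_apply, hzt]
  by_cases ht : z t = 0
  · simp [ht]
  · rw [hε t (hfree t (Finsupp.mem_support_iff.2 ht))]
    rcases Int.units_eq_one_or (ε t) with h | h <;> simp [h]

/-- All dual Smith sequences take the same value on an invariant cycle. -/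
theorem IsDualSmith.eval_eq {G : Set (Finset X)} {A : X → X} (hG : IsFreeFamily G A)
    {θ θ' : Finset X → ZMod 2} (h : IsDualSmith G A θ) (h' : IsDualSmith G A θ') {n : ℕ}
    {z : Chain X} (hz : z ∈ chainsIn (G ∩ {s | s.card = n})) (hAz : push A z = z)
    (hbz : bd z = 0) : chainLift θ z = chainLift θ' z := by
  induction n generalizing z with
  | zero =>
    refine eqOn_chainsIn hz fun s hs => ?_
    obtain rfl : s = ∅ := Finset.card_eq_zero.1 hs.2
    rw [chainLift_simplex, chainLift_simplex, h.empty, h'.empty]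
  | succ n ih =>
    have hmem := (Finsupp.mem_supported _ _).1 hz
    obtain ⟨x, hx, hzx⟩ := exists_eq_add_push hG.involutive (fun s hs =>
      hG.free s (hmem hs).1 (Finset.card_pos.1 (by
        have : s.card = n + 1 := (hmem hs).2
        omega))) hAz
    have hxG : x ∈ chainsIn (G ∩ {s | s.card = n + 1}) :=
      (Finsupp.mem_supported _ _).2 (subset_trans (by exact_mod_cast hx) hmem)
    have hxG' := Finsupp.supported_mono (R := ZMod 2) (M := ZMod 2) Set.inter_subset_left hxG
    rw [hzx, h.eval_add hG.involutive hxG', h'.eval_add hG.involutive hxG']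
    refine ih (bd_mem ?_ hxG) ?_ (bd_bd x)
    · rintro s ⟨hs, hc⟩ v hv
      have hc' : s.card = n + 1 := hc
      refine ⟨hG.erase s hs v hv, ?_⟩
      rw [Set.mem_ofPred_eq, Finset.card_erase_of_mem hv, hc', Nat.add_sub_cancel]
    · rw [← bd_push]
      have : bd x + bd (push A x) = 0 := by rw [← map_add, ← hzx, hbz]
      rw [← sub_eq_zero, ZModModule.sub_eq_add, add_comm, this]

/-- Dual Smith sequences pull back along equivariant chain maps. -/
lemma IsDualSmith.comp {G : Set (Finset X)} {H : Set (Finset Y)} {A : X → X} {A' : Y → Y}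
    {θ : Finset Y → ZMod 2} (h : IsDualSmith H A' θ) (hA' : Function.Involutive A')
    (F : Chain X →ₗ[ZMod 2] Chain Y) (h0 : F (simplex ∅) = simplex ∅)
    (hF : ∀ s ∈ G, F (simplex s) ∈ chainsIn H)
    (hb : ∀ s ∈ G, bd (F (simplex s)) = F (bd (simplex s)))
    (he : ∀ s ∈ G, F (simplex (s.image A)) = push A' (F (simplex s))) :
    IsDualSmith G A fun s => chainLift θ (F (simplex s)) := by
  refine ⟨by rw [h0, chainLift_simplex, h.empty], fun s hs => ?_⟩
  have h1 : (chainLift fun s => chainLift θ (F (simplex s))) = chainLift θ ∘ₗ F :=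
    chain_hom_ext fun s => by simp
  rw [he s hs, h1, LinearMap.comp_apply, ← hb s hs, ← h.eval_add hA' (hF s hs), map_add]

lemma chainLift_comp (θ : Finset Y → ZMod 2) (F : Chain X →ₗ[ZMod 2] Chain Y) (c : Chain X) :
    chainLift (fun s => chainLift θ (F (simplex s))) c = chainLift θ (F c) := by
  refine eq_of_simplex (F := chainLift fun s => chainLift θ (F (simplex s)))
    (F' := chainLift θ ∘ₗ F) (fun s => ?_) c
  simp

/-- The join of two dual Smith sequences. On a simplex `f * b` of a join it is the product of
`θ f` and of the value of `η` at `b` moved by the power of the involution given by the number of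
vertices of `f`. -/
lemma IsDualSmith.join {G G₁ G₂ : Set (Finset X)} {A : X → X} (hA : Function.Involutive A)
    {θ η : Finset X → ZMod 2} (hθ : IsDualSmith G₁ A θ) (hη : IsDualSmith G₂ A η)
    (p : X → Prop) [DecidablePred p] (hp : ∀ x, p (A x) ↔ p x)
    (h₁ : ∀ s ∈ G, s.filter p ∈ G₁) (h₂ : ∀ s ∈ G, s.filter (fun x => ¬ p x) ∈ G₂)
    (h₂A : ∀ s ∈ G₂, s.image A ∈ G₂) :
    IsDualSmith G A fun s =>
      θ (s.filter p) * η ((s.filter fun x => ¬ p x).image (A^[(s.filter p).card])) := by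
  have hit : ∀ i, Function.Injective (A^[i]) := fun i => hA.injective.iterate i
  refine ⟨by simp [hθ.empty, hη.empty], fun s hs => ?_⟩
  have hf := h₁ s hs
  have hb := h₂ s hs
  have e1 : (s.image A).filter p = (s.filter p).image A := by
    rw [Finset.filter_image]
    simp only [hp]
  have e2 : ((s.image A).filter fun x => ¬ p x) = (s.filter fun x => ¬ p x).image A := by
    rw [Finset.filter_image]
    simp only [hp]
  have e3 : ∀ v ∈ s.filter p, (s.erase v).filter p = (s.filter p).erase v ∧
      (s.erase v).filter (fun x => ¬ p x) = s.filter fun x => ¬ p x := by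
    intro v hv
    rw [Finset.filter_erase, Finset.filter_erase,
      Finset.erase_eq_of_notMem (s := s.filter fun x => ¬ p x)]
    · exact ⟨rfl, rfl⟩
    · simp [(Finset.mem_filter.1 hv).2]
  have e4 : ∀ v ∈ s.filter (fun x => ¬ p x), (s.erase v).filter p = s.filter p ∧
      (s.erase v).filter (fun x => ¬ p x) = (s.filter fun x => ¬ p x).erase v := by
    intro v hv
    rw [Finset.filter_erase, Finset.filter_erase, Finset.erase_eq_of_notMem (s := s.filter p)]
    · exact ⟨rfl, rfl⟩
    · simp [(Finset.mem_filter.1 hv).2]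
  rw [e1, e2, bd_simplex, map_sum, ← Finset.sum_filter_add_sum_filter_not s p]
  simp only [chainLift_simplex]
  rw [Finset.sum_congr rfl fun v hv => by rw [(e3 v hv).1, (e3 v hv).2],
    Finset.sum_congr (s₁ := s.filter fun x => ¬ p x) rfl fun v hv => by
      rw [(e4 v hv).1, (e4 v hv).2]]
  set f := s.filter p with hfdef
  set b := s.filter fun x => ¬ p x with hbdef
  have hfA : (f.image A).card = f.card := Finset.card_image_of_injective f hA.injective
  -- the sum over the vertices of the back face
  have k1 : ∀ i, b.image A^[i] ∈ G₂ := by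
    intro i
    induction i with
    | zero => simpa using hb
    | succ i ih =>
      rw [Function.iterate_succ', ← Finset.image_image]
      exact h₂A _ ih
  have k2 : ∑ v ∈ b, θ f * η ((b.erase v).image A^[f.card])
      = θ f * (η (b.image A^[f.card]) + η (b.image A^[f.card + 1])) := by
    rw [← Finset.mul_sum, Function.iterate_succ', ← Finset.image_image, hη.add _ (k1 _),
      bd_simplex, map_sum, Finset.sum_image (fun x _ y _ h => hit _ h)]
    congr 1
    refine Finset.sum_congr rfl fun v _ => ?_
    rw [chainLift_simplex, Finset.image_erase (hit _)]
  -- the sum over the vertices of the front face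
  have k3 : ∑ v ∈ f, θ (f.erase v) * η (b.image A^[(f.erase v).card])
      = (θ f + θ (f.image A)) * η (b.image A^[f.card + 1]) := by
    rw [hθ.add f hf, bd_simplex, map_sum, Finset.sum_mul]
    refine Finset.sum_congr rfl fun v hv => ?_
    have hc : f.card + 1 = (f.erase v).card + 2 := by
      rw [Finset.card_erase_of_mem hv]
      have := Finset.card_pos.2 ⟨v, hv⟩
      omega
    rw [chainLift_simplex, hc, Function.iterate_add A (f.erase v).card 2,
      show A^[2] = id from hA.comp_self, Function.comp_id]
  rw [k2, k3, hfA, Finset.image_image, ← Function.iterate_succ]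
  have h2 : (2 : ZMod 2) = 0 := rfl
  linear_combination (-(θ f * η (b.image A^[f.card + 1]))) * h2

/-- If all invariant cycles whose simplices have `p + 1` vertices have even characteristic number,
then there is a dual Smith sequence that vanishes on all simplices with more than `p` vertices. -/
lemma IsDualSmith.exists_truncated {G : Set (Finset X)} {A : X → X} (hG : IsFreeFamily G A)
    {θ : Finset X → ZMod 2} {p : ℕ} (hp : 0 < p)
    (hθ : IsDualSmith (G ∩ {s | s.card ≤ p + 1}) A θ)
    (h : ∀ z ∈ chainsIn (G ∩ {s | s.card = p + 1}), push A z = z → bd z = 0 →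
      chainLift θ z = 0) :
    ∃ θ' : Finset X → ZMod 2, IsDualSmith G A θ' ∧ ∀ s, p < s.card → θ' s = 0 := by
  have hA := hG.involutive
  let C (n : ℕ) : Submodule (ZMod 2) (Chain X) := chainsIn (G ∩ {s | s.card = n})
  have hC : ∀ n ≤ p + 1, C n ≤ chainsIn (G ∩ {s | s.card ≤ p + 1}) := fun n hn =>
    Finsupp.supported_mono fun s hs => ⟨hs.1, hs.2.le.trans hn⟩
  -- a linear form `f` with `f (bd x) = 0` and `f (y + A y) = θ (bd y)` is wanted; it exists as soon
  -- as `bd x + (y + A y) = 0` forces `θ (bd y) = 0`, which is the hypothesis for `z = x + A x`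
  let g : C (p + 1) × C p →ₗ[ZMod 2] Chain X :=
    (bd ∘ₗ (C (p + 1)).subtype).coprod ((LinearMap.id + push A) ∘ₗ (C p).subtype)
  let k : C (p + 1) × C p →ₗ[ZMod 2] ZMod 2 :=
    chainLift θ ∘ₗ bd ∘ₗ (C p).subtype ∘ₗ LinearMap.snd _ _ _
  have hk : k ∈ LinearMap.range g.dualMap := by
    have hr := LinearMap.range_dualMap_eq_dualAnnihilator_ker (K := ZMod 2)
      (V₁ := C (p + 1) × C p) (V₂ := Chain X) g
    refine (SetLike.ext_iff.1 hr k).2 ((Submodule.mem_dualAnnihilator _).2 ?_)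
    rintro ⟨⟨x, hx⟩, ⟨y, hy⟩⟩ hxy
    have hxy' : bd x + (y + push A y) = 0 := hxy
    have hbx : bd x = y + push A y := by
      rw [← sub_eq_zero, ZModModule.sub_eq_add, hxy']
    change chainLift θ (bd y) = 0
    rw [← hθ.eval_add hA (hC p (by omega) hy), ← hbx, ← hθ.eval_add hA (hC _ le_rfl hx)]
    refine h _ (Submodule.add_mem _ hx (push_mem ?_ hx)) ?_ ?_
    · rintro s ⟨h1, h2⟩
      exact ⟨hG.image s h1, (Finset.card_image_of_injective s hA.injective).trans h2⟩
    · rw [map_add, push_involutive hA, add_comm]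
    · rw [map_add, bd_push, hbx, map_add, push_involutive hA, add_comm (push A y) y,
        ZModModule.add_self]
  obtain ⟨f, hf⟩ := hk
  have hf1 : ∀ x ∈ C (p + 1), f (bd x) = 0 := by
    intro x hx
    have := LinearMap.congr_fun hf (⟨x, hx⟩, 0)
    simpa [g, k] using this
  have hf2 : ∀ y ∈ C p, f (y + push A y) = chainLift θ (bd y) := by
    intro y hy
    have := LinearMap.congr_fun hf (0, ⟨y, hy⟩)
    simpa [g, k] using this
  -- `θ'` is `θ` below `p` vertices, `f` on `p` vertices, and zero above
  let θ' : Finset X → ZMod 2 := fun s =>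
    if s.card < p then θ s else if s.card = p then f (simplex s) else 0
  have hlow : ∀ s : Finset X, s.card < p → θ' s = θ s := fun s hs => if_pos hs
  have hmid : ∀ s : Finset X, s.card = p → θ' s = f (simplex s) := fun s hs => by
    simp [θ', hs]
  have hhigh : ∀ s : Finset X, p < s.card → θ' s = 0 := fun s hs => by
    simp [θ', hs.not_gt, hs.ne']
  refine ⟨θ', ⟨by rw [hlow _ (by simpa using hp), hθ.empty], fun s hs => ?_⟩, hhigh⟩
  have hcA : (s.image A).card = s.card := Finset.card_image_of_injective s hA.injective
  have hce : ∀ v ∈ s, (s.erase v).card + 1 = s.card := fun v hv => Finset.card_erase_add_one hv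
  have hlift : ∀ ζ : Chain X →ₗ[ZMod 2] ZMod 2, (∀ v ∈ s, θ' (s.erase v) = ζ (simplex (s.erase v)))
      → chainLift θ' (bd (simplex s)) = ζ (bd (simplex s)) := by
    intro ζ hζ
    rw [bd_simplex, map_sum, map_sum]
    exact Finset.sum_congr rfl fun v hv => by rw [chainLift_simplex, hζ v hv]
  have hs1 : s.card = s.card → simplex s ∈ C s.card := fun h => simplex_mem ⟨hs, h⟩
  rcases lt_trichotomy s.card p with hc | hc | hc
  · rw [hlow s hc, hlow _ (hcA.trans_lt hc), hlift (chainLift θ),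
      hθ.add s ⟨hs, show s.card ≤ p + 1 by omega⟩]
    intro v hv
    rw [chainLift_simplex, hlow]
    have := hce v hv
    omega
  · rw [hmid s hc, hmid _ (hcA.trans hc), hlift (chainLift θ), ← hf2 _ (hc ▸ hs1 rfl), map_add,
      push_simplex_of_injective hA.injective]
    intro v hv
    rw [chainLift_simplex, hlow]
    have := hce v hv
    omega
  · rw [hhigh s hc, hhigh _ (hc.trans_eq hcA.symm), add_zero]
    by_cases hc1 : s.card = p + 1
    · rw [hlift f, hf1 _ (hc1 ▸ hs1 rfl)]
      intro v hv
      rw [hmid]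
      have := hce v hv
      omega
    · rw [hlift 0, LinearMap.zero_apply]
      intro v hv
      rw [LinearMap.zero_apply, hhigh]
      have := hce v hv
      omega

end Smith

/-! ### The dual Smith sequence of the cross-polytope -/

/-- The antipodal map on the vertices `(i, ±1)` of the cross-polytope. -/
def negLabel (l : ℕ × ℤˣ) : ℕ × ℤˣ := (l.1, -l.2)

lemma negLabel_involutive : Function.Involutive negLabel := fun l => by simp [negLabel]

/-- The sets of vertices of the `n`-dimensional cross-polytope that span a simplex of its boundary,
together with the empty set. -/
def crossFaces (n : ℕ) : Set (Finset (ℕ × ℤˣ)) :=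
  {s | (∀ l ∈ s, l.1 < n) ∧ Set.InjOn Prod.fst (s : Set (ℕ × ℤˣ))}

/-- The facet of the `n`-dimensional cross-polytope whose vertices all have sign `σ`. -/
def crossFacet (n : ℕ) (σ : ℤˣ) : Finset (ℕ × ℤˣ) := (Finset.range n).image fun i => (i, σ)

lemma card_le_of_mem_crossFaces {n : ℕ} {s : Finset (ℕ × ℤˣ)} (hs : s ∈ crossFaces n) :
    s.card ≤ n := by
  rw [← Finset.card_image_of_injOn hs.2]
  calc _ ≤ (Finset.range n).card := Finset.card_le_card fun i hi => by
        obtain ⟨l, hl, rfl⟩ := Finset.mem_image.1 hi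
        exact Finset.mem_range.2 (hs.1 l hl)
    _ = n := Finset.card_range n

/-- The cochain that, after the sign of each vertex `(i, ε)` is multiplied by `(-1)^i`, is one on
the simplices whose vertices have distinct indices and alternating signs, with the sign of the last
vertex prescribed by `σ`, and zero on the other simplices of the cross-polytope. It counts the
alternating simplices in Ky Fan's lemma. -/
def fanCochain : ℕ → ℤˣ → Finset (ℕ × ℤˣ) → ZMod 2
  | 0, _, s => if s = ∅ then 1 else 0
  | n + 1, σ, s =>
    fanCochain n (-σ) s + if (n, σ) ∈ s then fanCochain n σ (s.erase (n, σ)) else 0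

lemma fanCochain_of_le {n : ℕ} {σ : ℤˣ} {s : Finset (ℕ × ℤˣ)} {l : ℕ × ℤˣ} (hl : l ∈ s)
    (hn : n ≤ l.1) : fanCochain n σ s = 0 := by
  induction n generalizing σ s with
  | zero => simp [fanCochain, Finset.ne_empty_of_mem hl]
  | succ n ih =>
    rw [fanCochain, ih hl (by omega), zero_add]
    split_ifs
    · refine ih (Finset.mem_erase.2 ⟨?_, hl⟩) (by omega)
      rintro rfl
      simp at hn
    · rfl

lemma fanCochain_of_lt_card {n : ℕ} {σ : ℤˣ} {s : Finset (ℕ × ℤˣ)} (hn : n < s.card) :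
    fanCochain n σ s = 0 := by
  induction n generalizing σ s with
  | zero => simp [fanCochain, (Finset.card_pos.1 hn).ne_empty]
  | succ n ih =>
    rw [fanCochain, ih (by omega), zero_add]
    split_ifs with h
    · exact ih (by rw [Finset.card_erase_of_mem h]; omega)
    · rfl

/-- In the top degree the cochain counts a single facet. -/
lemma fanCochain_of_card_eq {n : ℕ} {σ : ℤˣ} {s : Finset (ℕ × ℤˣ)} (hn : s.card = n) :
    fanCochain n σ s = if s = crossFacet n σ then 1 else 0 := by
  induction n generalizing σ s with
  | zero =>
    obtain rfl : s = ∅ := Finset.card_eq_zero.1 hn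
    simp [fanCochain, crossFacet]
  | succ n ih =>
    have hins : crossFacet (n + 1) σ = insert (n, σ) (crossFacet n σ) := by
      rw [crossFacet, Finset.range_add_one, Finset.image_insert, crossFacet]
    have hnot : (n, σ) ∉ crossFacet n σ := by simp [crossFacet]
    rw [fanCochain, fanCochain_of_lt_card (by omega), zero_add, hins]
    split_ifs with h1 h2 h2
    · rw [ih (by rw [Finset.card_erase_of_mem h1]; omega), if_pos]
      rw [h2, Finset.erase_insert hnot]
    · rw [ih (by rw [Finset.card_erase_of_mem h1]; omega), if_neg]
      intro h
      rw [← h, Finset.insert_erase h1] at h2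
      exact h2 rfl
    · exact absurd (h2 ▸ Finset.mem_insert_self _ _) h1
    · rfl

lemma fanCochain_empty (n : ℕ) (σ : ℤˣ) : fanCochain n σ ∅ = 1 := by
  induction n generalizing σ with
  | zero => simp [fanCochain]
  | succ n ih => simp [fanCochain, ih]

lemma fanCochain_neg (n : ℕ) (σ : ℤˣ) (s : Finset (ℕ × ℤˣ)) :
    fanCochain n σ (s.image negLabel) = fanCochain n (-σ) s := by
  induction n generalizing σ s with
  | zero => simp [fanCochain]
  | succ n ih =>
    have h : negLabel (n, -σ) = (n, σ) := by simp [negLabel]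
    have hmem : (n, σ) ∈ s.image negLabel ↔ (n, -σ) ∈ s := by
      rw [← h, Finset.mem_image]
      refine ⟨?_, fun hs => ⟨_, hs, rfl⟩⟩
      rintro ⟨l, hl, he⟩
      rwa [← negLabel_involutive.injective he]
    rw [fanCochain, fanCochain, ih]
    simp only [hmem]
    congr 2
    rw [← h, ← Finset.image_erase negLabel_involutive.injective, ih]

lemma sum_fanCochain_erase {n : ℕ} (σ : ℤˣ) {s : Finset (ℕ × ℤˣ)} (hs : s ∈ crossFaces n) :
    ∑ l ∈ s, fanCochain n σ (s.erase l) = fanCochain n 1 s + fanCochain n (-1) s := by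
  induction n generalizing σ s with
  | zero =>
    obtain rfl : s = ∅ := Finset.card_eq_zero.1 (Nat.le_zero.1 (card_le_of_mem_crossFaces hs))
    simp [fanCochain]
    rfl
  | succ n ih =>
    have hsym : ∀ t : Finset (ℕ × ℤˣ), ∀ τ : ℤˣ,
        fanCochain n τ t + fanCochain n (-τ) t = fanCochain n 1 t + fanCochain n (-1) t := by
      intro t τ
      rcases Int.units_eq_one_or τ with rfl | rfl
      · rfl
      · rw [neg_neg, add_comm]
    -- the terms are compared according to whether `s` has a vertex on the last axis
    by_cases hex : ∃ τ, (n, τ) ∈ s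
    · obtain ⟨τ, hτ⟩ := hex
      have huniq : ∀ l ∈ s, l.1 = n → l = (n, τ) := fun l hl h => hs.2 hl hτ h
      have hs0 : s.erase (n, τ) ∈ crossFaces n := by
        refine ⟨fun l hl => ?_, hs.2.mono (by simp)⟩
        rw [Finset.mem_erase] at hl
        have := hs.1 l hl.2
        have h2 : l.1 ≠ n := fun h => hl.1 (huniq l hl.2 h)
        omega
      have hz : ∀ (ρ : ℤˣ) (t : Finset (ℕ × ℤˣ)), (n, τ) ∈ t → fanCochain n ρ t = 0 :=
        fun ρ t ht => fanCochain_of_le ht le_rfl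
      have hval : ∀ (ρ : ℤˣ) (t : Finset (ℕ × ℤˣ)), t ⊆ s → (n, τ) ∈ t →
          fanCochain (n + 1) ρ t = if ρ = τ then fanCochain n τ (t.erase (n, τ)) else 0 := by
        intro ρ t hts ht
        rw [fanCochain, hz _ _ ht, zero_add]
        by_cases hρ : ρ = τ
        · rw [hρ, if_pos ht, if_pos rfl]
        · rw [if_neg hρ, if_neg]
          intro h
          have := huniq _ (hts h) rfl
          exact hρ (by simpa using this)
      rw [← Finset.add_sum_erase s _ hτ, Finset.sum_congr rfl fun l hl => hval σ (s.erase l)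
        (Finset.erase_subset _ _) (Finset.mem_erase.2 ⟨(Finset.ne_of_mem_erase hl).symm, hτ⟩),
        hval 1 s subset_rfl hτ, hval (-1) s subset_rfl hτ]
      have hnot : ∀ ρ, (n, ρ) ∉ s.erase (n, τ) := fun ρ h => by
        rw [Finset.mem_erase] at h
        exact h.1 (huniq _ h.2 rfl)
      rw [fanCochain, if_neg (hnot σ), add_zero]
      have hrhs : ((if (1 : ℤˣ) = τ then fanCochain n τ (s.erase (n, τ)) else 0)
          + if (-1 : ℤˣ) = τ then fanCochain n τ (s.erase (n, τ)) else 0)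
          = fanCochain n τ (s.erase (n, τ)) := by
        rcases Int.units_eq_one_or τ with rfl | rfl <;> simp
      rw [hrhs]
      by_cases hσ : σ = τ
      · subst hσ
        simp only [if_true]
        have := ih σ hs0
        simp only [Finset.erase_right_comm (a := (n, σ))] at this
        rw [this, ← hsym _ σ]
        have h2 : (2 : ZMod 2) = 0 := rfl
        linear_combination fanCochain n (-σ) (s.erase (n, σ)) * h2
      · simp only [if_neg hσ, Finset.sum_const_zero, add_zero]
        congr 1
        rcases Int.units_eq_one_or τ with rfl | rfl <;>
          rcases Int.units_eq_one_or σ with rfl | rfl <;> simp_all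
    · simp only [not_exists] at hex
      have hs' : s ∈ crossFaces n := by
        refine ⟨fun l hl => ?_, hs.2⟩
        have := hs.1 l hl
        have h2 : l.1 ≠ n := fun h => hex l.2 (by rwa [← h])
        omega
      have hval : ∀ (ρ : ℤˣ) (t : Finset (ℕ × ℤˣ)), t ⊆ s →
          fanCochain (n + 1) ρ t = fanCochain n (-ρ) t := by
        intro ρ t ht
        rw [fanCochain, if_neg fun h => hex ρ (ht h), add_zero]
      rw [Finset.sum_congr rfl fun l _ => hval σ _ (Finset.erase_subset l s), hval _ _ subset_rfl,
        hval _ _ subset_rfl, ih (-σ) hs', neg_neg, add_comm]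

lemma isDualSmith_fanCochain (n : ℕ) (σ : ℤˣ) :
    IsDualSmith (crossFaces n) negLabel (fanCochain n σ) := by
  refine ⟨fanCochain_empty n σ, fun s hs => ?_⟩
  rw [fanCochain_neg, bd_simplex, map_sum]
  simp only [chainLift_simplex]
  rw [sum_fanCochain_erase σ hs]
  rcases Int.units_eq_one_or σ with rfl | rfl
  · rfl
  · rw [neg_neg, add_comm]

lemma chainLift_fanCochain {n : ℕ} {c : Chain (ℕ × ℤˣ)} (hc : c ∈ chainsIn {s | s.card = n}) :
    chainLift (fanCochain n 1) c = c (crossFacet n 1) := by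
  refine eqOn_chainsIn (F' := Finsupp.lapply (crossFacet n 1)) hc fun s hs => ?_
  rw [chainLift_simplex, fanCochain_of_card_eq hs, Finsupp.lapply_apply, Finsupp.single_apply]

/-! ### Subdivisions and chains -/

section Fan

open scoped Classical

variable {V : Type*} {V' : Type*}

/-- The conical form of a subdivision: the cones spanned by the vectors `P v`, for `v` in a member
of `K'`, subdivide the coordinate cones given by the members of `K`. -/
structure IsFan (K : Set (Finset V)) (K' : Set (Finset V')) (P : V' → V →₀ ℝ) : Prop where
  finite : K'.Finite
  empty_mem : ∅ ∈ K'
  subset : ∀ s ∈ K', ∀ t ⊆ s, t ∈ K'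
  subset_base : ∀ s ∈ K, ∀ t ⊆ s, t ∈ K
  nonneg : ∀ v i, 0 ≤ P v i
  inj : ∀ s ∈ K', ∀ t ∈ K', ∀ f g : V' → ℝ, (∀ v ∈ s, 0 ≤ f v) → (∀ v ∈ t, 0 ≤ g v) →
    ∑ v ∈ s, f v • P v = ∑ v ∈ t, g v • P v →
      ∀ v, (if v ∈ s then f v else 0) = if v ∈ t then g v else 0
  surj : ∀ x : V →₀ ℝ, (∀ i, 0 ≤ x i) → x.support ∈ K →
    ∃ s ∈ K', ∃ f : V' → ℝ, (∀ v ∈ s, 0 < f v) ∧ ∑ v ∈ s, f v • P v = x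

namespace IsFan

variable {K : Set (Finset V)} {K' : Set (Finset V')} {P : V' → V →₀ ℝ}

/-- The simplices of the subdivision that lie in the closed simplex `σ`. -/
def inCell (K' : Set (Finset V')) (P : V' → V →₀ ℝ) (σ : Finset V) : Set (Finset V') :=
  {s | s ∈ K' ∧ ∀ v ∈ s, (P v).support ⊆ σ}

lemma inCell_subset (h : IsFan K K' P) {σ : Finset V} {s t : Finset V'} (hs : s ∈ inCell K' P σ)
    (hts : t ⊆ s) : t ∈ inCell K' P σ :=
  ⟨h.subset s hs.1 t hts, fun v hv => hs.2 v (hts hv)⟩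

lemma inCell_mono {σ ρ : Finset V} (hσ : σ ⊆ ρ) {s : Finset V'} (hs : s ∈ inCell K' P σ) :
    s ∈ inCell K' P ρ :=
  ⟨hs.1, fun v hv => (hs.2 v hv).trans hσ⟩

lemma linearIndepOn (h : IsFan K K' P) {s : Finset V'} (hs : s ∈ K') :
    LinearIndepOn ℝ P (s : Set V') := by
  rw [linearIndepOn_finset_iff]
  intro f hf v hv
  let M : ℝ := ∑ u ∈ s, |f u|
  have hM : ∀ u ∈ s, |f u| ≤ M := fun u hu =>
    Finset.single_le_sum (f := fun u => |f u|) (fun _ _ => abs_nonneg _) hu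
  have h0 : ∀ u ∈ s, 0 ≤ M := fun u hu => (abs_nonneg _).trans (hM u hu)
  have := h.inj s hs s hs (fun u => f u + M) (fun _ => M)
    (fun u hu => by have := hM u hu; have := neg_abs_le (f u); linarith) h0
    (by simp only [add_smul, Finset.sum_add_distrib, hf, zero_add]) v
  simpa [hv] using this

lemma mem_supported {σ : Finset V} {s : Finset V'} (hs : s ∈ inCell K' P σ) {v : V'}
    (hv : v ∈ s) : P v ∈ Finsupp.supported ℝ ℝ (σ : Set V) := by
  rw [Finsupp.mem_supported]
  exact_mod_cast hs.2 v hv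

lemma finrank_supported (σ : Finset V) :
    Module.finrank ℝ (Finsupp.supported ℝ ℝ (σ : Set V)) = σ.card := by
  rw [LinearEquiv.finrank_eq (Finsupp.supportedEquivFinsupp (σ : Set V))]
  simp

instance (σ : Finset V) : FiniteDimensional ℝ (Finsupp.supported ℝ ℝ (σ : Set V)) :=
  Module.Finite.equiv (Finsupp.supportedEquivFinsupp (σ : Set V)).symm

lemma span_le {σ : Finset V} {s : Finset V'} (hs : s ∈ inCell K' P σ) :
    Submodule.span ℝ (P '' (s : Set V')) ≤ Finsupp.supported ℝ ℝ (σ : Set V) := by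
  rw [Submodule.span_le]
  rintro _ ⟨v, hv, rfl⟩
  exact mem_supported hs hv

lemma finrank_span (h : IsFan K K' P) {s : Finset V'} (hs : s ∈ K') :
    Module.finrank ℝ (Submodule.span ℝ (P '' (s : Set V'))) = s.card := by
  have h1 := h.linearIndepOn hs
  have h2 : P '' (s : Set V') = Set.range fun v : (s : Set V') => P v := by
    ext x
    simp
  rw [h2, finrank_span_eq_card h1]
  simp

lemma card_le (h : IsFan K K' P) {σ : Finset V} {s : Finset V'} (hs : s ∈ inCell K' P σ) :
    s.card ≤ σ.card := by
  rw [← h.finrank_span hs.1, ← finrank_supported σ]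
  exact Submodule.finrank_mono (span_le hs)

/-- The linear form `l` defines the hyperplane spanned by the codimension one simplex `τ` of the
subdivision of `σ`. -/
def IsWall (P : V' → V →₀ ℝ) (σ : Finset V) (τ : Finset V') (l : (V →₀ ℝ) →ₗ[ℝ] ℝ) : Prop :=
  (∀ v ∈ τ, l (P v) = 0) ∧ ∀ x ∈ Finsupp.supported ℝ ℝ (σ : Set V), l x = 0 →
    x ∈ Submodule.span ℝ (P '' (τ : Set V'))

lemma exists_isWall (h : IsFan K K' P) {σ : Finset V} {τ : Finset V'} (hτ : τ ∈ inCell K' P σ)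
    (hc : τ.card + 1 = σ.card) :
    ∃ l, IsWall P σ τ l ∧ ∃ z ∈ Finsupp.supported ℝ ℝ (σ : Set V), l z ≠ 0 := by
  set E := Finsupp.supported ℝ ℝ (σ : Set V) with hE
  set W := Submodule.span ℝ (P '' (τ : Set V')) with hW
  have hWE : W ≤ E := span_le hτ
  have hne : W ≠ E := by
    intro e
    have h1 := h.finrank_span hτ.1
    rw [← hW, e, hE, finrank_supported] at h1
    omega
  obtain ⟨z, hzE, hzW⟩ := SetLike.exists_of_lt (lt_of_le_of_ne hWE hne)
  obtain ⟨l, hlz, hl⟩ := Submodule.exists_le_ker_of_notMem hzW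
  have hl' : ∀ x ∈ W, l x = 0 := fun x hx => hl hx
  refine ⟨l, ⟨fun v hv => hl' _ (Submodule.subset_span ⟨v, hv, rfl⟩), fun x hx hx0 => ?_⟩,
    z, hzE, hlz⟩
  -- the span of `τ` has codimension one
  have hsup : W ⊔ Submodule.span ℝ {z} = E := by
    have hle : W ⊔ Submodule.span ℝ {z} ≤ E :=
      sup_le hWE (by rw [Submodule.span_le]; simpa using hzE)
    have hfd : FiniteDimensional ℝ (W ⊔ Submodule.span ℝ {z} : Submodule ℝ (V →₀ ℝ)) :=
      Submodule.finiteDimensional_of_le hle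
    refine Submodule.eq_of_le_of_finrank_le hle ?_
    have hlt : W < W ⊔ Submodule.span ℝ {z} := by
      refine lt_of_le_of_ne le_sup_left fun e => hzW ?_
      rw [e]
      exact Submodule.mem_sup_right (Submodule.mem_span_singleton_self z)
    have := Submodule.finrank_lt_finrank_of_lt hlt
    rw [hW, h.finrank_span hτ.1] at this
    rw [hE, finrank_supported]
    rw [hW]
    omega
  have hx : x ∈ E := hx
  rw [← hsup] at hx
  obtain ⟨w, hw, z', hz', rfl⟩ := Submodule.mem_sup.1 hx
  obtain ⟨c, rfl⟩ := Submodule.mem_span_singleton.1 hz'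
  rw [map_add, hl' w hw, zero_add, map_smul, smul_eq_mul] at hx0
  rcases mul_eq_zero.1 hx0 with hc | hc
  · rw [hc, zero_smul, add_zero]
    exact hw
  · exact absurd hc hlz

lemma IsWall.ne_zero (h : IsFan K K' P) {σ : Finset V} {τ : Finset V'}
    {l : (V →₀ ℝ) →ₗ[ℝ] ℝ} (hl : IsWall P σ τ l) {v : V'} (hv : v ∉ τ)
    (hs : insert v τ ∈ inCell K' P σ) : l (P v) ≠ 0 := by
  intro h0
  have h1 := h.linearIndepOn hs.1
  rw [Finset.coe_insert, linearIndepOn_insert (by exact_mod_cast hv)] at h1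
  exact h1.2 (hl.2 _ (mem_supported hs (Finset.mem_insert_self _ _)) h0)

/-- At most one simplex of the subdivision contains `τ` and lies on a given side of its wall. -/
lemma IsWall.side_unique (h : IsFan K K' P) {σ : Finset V} {τ : Finset V'}
    {l : (V →₀ ℝ) →ₗ[ℝ] ℝ} (hl : IsWall P σ τ l) {v v' : V'} (hv : v ∉ τ) (hv' : v' ∉ τ)
    (hs : insert v τ ∈ inCell K' P σ) (hs' : insert v' τ ∈ inCell K' P σ)
    (hside : 0 < l (P v) * l (P v')) : v = v' := by
  have hne := hl.ne_zero h hv hs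
  -- the vectors `P v'` and `α • P v` differ by an element of the span of `τ`
  set α := l (P v') / l (P v) with hα
  have hα0 : 0 < α := by
    rw [hα, div_eq_mul_inv]
    have : l (P v') * (l (P v))⁻¹ = (l (P v) * l (P v')) * ((l (P v))⁻¹) ^ 2 := by
      field_simp
    rw [this]
    positivity
  have hmem : P v' - α • P v ∈ Submodule.span ℝ (P '' (τ : Set V')) := by
    refine hl.2 _ (Submodule.sub_mem _ (mem_supported hs' (Finset.mem_insert_self _ _))
      (Submodule.smul_mem _ _ (mem_supported hs (Finset.mem_insert_self _ _)))) ?_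
    rw [map_sub, map_smul, smul_eq_mul, hα, div_mul_cancel₀ _ hne, sub_self]
  obtain ⟨c, hc⟩ := (Submodule.mem_span_image_finset_iff_exists_fun ℝ).1 hmem
  let d : V' → ℝ := fun u => if hu : u ∈ τ then c ⟨u, hu⟩ else 0
  have hd : ∑ u ∈ τ, d u • P u = P v' - α • P v := by
    rw [← hc, ← Finset.sum_coe_sort τ]
    exact Finset.sum_congr rfl fun u _ => by simp [d]
  let M : ℝ := ∑ u ∈ τ, |d u|
  have hM : ∀ u ∈ τ, |d u| ≤ M := fun u hu =>
    Finset.single_le_sum (f := fun u => |d u|) (fun _ _ => abs_nonneg _) hu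
  have hM0 : 0 ≤ M := Finset.sum_nonneg fun _ _ => abs_nonneg _
  -- adding `M` times the sum of the vertices of `τ` makes all coefficients nonnegative, so that one
  -- point has two expressions
  have hkey := h.inj _ hs'.1 _ hs.1 (fun u => if u = v' then 1 else M)
    (fun u => if u = v then α else M + d u) ?_ ?_ ?_ v'
  · by_contra hvv
    rw [if_pos (Finset.mem_insert_self _ _), if_pos rfl, if_neg] at hkey
    · exact one_ne_zero hkey
    · rw [Finset.mem_insert, not_or]
      exact ⟨fun e => hvv e.symm, hv'⟩
  · intro u _
    split_ifs
    · exact zero_le_one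
    · exact hM0
  · intro u hu
    split_ifs with e
    · exact hα0.le
    · have := hM u ((Finset.mem_insert.1 hu).resolve_left e)
      have := neg_abs_le (d u)
      linarith
  · rw [Finset.sum_insert hv', Finset.sum_insert hv]
    have e1 : ∀ u ∈ τ, (if u = v' then (1 : ℝ) else M) • P u = M • P u := fun u hu => by
      rw [if_neg]
      rintro rfl
      exact hv' hu
    have e2 : ∀ u ∈ τ, (if u = v then α else M + d u) • P u = M • P u + d u • P u :=
      fun u hu => by
        rw [if_neg, add_smul]
        rintro rfl
        exact hv hu
    rw [Finset.sum_congr rfl e1, Finset.sum_congr rfl e2, Finset.sum_add_distrib, hd]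
    simp only [if_true, one_smul]
    abel

/-- If the vectors `b + ε z`, for `b` in the interior of the cone of `τ` and small `ε > 0`, stay in
`σ`, then a simplex of the subdivision contains `τ` and lies on the side of `z`. -/
lemma IsWall.side_exists (h : IsFan K K' P) {σ : Finset V} (hσ : σ ∈ K) {τ : Finset V'}
    (hτ : τ ∈ inCell K' P σ) (hc : τ.card + 1 = σ.card) {l : (V →₀ ℝ) →ₗ[ℝ] ℝ}
    (hl : IsWall P σ τ l) {z : V →₀ ℝ} (hz : z ∈ Finsupp.supported ℝ ℝ (σ : Set V))
    (hlz : l z ≠ 0) {ε₀ : ℝ} (hε₀ : 0 < ε₀)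
    (hpos : ∀ ε, 0 < ε → ε ≤ ε₀ → ∀ i, 0 ≤ (∑ u ∈ τ, P u + ε • z) i) :
    ∃ v, v ∉ τ ∧ insert v τ ∈ inCell K' P σ ∧ 0 < l (P v) * l z := by
  set b := ∑ u ∈ τ, P u with hb
  have hbσ : b ∈ Finsupp.supported ℝ ℝ (σ : Set V) :=
    Submodule.sum_mem _ fun u hu => mem_supported hτ hu
  have hlb : l b = 0 := by
    rw [hb, map_sum]
    exact Finset.sum_eq_zero hl.1
  let e : ℕ → ℝ := fun n => ε₀ / (n + 1)
  have he : ∀ n, 0 < e n := fun n => by positivity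
  have he' : ∀ n, e n ≤ ε₀ := fun n => by
    refine div_le_self hε₀.le ?_
    have : (0 : ℝ) ≤ n := Nat.cast_nonneg n
    linarith
  have hsupp : ∀ n, (b + e n • z).support ⊆ σ := fun n => by
    have := Submodule.add_mem _ hbσ (Submodule.smul_mem _ (e n) hz)
    rw [Finsupp.mem_supported] at this
    exact_mod_cast this
  choose s hs f hf hsum using fun n => h.surj (b + e n • z) (hpos _ (he n) (he' n))
    (h.subset_base σ hσ _ (hsupp n))
  -- by finiteness, one simplex meets the ray in points arbitrarily close to `b`
  have := h.finite.to_subtype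
  obtain ⟨⟨S, hSK⟩, hS⟩ := Finite.exists_infinite_fiber fun n => (⟨s n, hs n⟩ : K')
  have hSinf : {n | s n = S}.Infinite := by
    have h1 : ((fun n => (⟨s n, hs n⟩ : K')) ⁻¹' {⟨S, hSK⟩}) = {n | s n = S} := by
      ext n
      simp [Subtype.ext_iff]
    rw [← h1]
    exact Set.infinite_coe_iff.1 hS
  obtain ⟨n₁, hn₁⟩ := hSinf.nonempty
  obtain ⟨n₂, hn₂, hlt⟩ := hSinf.exists_gt n₁
  have hn₁' : s n₁ = S := hn₁
  have hn₂' : s n₂ = S := hn₂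
  have hene : e n₁ - e n₂ ≠ 0 := by
    have : e n₂ < e n₁ := by
      refine div_lt_div_of_pos_left hε₀ (by positivity) ?_
      have : (n₁ : ℝ) < n₂ := by exact_mod_cast hlt
      linarith
    linarith
  -- along this simplex the coordinates are affine functions `c + ε d` of `ε`
  let d : V' → ℝ := fun v => (f n₁ v - f n₂ v) / (e n₁ - e n₂)
  let c : V' → ℝ := fun v => f n₁ v - e n₁ * d v
  have hsum' : ∀ n, s n = S → ∑ v ∈ S, f n v • P v = b + e n • z := fun n hn => by
    rw [← hsum n, hn]
  have hd : ∑ v ∈ S, d v • P v = z := by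
    have : ∑ v ∈ S, d v • P v
        = (e n₁ - e n₂)⁻¹ • (∑ v ∈ S, f n₁ v • P v - ∑ v ∈ S, f n₂ v • P v) := by
      rw [← Finset.sum_sub_distrib, Finset.smul_sum]
      refine Finset.sum_congr rfl fun v _ => ?_
      rw [← sub_smul, smul_smul, ← div_eq_inv_mul]
    rw [this, hsum' _ hn₁', hsum' _ hn₂', add_sub_add_left_eq_sub, ← sub_smul, smul_smul,
      inv_mul_cancel₀ hene, one_smul]
  have hcb : ∑ v ∈ S, c v • P v = b := by
    have : ∑ v ∈ S, c v • P v = ∑ v ∈ S, f n₁ v • P v - e n₁ • ∑ v ∈ S, d v • P v := by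
      rw [Finset.smul_sum, ← Finset.sum_sub_distrib]
      refine Finset.sum_congr rfl fun v _ => ?_
      rw [smul_smul, ← sub_smul]
    rw [this, hd, hsum' _ hn₁', add_sub_cancel_right]
  have hfn : ∀ n, s n = S → ∀ v ∈ S, f n v = c v + e n * d v := by
    intro n hn v hv
    have h1 := linearIndepOn_finset_iff.1 (h.linearIndepOn hSK)
      (fun v => f n v - (c v + e n * d v)) ?_ v hv
    · linarith
    · simp only [sub_smul, add_smul, mul_smul, Finset.sum_sub_distrib, Finset.sum_add_distrib,
        ← Finset.smul_sum, hcb, hd, hsum' n hn, sub_self]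
  -- in the limit `ε → 0` the coordinates are nonnegative, so that `S` contains the carrier of `b`
  have hc0 : ∀ v ∈ S, 0 ≤ c v := by
    intro v hv
    by_contra hneg
    obtain ⟨N, hN⟩ := exists_nat_gt (ε₀ * |d v| / -c v)
    obtain ⟨n, hn, hNn⟩ := hSinf.exists_gt N
    have hfpos := hf n v ((show s n = S from hn) ▸ hv)
    rw [hfn n hn v hv] at hfpos
    have hcv : 0 < -c v := by linarith
    rw [div_lt_iff₀ hcv] at hN
    have h2 : e n * d v ≤ e n * |d v| := mul_le_mul_of_nonneg_left (le_abs_self _) (he n).le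
    have h3 : -c v < e n * |d v| := by linarith
    have h4 : e n * |d v| = ε₀ * |d v| / (n + 1) := by
      simp only [e]
      ring
    have hn1 : (0 : ℝ) < n + 1 := by positivity
    rw [h4, lt_div_iff₀ hn1] at h3
    have h5 : (N : ℝ) < n := by exact_mod_cast hNn
    nlinarith
  have hτS : τ ⊆ S := by
    intro u hu
    have := h.inj S hSK τ hτ.1 c (fun _ => 1) hc0 (fun _ _ => zero_le_one)
      (by rw [hcb, hb]; simp) u
    by_contra hn
    rw [if_neg hn, if_pos hu] at this
    exact one_ne_zero this.symm
  have hSσ : S ∈ inCell K' P σ := by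
    refine ⟨hSK, fun v hv => ?_⟩
    refine Finset.Subset.trans ?_ (hsupp n₁)
    intro i hi
    rw [Finsupp.mem_support_iff, ← hsum' _ hn₁', Finsupp.finsetSum_apply]
    refine ne_of_gt (Finset.sum_pos' (fun u hu => ?_) ⟨v, hv, ?_⟩)
    · exact mul_nonneg (hf n₁ u (hn₁'.symm ▸ hu)).le (h.nonneg u i)
    · exact mul_pos (hf n₁ v (hn₁'.symm ▸ hv))
        ((h.nonneg v i).lt_of_ne (Finsupp.mem_support_iff.1 hi).symm)
  have hlS : l (∑ v ∈ S, f n₁ v • P v) = e n₁ * l z := by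
    rw [hsum' _ hn₁', map_add, map_smul, hlb, zero_add, smul_eq_mul]
  have hτne : τ ≠ S := by
    rintro rfl
    rw [map_sum, Finset.sum_eq_zero] at hlS
    · exact mul_ne_zero (he n₁).ne' hlz hlS.symm
    · intro v hv
      rw [map_smul, hl.1 v hv, smul_zero]
  have hScard : S.card = τ.card + 1 := by
    have h1 := h.card_le hSσ
    have h2 := Finset.card_lt_card (Finset.ssubset_iff_subset_ne.2 ⟨hτS, hτne⟩)
    omega
  obtain ⟨v, hv⟩ : ∃ v, S \ τ = {v} := by
    rw [← Finset.card_eq_one, Finset.card_sdiff_of_subset hτS]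
    omega
  have hvS : v ∈ S \ τ := hv ▸ Finset.mem_singleton_self v
  rw [Finset.mem_sdiff] at hvS
  have hins : S = insert v τ := by
    rw [Finset.insert_eq, ← hv, Finset.sdiff_union_of_subset hτS]
  refine ⟨v, hvS.2, hins ▸ hSσ, ?_⟩
  rw [hins, Finset.sum_insert hvS.2, map_add, map_sum, Finset.sum_eq_zero, add_zero, map_smul,
    smul_eq_mul] at hlS
  · have hfv := hf n₁ v (hn₁'.symm ▸ hvS.1)
    have : l (P v) = e n₁ / f n₁ v * l z := by
      field_simp
      linarith
    rw [this, mul_assoc]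
    have h2 : 0 < l z * l z := mul_self_pos.2 hlz
    have := he n₁
    positivity
  · intro u hu
    rw [map_smul, hl.1 u hu, smul_zero]

/-- The top-dimensional simplices of the subdivision of `σ`. -/
def top (K' : Set (Finset V')) (P : V' → V →₀ ℝ) (σ : Finset V) : Set (Finset V') :=
  inCell K' P σ ∩ {s | s.card = σ.card}

lemma eq_insert {s τ : Finset V'} (hτs : τ ⊆ s) (hc : s.card = τ.card + 1) :
    ∃ v, v ∉ τ ∧ s = insert v τ := by
  obtain ⟨v, hv⟩ : ∃ v, s \ τ = {v} := by
    rw [← Finset.card_eq_one, Finset.card_sdiff_of_subset hτs]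
    omega
  have hvs : v ∈ s \ τ := hv ▸ Finset.mem_singleton_self v
  exact ⟨v, (Finset.mem_sdiff.1 hvs).2, by
    rw [Finset.insert_eq, ← hv, Finset.sdiff_union_of_subset hτs]⟩

/-- A codimension one simplex of the subdivision in a facet of `σ` is a face of exactly one
top-dimensional simplex. -/
lemma exists_unique_top (h : IsFan K K' P) {σ : Finset V} (hσ : σ ∈ K) {τ : Finset V'}
    (hc : τ.card + 1 = σ.card) {i : V} (hi : i ∈ σ) (hτ : τ ∈ inCell K' P (σ.erase i)) :
    ∃ s, ∀ t, t ∈ top K' P σ ∧ τ ⊆ t ↔ t = s := by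
  have hτσ : τ ∈ inCell K' P σ := inCell_mono (Finset.erase_subset _ _) hτ
  -- the wall is the coordinate hyperplane `x i = 0`, and `σ` lies on one side of it
  have hspan : Submodule.span ℝ (P '' (τ : Set V'))
      = Finsupp.supported ℝ ℝ ((σ.erase i : Finset V) : Set V) := by
    refine Submodule.eq_of_le_of_finrank_le (span_le hτ) ?_
    rw [finrank_supported, h.finrank_span hτ.1, Finset.card_erase_of_mem hi]
    omega
  have hl : IsWall P σ τ (Finsupp.lapply i) := by
    refine ⟨fun v hv => ?_, fun x hx hx0 => ?_⟩
    · by_contra hne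
      exact Finset.notMem_erase i σ (hτ.2 v hv (Finsupp.mem_support_iff.2 hne))
    · rw [hspan, Finsupp.mem_supported]
      rw [Finsupp.mem_supported] at hx
      intro j hj
      rw [Finset.mem_coe, Finset.mem_erase]
      refine ⟨?_, by exact_mod_cast hx hj⟩
      rintro rfl
      exact Finsupp.mem_support_iff.1 hj hx0
  obtain ⟨v, hv, hvs, -⟩ := hl.side_exists h hσ hτσ hc (z := Finsupp.single i 1)
    (Finsupp.single_mem_supported _ _ (by exact_mod_cast hi)) (by simp) one_pos
    (fun ε hε _ j => by
      rw [Finsupp.add_apply, Finsupp.finsetSum_apply, Finsupp.smul_apply, smul_eq_mul]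
      refine add_nonneg (Finset.sum_nonneg fun u _ => h.nonneg u j) (mul_nonneg hε.le ?_)
      rw [Finsupp.single_apply]
      split_ifs <;> norm_num)
  refine ⟨insert v τ, fun t => ⟨?_, ?_⟩⟩
  · rintro ⟨⟨ht, htc⟩, hτt⟩
    have htc' : t.card = σ.card := htc
    obtain ⟨u, hu, rfl⟩ := eq_insert hτt (by omega)
    have h1 : ∀ w, w ∉ τ → insert w τ ∈ inCell K' P σ → 0 < Finsupp.lapply (R := ℝ) i (P w) :=
      fun w hw hws => (h.nonneg w i).lt_of_ne (hl.ne_zero h hw hws).symm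
    rw [hl.side_unique h hu hv ht hvs (mul_pos (h1 u hu ht) (h1 v hv hvs))]
  · rintro rfl
    exact ⟨⟨hvs, by rw [Set.mem_ofPred_eq, Finset.card_insert_of_notMem hv, hc]⟩,
      Finset.subset_insert _ _⟩

/-- A codimension one simplex of the subdivision in no facet of `σ` is a face of exactly two
top-dimensional simplices. -/
lemma exists_two_top (h : IsFan K K' P) {σ : Finset V} (hσ : σ ∈ K) {τ : Finset V'}
    (hc : τ.card + 1 = σ.card) (hτ : τ ∈ inCell K' P σ)
    (hint : ∀ i ∈ σ, τ ∉ inCell K' P (σ.erase i)) :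
    ∃ s s', s ≠ s' ∧ ∀ t, t ∈ top K' P σ ∧ τ ⊆ t ↔ t = s ∨ t = s' := by
  obtain ⟨l, hl, z, hz, hlz⟩ := h.exists_isWall hτ hc
  have hb : ∀ i ∈ σ, 0 < (∑ u ∈ τ, P u) i := by
    intro i hi
    have : ∃ v ∈ τ, ¬ (P v).support ⊆ σ.erase i := by
      by_contra hn
      push Not at hn
      exact hint i hi ⟨hτ.1, hn⟩
    obtain ⟨v, hv, hvi⟩ := this
    rw [Finsupp.finsetSum_apply]
    refine Finset.sum_pos' (fun u _ => h.nonneg u i) ⟨v, hv, (h.nonneg v i).lt_of_ne ?_⟩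
    intro h0
    refine hvi fun j hj => Finset.mem_erase.2 ⟨?_, hτ.2 v hv hj⟩
    rintro rfl
    exact Finsupp.mem_support_iff.1 hj h0.symm
  -- the sum of the vertices of `τ` is interior to `σ`, so that one can move to both sides
  obtain ⟨ε₀, hε₀, hε⟩ : ∃ ε₀ : ℝ, 0 < ε₀ ∧ ∀ i ∈ σ, ε₀ * |z i| ≤ (∑ u ∈ τ, P u) i := by
    have hne : σ.Nonempty := Finset.card_pos.1 (by omega)
    obtain ⟨j, hj, hmin⟩ := Finset.exists_min_image σ
      (fun i => (∑ u ∈ τ, P u) i / (|z i| + 1)) hne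
    refine ⟨(∑ u ∈ τ, P u) j / (|z j| + 1), div_pos (hb j hj) (by positivity), fun i hi => ?_⟩
    calc _ ≤ (∑ u ∈ τ, P u) i / (|z i| + 1) * |z i| :=
          mul_le_mul_of_nonneg_right (hmin i hi) (abs_nonneg _)
      _ ≤ (∑ u ∈ τ, P u) i := by
          rw [div_mul_eq_mul_div, div_le_iff₀ (by positivity)]
          exact mul_le_mul_of_nonneg_left (by linarith) (hb i hi).le
  have hside : ∀ y ∈ Finsupp.supported ℝ ℝ (σ : Set V), (∀ i, |y i| = |z i|) →
      ∀ ε, 0 < ε → ε ≤ ε₀ → ∀ i, 0 ≤ (∑ u ∈ τ, P u + ε • y) i := by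
    intro y hy hyz ε hε1 hε2 i
    by_cases hi : i ∈ σ
    · have h1 := hε i hi
      have h2 : ε * |y i| ≤ ε₀ * |z i| := by
        rw [hyz]
        exact mul_le_mul_of_nonneg_right hε2 (abs_nonneg _)
      have h3 : -(ε * |y i|) ≤ ε * y i := by
        have := mul_le_mul_of_nonneg_left (neg_abs_le (y i)) hε1.le
        linarith
      rw [Finsupp.add_apply, Finsupp.smul_apply, smul_eq_mul]
      linarith
    · have : y i = 0 := by
        by_contra hne
        rw [Finsupp.mem_supported] at hy
        exact hi (by exact_mod_cast hy (Finsupp.mem_support_iff.2 hne))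
      rw [Finsupp.add_apply, Finsupp.smul_apply, this, smul_zero, add_zero,
        Finsupp.finsetSum_apply]
      exact Finset.sum_nonneg fun u _ => h.nonneg u i
  obtain ⟨v, hv, hvs, hvl⟩ := hl.side_exists h hσ hτ hc hz hlz hε₀ (hside z hz fun _ => rfl)
  obtain ⟨v', hv', hvs', hvl'⟩ := hl.side_exists h hσ hτ hc (Submodule.neg_mem _ hz)
    (by rw [map_neg]; exact neg_ne_zero.2 hlz) hε₀
    (hside (-z) (Submodule.neg_mem _ hz) fun i => by rw [Finsupp.neg_apply, abs_neg])
  rw [map_neg] at hvl'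
  refine ⟨insert v τ, insert v' τ, ?_, fun t => ⟨?_, ?_⟩⟩
  · intro e
    have : v = v' := by
      have hm : v ∈ insert v' τ := e ▸ Finset.mem_insert_self v τ
      exact (Finset.mem_insert.1 hm).resolve_right hv
    subst this
    linarith
  · rintro ⟨⟨ht, htc⟩, hτt⟩
    have htc' : t.card = σ.card := htc
    obtain ⟨u, hu, rfl⟩ := eq_insert hτt (by omega)
    rcases lt_or_gt_of_ne (mul_ne_zero (hl.ne_zero h hu ht) hlz) with hlt | hgt
    · right
      rw [hl.side_unique h hu hv' ht hvs']
      have hz2 : 0 < l z * l z := mul_self_pos.2 hlz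
      have h3 : 0 < (l (P u) * l (P v')) * (l z * l z) := by nlinarith
      exact pos_of_mul_pos_left h3 hz2.le
    · left
      rw [hl.side_unique h hu hv ht hvs]
      have hz2 : 0 < l z * l z := mul_self_pos.2 hlz
      have h3 : 0 < (l (P u) * l (P v)) * (l z * l z) := by nlinarith
      exact pos_of_mul_pos_left h3 hz2.le
  · rintro (rfl | rfl)
    · exact ⟨⟨hvs, by rw [Set.mem_ofPred_eq, Finset.card_insert_of_notMem hv, hc]⟩,
        Finset.subset_insert _ _⟩
    · exact ⟨⟨hvs', by rw [Set.mem_ofPred_eq, Finset.card_insert_of_notMem hv', hc]⟩,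
        Finset.subset_insert _ _⟩

lemma finite_top (h : IsFan K K' P) (σ : Finset V) : (top K' P σ).Finite :=
  h.finite.subset fun _ hs => hs.1.1

/-- The subdivision operator: it sends a simplex to the sum of the top-dimensional simplices of its
subdivision. -/
def chainMap (h : IsFan K K' P) : Chain V →ₗ[ZMod 2] Chain V' :=
  chainLift fun σ => ∑ s ∈ (h.finite_top σ).toFinset, simplex s

lemma chainMap_simplex (h : IsFan K K' P) (σ : Finset V) :
    h.chainMap (simplex σ) = ∑ s ∈ (h.finite_top σ).toFinset, simplex s := by
  simp [chainMap]

lemma chainMap_simplex_apply (h : IsFan K K' P) (σ : Finset V) (t : Finset V') :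
    h.chainMap (simplex σ) t = if t ∈ top K' P σ then 1 else 0 := by
  rw [chainMap_simplex, Finsupp.finsetSum_apply]
  simp only [Finsupp.single_apply]
  rw [Finset.sum_ite_eq']
  simp

lemma chainMap_simplex_mem (h : IsFan K K' P) (σ : Finset V) :
    h.chainMap (simplex σ) ∈ chainsIn (top K' P σ) := by
  rw [chainMap_simplex]
  exact Submodule.sum_mem _ fun s hs => simplex_mem (by simpa using hs)

lemma chainMap_empty (h : IsFan K K' P) : h.chainMap (simplex ∅) = simplex ∅ := by
  ext t
  rw [chainMap_simplex_apply, Finsupp.single_apply]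
  refine if_congr ⟨fun ht => ?_, ?_⟩ rfl rfl
  · exact (Finset.card_eq_zero.1 (by simpa using ht.2)).symm
  · rintro rfl
    exact ⟨⟨h.empty_mem, by simp⟩, rfl⟩

lemma bd_chainMap (h : IsFan K K' P) {σ : Finset V} (hσ : σ ∈ K) :
    bd (h.chainMap (simplex σ)) = h.chainMap (bd (simplex σ)) := by
  ext τ
  -- the coefficient of `τ` on the left counts the top simplices that contain `τ`, the one on the
  -- right the facets of `σ` in which `τ` has full dimension: one and one if `τ` lies in a facet,
  -- two and none if it lies in `σ` but in no facet
  have hL : bd (h.chainMap (simplex σ)) τ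
      = (({t | (t ∈ top K' P σ ∧ τ ⊆ t) ∧ t.card = τ.card + 1}).ncard : ZMod 2) := by
    rw [bd_apply, ← Set.ncard_coe_finset]
    congr 2
    ext t
    simp only [Finset.coe_filter, Finsupp.mem_support_iff, chainMap_simplex_apply,
      Set.mem_ofPred_eq]
    by_cases ht : t ∈ top K' P σ <;> simp [ht]
  have hR : h.chainMap (bd (simplex σ)) τ
      = ((σ.filter fun i => τ ∈ top K' P (σ.erase i)).card : ZMod 2) := by
    rw [bd_simplex, map_sum, Finsupp.finsetSum_apply]
    simp only [chainMap_simplex_apply]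
    rw [Finset.sum_boole]
  rw [hL, hR]
  have htop : ∀ i ∈ σ, τ ∈ top K' P (σ.erase i) →
      τ.card + 1 = σ.card ∧ τ ∈ inCell K' P (σ.erase i) := fun i hi ht => by
    have h1 : τ.card = (σ.erase i).card := ht.2
    rw [h1, Finset.card_erase_add_one hi]
    exact ⟨rfl, ht.1⟩
  by_cases hcard : τ.card + 1 = σ.card
  swap
  · rw [Finset.filter_eq_empty_iff.2 fun i hi ht => hcard (htop i hi ht).1]
    convert_to ((∅ : Set (Finset V')).ncard : ZMod 2) = _
    · congr 2
      ext t
      simp only [Set.mem_ofPred_eq, Set.mem_empty_iff_false, iff_false]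
      rintro ⟨⟨ht, -⟩, hc⟩
      have : t.card = σ.card := ht.2
      omega
    · simp
  have hset : {t | (t ∈ top K' P σ ∧ τ ⊆ t) ∧ t.card = τ.card + 1}
      = {t | t ∈ top K' P σ ∧ τ ⊆ t} := by
    ext t
    simp only [Set.mem_ofPred_eq, and_iff_left_iff_imp]
    intro ht
    exact Eq.trans ht.1.2 hcard.symm
  rw [hset]
  by_cases hex : ∃ i ∈ σ, τ ∈ inCell K' P (σ.erase i)
  · obtain ⟨i, hi, hτ⟩ := hex
    obtain ⟨s, hs⟩ := h.exists_unique_top hσ hcard hi hτ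
    have h1 : {t | t ∈ top K' P σ ∧ τ ⊆ t} = {s} := by
      ext t
      simp [hs t]
    have h2 : (σ.filter fun i => τ ∈ top K' P (σ.erase i)) = {i} := by
      ext j
      simp only [Finset.mem_filter, Finset.mem_singleton]
      constructor
      · rintro ⟨hj, ht⟩
        by_contra hji
        have h3 : τ ∈ inCell K' P ((σ.erase i).erase j) := by
          refine ⟨hτ.1, fun v hv k hk => ?_⟩
          have h4 := ht.1.2 v hv hk
          have h5 := hτ.2 v hv hk
          rw [Finset.mem_erase] at h4 h5 ⊢
          exact ⟨h4.1, Finset.mem_erase.2 h5⟩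
        have h4 := h.card_le h3
        rw [Finset.card_erase_of_mem (Finset.mem_erase.2 ⟨hji, hj⟩), Finset.card_erase_of_mem hi]
          at h4
        have h5 := Finset.card_le_card (Finset.insert_subset hi (Finset.singleton_subset_iff.2 hj))
        rw [Finset.card_pair (Ne.symm hji)] at h5
        omega
      · rintro rfl
        refine ⟨hi, hτ, ?_⟩
        rw [Set.mem_ofPred_eq, Finset.card_erase_of_mem hi]
        omega
    rw [h1, h2]
    simp
  · push Not at hex
    rw [Finset.filter_eq_empty_iff.2 fun i hi ht => hex i hi (htop i hi ht).2]
    by_cases hτ : τ ∈ inCell K' P σ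
    · obtain ⟨s, s', hne, hs⟩ := h.exists_two_top hσ hcard hτ hex
      have h1 : {t | t ∈ top K' P σ ∧ τ ⊆ t} = {s, s'} := by
        ext t
        simp [hs t]
      rw [h1, Set.ncard_pair hne, Finset.card_empty]
      rfl
    · have h1 : {t | t ∈ top K' P σ ∧ τ ⊆ t} = ∅ := by
        ext t
        simp only [Set.mem_ofPred_eq, Set.mem_empty_iff_false, iff_false]
        exact fun ht => hτ (h.inCell_subset ht.1.1 ht.2)
      rw [h1]
      simp

end IsFan

end Fan

/-! ### Points and topology of the realization -/

section Realization

variable {V Y Z : Type*} {K : Complex V}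

lemma faces_subset {s t : Finset V} (hs : s ∈ K.faces) (hts : t ⊆ s) (ht : t.Nonempty) :
    t ∈ K.faces :=
  (K.isRelLowerSet_faces hs).2 hts ht

lemma faces_nonempty {s : Finset V} (hs : s ∈ K.faces) : s.Nonempty :=
  (K.isRelLowerSet_faces hs).1

namespace Realization

lemma ext {x y : Realization K} (h : ∀ v, x.1 v = y.1 v) : x = y :=
  Subtype.ext (Finsupp.ext h)

lemma nonneg (x : Realization K) (v : V) : 0 ≤ x.1 v := x.2.1 v

lemma support_mem (x : Realization K) : x.1.support ∈ K.faces := x.2.2.2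

lemma sum_eq_one (x : Realization K) {s : Finset V} (hs : x.1.support ⊆ s) :
    ∑ v ∈ s, x.1 v = 1 := by
  refine Eq.trans ?_ x.2.2.1
  rw [Finsupp.sum]
  exact (Finset.sum_subset hs fun v _ hv => by simpa using hv).symm

lemma le_one (x : Realization K) (v : V) : x.1 v ≤ 1 := by
  classical
  exact (Finset.single_le_sum (f := fun v => x.1 v) (fun _ _ => x.nonneg _)
    (Finset.mem_insert_self v x.1.support)).trans
    (x.sum_eq_one (Finset.subset_insert v x.1.support)).le

lemma pos_iff (x : Realization K) (v : V) : 0 < x.1 v ↔ v ∈ x.1.support := by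
  rw [Finsupp.mem_support_iff]
  exact ⟨fun h => h.ne', fun h => (x.nonneg v).lt_of_ne h.symm⟩

lemma exists_pos (x : Realization K) : ∃ v, 0 < x.1 v := by
  obtain ⟨v, hv⟩ := faces_nonempty x.support_mem
  exact ⟨v, (x.pos_iff v).2 hv⟩

/-- A point given by its coordinates on a face. -/
def mk (s : Finset V) (hs : s ∈ K.faces) (f : V → ℝ) (hf : ∀ v ∈ s, 0 ≤ f v)
    (h1 : ∑ v ∈ s, f v = 1) : Realization K :=
  ⟨Finsupp.indicator s fun v _ => f v, by
    classical
    have hsub : (Finsupp.indicator s fun v _ => f v).support ⊆ s :=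
      Finsupp.support_indicator_subset _ _
    have hsum : ((Finsupp.indicator s fun v _ => f v).sum fun _ t => t) = 1 := by
      rw [Finsupp.sum_of_support_subset _ hsub _ fun _ _ => rfl, ← h1]
      exact Finset.sum_congr rfl fun v hv => by rw [Finsupp.indicator_of_mem hv]
    refine ⟨fun v => ?_, hsum, faces_subset hs hsub ?_⟩
    · rw [Finsupp.indicator_apply]
      split_ifs with hv
      · exact hf v hv
      · exact le_rfl
    · rw [Finset.nonempty_iff_ne_empty]
      intro h
      rw [Finsupp.support_eq_empty] at h
      rw [h] at hsum
      simp at hsum⟩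

lemma mk_apply [DecidableEq V] (s : Finset V) (hs : s ∈ K.faces) (f : V → ℝ)
    (hf : ∀ v ∈ s, 0 ≤ f v) (h1 : ∑ v ∈ s, f v = 1) (v : V) :
    (mk s hs f hf h1).1 v = if v ∈ s then f v else 0 := by
  simp [mk, Finsupp.indicator_apply]

lemma support_mk_subset (s : Finset V) (hs : s ∈ K.faces) (f : V → ℝ)
    (hf : ∀ v ∈ s, 0 ≤ f v) (h1 : ∑ v ∈ s, f v = 1) : (mk s hs f hf h1).1.support ⊆ s :=
  Finsupp.support_indicator_subset _ _

/-- A vertex as a point of the realization. -/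
def vertex (v : V) (hv : {v} ∈ K.faces) : Realization K :=
  mk {v} hv (fun _ => 1) (fun _ _ => zero_le_one) (by simp)

lemma vertex_val (v : V) (hv : {v} ∈ K.faces) : (vertex v hv).1 = Finsupp.single v 1 := by
  classical
  ext u
  rw [vertex, mk_apply, Finsupp.single_apply]
  simp only [Finset.mem_singleton, eq_comm]

/-- The convex combination, with weights `w`, of points in a common closed simplex. -/
lemma convex_mem {t : Finset V} (ht : t ∈ K.faces) {s : Finset Y} {p : Y → Realization K}
    (hp : ∀ v ∈ s, (p v).1.support ⊆ t) {w : Y → ℝ} (hw : ∀ v ∈ s, 0 ≤ w v)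
    (hw1 : ∑ v ∈ s, w v = 1) :
    (∀ i, 0 ≤ (∑ v ∈ s, w v • (p v).1) i) ∧
      ((∑ v ∈ s, w v • (p v).1).sum fun _ t => t) = 1 ∧
      (∑ v ∈ s, w v • (p v).1).support ∈ K.faces ∧ (∑ v ∈ s, w v • (p v).1).support ⊆ t := by
  classical
  have hap : ∀ i, (∑ v ∈ s, w v • (p v).1) i = ∑ v ∈ s, w v * (p v).1 i := fun i => by
    rw [Finsupp.finsetSum_apply]
    rfl
  have hsub : (∑ v ∈ s, w v • (p v).1).support ⊆ t := by
    intro i hi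
    rw [Finsupp.mem_support_iff, hap] at hi
    obtain ⟨v, hv, hne⟩ := Finset.exists_ne_zero_of_sum_ne_zero hi
    exact hp v hv (Finsupp.mem_support_iff.2 (right_ne_zero_of_mul hne))
  have hsum : ((∑ v ∈ s, w v • (p v).1).sum fun _ t => t) = 1 := by
    rw [Finsupp.sum_of_support_subset _ hsub _ fun _ _ => rfl]
    simp only [hap]
    rw [Finset.sum_comm]
    refine Eq.trans ?_ hw1
    refine Finset.sum_congr rfl fun v hv => ?_
    rw [← Finset.mul_sum, (p v).sum_eq_one (hp v hv), mul_one]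
  refine ⟨fun i => ?_, hsum, faces_subset ht hsub ?_, hsub⟩
  · rw [hap]
    exact Finset.sum_nonneg fun v hv => mul_nonneg (hw v hv) ((p v).nonneg i)
  · rw [Finset.nonempty_iff_ne_empty]
    intro h
    rw [Finsupp.support_eq_empty] at h
    rw [h] at hsum
    simp at hsum

/-! #### Continuity -/

lemma continuous_of_cell {s : Finset V} (hs : s ∈ K.faces) :
    Continuous fun x : Cell K s => x.1 :=
  continuous_iff_coinduced_le.2 (le_iSup (fun s : K.faces => TopologicalSpace.coinduced
    (fun x : Cell K s.1 => (x.1 : Realization K)) inferInstance) ⟨s, hs⟩)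

lemma continuous_dom_iff [TopologicalSpace Z] {f : Realization K → Z} :
    Continuous f ↔ ∀ s ∈ K.faces, Continuous fun x : Cell K s => f x.1 := by
  refine ⟨fun h s hs => h.comp (continuous_of_cell hs), fun h => ?_⟩
  refine continuous_iSup_dom.2 fun s => continuous_coinduced_dom.2 (h s.1 s.2)

lemma isClosed_iff {C : Set (Realization K)} :
    IsClosed C ↔ ∀ s ∈ K.faces, IsClosed {x : Cell K s | x.1 ∈ C} := by
  refine ⟨fun h s hs => h.preimage (continuous_of_cell hs), fun h => ?_⟩
  exact isClosed_iSup_iff.2 fun s => isClosed_coinduced.2 (h s.1 s.2)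

lemma continuous_cell_coord (s : Finset V) (v : V) :
    Continuous fun x : Cell K s => x.1.1 v :=
  (continuous_apply v).comp continuous_induced_dom

lemma continuous_coord (v : V) : Continuous fun x : Realization K => x.1 v :=
  continuous_dom_iff.2 fun s _ => continuous_cell_coord s v

instance : T2Space (Realization K) :=
  T2Space.of_injective_continuous (f := fun x (v : V) => x.1 v)
    (fun _ _ h => ext fun v => congrFun h v) (continuous_pi fun v => continuous_coord v)

instance (s : Finset V) : T2Space (Cell K s) :=
  T2Space.of_injective_continuous (f := fun x (v : V) => x.1.1 v)
    (fun _ _ h => Subtype.ext (ext fun v => congrFun h v))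
    (continuous_pi fun v => continuous_cell_coord s v)

lemma continuous_into_cell [TopologicalSpace Z] {s : Finset V} {g : Z → Cell K s}
    (h : ∀ v, Continuous fun z => (g z).1.1 v) : Continuous g :=
  continuous_induced_rng.2 (continuous_pi h)

/-- A map into finitely many closed simplices is continuous if its coordinates are. -/
lemma continuous_of_coord [TopologicalSpace Z] {g : Z → Realization K}
    (h : ∀ v, Continuous fun z => (g z).1 v) {Φ : Set (Finset V)} (hfin : Φ.Finite)
    (hΦ : Φ ⊆ K.faces) (hg : ∀ z, ∃ s ∈ Φ, (g z).1.support ⊆ s) : Continuous g := by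
  have := hfin.to_subtype
  refine LocallyFinite.continuous (f := fun s : Φ => {z | (g z).1.support ⊆ s.1})
    (locallyFinite_of_finite _) ?_ ?_ ?_
  · refine Set.eq_univ_of_forall fun z => ?_
    obtain ⟨s, hs, hz⟩ := hg z
    exact Set.mem_iUnion.2 ⟨⟨s, hs⟩, hz⟩
  · rintro ⟨s, hs⟩
    have : {z | (g z).1.support ⊆ s} = ⋂ v ∈ {v | v ∉ s}, {z | (g z).1 v = 0} := by
      ext z
      simp only [Set.mem_ofPred_eq, Set.mem_iInter]
      refine ⟨fun hz v hv => ?_, fun hz v hv => ?_⟩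
      · by_contra hne
        exact hv (hz (Finsupp.mem_support_iff.2 hne))
      · by_contra hvs
        exact Finsupp.mem_support_iff.1 hv (hz v hvs)
    change IsClosed {z | (g z).1.support ⊆ s}
    rw [this]
    exact isClosed_biInter fun v _ => isClosed_eq (h v) continuous_const
  · rintro ⟨s, hs⟩
    rw [continuousOn_iff_continuous_domRestrict]
    let G : {z | (g z).1.support ⊆ s} → Cell K s := fun z => ⟨g z.1, z.2⟩
    have hc : Continuous G :=
      continuous_into_cell fun v => (h v).comp continuous_subtype_val
    exact (continuous_of_cell (hΦ hs)).comp hc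

lemma compactSpace_cell {s : Finset V} (hs : s ∈ K.faces) : CompactSpace (Cell K s) := by
  classical
  have : CompactSpace (stdSimplex ℝ s) := isCompact_iff_compactSpace.1 (isCompact_stdSimplex ℝ s)
  let ext0 : stdSimplex ℝ s → V → ℝ := fun w v => if h : v ∈ s then w.1 ⟨v, h⟩ else 0
  have hsum : ∀ w, ∑ v ∈ s, ext0 w v = 1 := fun w => by
    rw [← w.2.2, ← Finset.sum_coe_sort s]
    exact Finset.sum_congr rfl fun v _ => by simp [ext0]
  have hnn : ∀ w, ∀ v ∈ s, 0 ≤ ext0 w v := fun w v hv => by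
    simp only [ext0, hv, dif_pos]
    exact w.2.1 _
  let F : stdSimplex ℝ s → Cell K s := fun w =>
    ⟨mk s hs (ext0 w) (hnn w) (hsum w), support_mk_subset _ _ _ _ _⟩
  refine Function.Surjective.compactSpace (f := F) ?_ ?_
  · refine continuous_into_cell fun v => ?_
    simp only [F, mk_apply]
    by_cases hv : v ∈ s
    · simp only [ext0, hv, if_true, dif_pos]
      exact (continuous_apply _).comp continuous_subtype_val
    · simp only [hv, if_false]
      exact continuous_const
  · intro x
    refine ⟨⟨fun v => x.1.1 v, fun v => x.1.nonneg v, ?_⟩, ?_⟩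
    · rw [Finset.sum_coe_sort s fun v => x.1.1 v]
      exact x.1.sum_eq_one x.2
    · refine Subtype.ext (ext fun v => ?_)
      simp only [F, mk_apply, ext0]
      split_ifs with hv
      · rfl
      · by_contra hne
        exact hv (x.2 (Finsupp.mem_support_iff.2 (Ne.symm hne)))

/-- A compact set meets the interiors of only finitely many simplices. -/
lemma finite_supports [TopologicalSpace Z] [CompactSpace Z] {g : Z → Realization K}
    (hg : Continuous g) : (Set.range fun z => (g z).1.support).Finite := by
  classical
  set Φ := Set.range fun z => (g z).1.support with hΦ
  choose pt hpt using fun s : Φ => s.2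
  let D : Set (Realization K) := Set.range fun s => g (pt s)
  -- a set of points with pairwise different carriers is closed, as are all of its subsets
  have hclosed : ∀ E ⊆ D, IsClosed E := by
    intro E hE
    refine isClosed_iff.2 fun s _ => Set.Finite.isClosed ?_
    refine Set.Finite.of_finite_image (f := fun x : Cell K s => x.1.1.support)
      ((Finset.finite_toSet s.powerset).subset ?_) ?_
    · rintro _ ⟨x, -, rfl⟩
      simpa using x.2
    · intro x hx y hy hxy
      obtain ⟨a, hax⟩ := hE hx
      obtain ⟨b, hby⟩ := hE hy
      have h1 : (g (pt a)).1.support = a := hpt a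
      have h2 : (g (pt b)).1.support = b := hpt b
      have hax' : g (pt a) = x.1 := hax
      have hby' : g (pt b) = y.1 := hby
      have : a = b := by
        refine Subtype.ext ?_
        rw [← h1, ← h2, hax', hby']
        exact hxy
      exact Subtype.ext (by rw [← hax', ← hby', this])
  have hcomp : IsCompact D := by
    refine (isCompact_range hg).of_isClosed_subset (hclosed D subset_rfl) ?_
    rintro _ ⟨s, rfl⟩
    exact Set.mem_range_self _
  have hdisc : DiscreteTopology D := by
    rw [discreteTopology_iff_forall_isClosed]
    intro E
    have := (hclosed (Subtype.val '' E) (by rintro _ ⟨x, -, rfl⟩; exact x.2)).preimage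
      (continuous_subtype_val (p := (· ∈ D)))
    rwa [Set.preimage_image_eq _ Subtype.val_injective] at this
  have hfin : D.Finite := hcomp.finite ⟨hdisc⟩
  have : Finite Φ := by
    have := hfin.to_subtype
    refine Finite.of_injective (Set.rangeFactorization fun s => g (pt s)) fun s t hst => ?_
    have h1 : g (pt s) = g (pt t) := congrArg Subtype.val hst
    refine Subtype.ext ?_
    rw [← hpt s, ← hpt t]
    exact congrArg (fun x : Realization K => x.1.support) h1
  exact Set.toFinite Φ

lemma compactSpace (hK : K.faces.Finite) : CompactSpace (Realization K) := by
  have := hK.to_subtype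
  have h : (Set.univ : Set (Realization K))
      = ⋃ s : K.faces, Set.range fun x : Cell K s.1 => (x.1 : Realization K) := by
    refine (Set.eq_univ_of_forall fun x => ?_).symm
    exact Set.mem_iUnion.2 ⟨⟨_, x.support_mem⟩, ⟨⟨x, subset_rfl⟩, rfl⟩⟩
  refine ⟨?_⟩
  rw [h]
  refine isCompact_iUnion fun s => ?_
  have := compactSpace_cell s.2
  exact isCompact_range (continuous_of_cell s.2)

/-- Lebesgue's lemma for the realization of a finite complex, in barycentric coordinates. -/
lemma exists_lebesgue (hK : K.faces.Finite) {ι : Type*} (U : ι → Set (Realization K))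
    (hU : ∀ i, IsOpen (U i)) (hcov : ∀ x, ∃ i, x ∈ U i) :
    ∃ δ : ℝ, 0 < δ ∧ ∀ x : Realization K, ∃ i, ∀ y : Realization K,
      (∀ v, |y.1 v - x.1 v| < δ) → y ∈ U i := by
  classical
  have := compactSpace hK
  let W : Finset V := hK.toFinset.biUnion id
  have hW : ∀ (x : Realization K) v, v ∉ W → x.1 v = 0 := by
    intro x v hv
    by_contra hne
    refine hv (Finset.mem_biUnion.2 ⟨x.1.support, ?_, Finsupp.mem_support_iff.2 hne⟩)
    simpa using x.support_mem
  let J : Realization K → W → ℝ := fun x v => x.1 v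
  have hJ : Topology.IsClosedEmbedding J := by
    refine Continuous.isClosedEmbedding (continuous_pi fun v => continuous_coord v.1) ?_
    intro x y hxy
    refine ext fun v => ?_
    by_cases hv : v ∈ W
    · exact congrFun hxy ⟨v, hv⟩
    · rw [hW x v hv, hW y v hv]
  choose O hO hOU using fun i => hJ.isInducing.isOpen_iff.1 (hU i)
  obtain ⟨δ, hδ, h⟩ := lebesgue_number_lemma_of_metric (isCompact_range hJ.continuous) hO (by
    rintro _ ⟨x, rfl⟩
    obtain ⟨i, hi⟩ := hcov x
    rw [← hOU i] at hi
    exact Set.mem_iUnion.2 ⟨i, hi⟩)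
  refine ⟨δ, hδ, fun x => ?_⟩
  obtain ⟨i, hi⟩ := h (J x) (Set.mem_range_self x)
  refine ⟨i, fun y hy => ?_⟩
  rw [← hOU i]
  refine hi ?_
  rw [Metric.mem_ball, dist_pi_lt_iff hδ]
  intro v
  rw [Real.dist_eq]
  exact hy v

end Realization

/-- Points `p v` in the realization of `L`, one for every `v`, such that those belonging to a
simplex of `K` lie in a common closed simplex. -/
def IsAffineOn {W : Type*} (K : Complex V) {L : Complex W} (p : V → Realization L) : Prop :=
  ∀ s ∈ K.faces, ∃ t ∈ L.faces, ∀ v ∈ s, (p v).1.support ⊆ t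

/-- The map of realizations that is affine on every simplex and sends each vertex `v` to `p v`. -/
def affineMap {W : Type*} {L : Complex W} {p : V → Realization L} (hp : IsAffineOn K p)
    (x : Realization K) : Realization L :=
  ⟨x.1.sum fun v t => t • (p v).1, by
    obtain ⟨t, ht, hpt⟩ := hp _ x.support_mem
    have := Realization.convex_mem ht hpt (fun v _ => x.nonneg v) (x.sum_eq_one subset_rfl)
    exact ⟨this.1, this.2.1, this.2.2.1⟩⟩

lemma affineMap_apply {W : Type*} {L : Complex W} {p : V → Realization L} (hp : IsAffineOn K p)
    (x : Realization K) {s : Finset V} (hs : x.1.support ⊆ s) (i : W) :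
    (affineMap hp x).1 i = ∑ v ∈ s, x.1 v * (p v).1 i := by
  have : (affineMap hp x).1 = ∑ v ∈ s, x.1 v • (p v).1 :=
    Finsupp.sum_of_support_subset _ hs (fun v t => t • (p v).1) fun _ _ => zero_smul _ _
  rw [this, Finsupp.finsetSum_apply]
  rfl

lemma support_affineMap_subset {W : Type*} {L : Complex W} {p : V → Realization L}
    (hp : IsAffineOn K p) (x : Realization K) {t : Finset W}
    (h : ∀ v ∈ x.1.support, (p v).1.support ⊆ t) : (affineMap hp x).1.support ⊆ t := by
  intro i hi
  rw [Finsupp.mem_support_iff, affineMap_apply hp x subset_rfl] at hi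
  obtain ⟨v, hv, hne⟩ := Finset.exists_ne_zero_of_sum_ne_zero hi
  exact h v hv (Finsupp.mem_support_iff.2 (right_ne_zero_of_mul hne))

lemma continuous_affineMap {W : Type*} {L : Complex W} {p : V → Realization L}
    (hp : IsAffineOn K p) : Continuous (affineMap hp) := by
  refine Realization.continuous_dom_iff.2 fun s hs => ?_
  obtain ⟨t, ht, hpt⟩ := hp s hs
  refine Realization.continuous_of_coord (fun i => ?_) (Set.finite_singleton t)
    (by simpa using ht) fun x => ⟨t, rfl, ?_⟩
  · have : (fun x : Cell K s => (affineMap hp x.1).1 i)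
        = fun x => ∑ v ∈ s, x.1.1 v * (p v).1 i := funext fun x => affineMap_apply hp x.1 x.2 i
    rw [this]
    exact continuous_finsetSum _ fun v _ =>
      (Realization.continuous_cell_coord s v).mul continuous_const
  · exact support_affineMap_subset hp x.1 fun v hv => hpt v (x.2 hv)

lemma SimplicialMap.realize_val {W : Type*} {L : Complex W} (f : SimplicialMap K L)
    (x : Realization K) : (f.realize x).1 = x.1.mapDomain f.toFun := rfl

lemma SimplicialMap.support_realize_subset {W : Type*} [DecidableEq W] {L : Complex W}
    (f : SimplicialMap K L) (x : Realization K) {s : Finset V} (hs : x.1.support ⊆ s) :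
    (f.realize x).1.support ⊆ s.image f.toFun := by
  rw [f.realize_val]
  exact (Finsupp.mapDomain_support).trans (Finset.image_subset_image hs)

lemma SimplicialMap.image_mem' {W : Type*} [DecidableEq W] {L : Complex W}
    (f : SimplicialMap K L) {s : Finset V} (hs : s ∈ K.faces) : s.image f.toFun ∈ L.faces := by
  convert f.image_mem s hs

lemma SimplicialMap.realize_apply {W : Type*} [DecidableEq W] {L : Complex W}
    (f : SimplicialMap K L) (x : Realization K) {s : Finset V} (hs : x.1.support ⊆ s) (w : W) :
    (f.realize x).1 w = ∑ v ∈ s, if f.toFun v = w then x.1 v else 0 := by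
  rw [f.realize_val, Finsupp.mapDomain, Finsupp.sum_of_support_subset _ hs _ (by simp),
    Finsupp.finsetSum_apply]
  simp only [Finsupp.single_apply]

lemma SimplicialMap.continuous_realize {W : Type*} {L : Complex W} (f : SimplicialMap K L) :
    Continuous f.realize := by
  classical
  refine Realization.continuous_dom_iff.2 fun s hs => ?_
  refine Realization.continuous_of_coord (fun w => ?_) (Set.finite_singleton (s.image f.toFun))
    (by simpa using f.image_mem' hs) fun x => ⟨_, rfl, f.support_realize_subset x.1 x.2⟩
  have : (fun x : Cell K s => (f.realize x.1).1 w)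
      = fun x => ∑ v ∈ s, if f.toFun v = w then x.1.1 v else 0 :=
    funext fun x => f.realize_apply x.1 x.2 w
  rw [this]
  refine continuous_finsetSum _ fun v _ => ?_
  split_ifs
  · exact Realization.continuous_cell_coord s v
  · exact continuous_const

end Realization

/-! ### Barycentric subdivision of affine chains -/

section Sd

open scoped Classical

variable {V : Type*} {S : Complex V}

/-- The finite sets of points of `|S|` that lie in a common closed simplex. -/
def cellSets (S : Complex V) : Set (Finset (Realization S)) :=
  {s | ∃ t ∈ S.faces, ∀ x ∈ s, x.1.support ⊆ t}

lemma cellSets_subset {s t : Finset (Realization S)} (hs : s ∈ cellSets S) (hts : t ⊆ s) :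
    t ∈ cellSets S := by
  obtain ⟨r, hr, h⟩ := hs
  exact ⟨r, hr, fun x hx => h x (hts hx)⟩

lemma cellSets_image {a : SimplicialMap S S} {s : Finset (Realization S)} (hs : s ∈ cellSets S) :
    s.image a.realize ∈ cellSets S := by
  obtain ⟨t, ht, h⟩ := hs
  refine ⟨t.image a.toFun, a.image_mem' ht, fun x hx => ?_⟩
  obtain ⟨y, hy, rfl⟩ := Finset.mem_image.1 hx
  exact a.support_realize_subset y (h y hy)

lemma empty_mem_cellSets [h : Nonempty (Realization S)] : ∅ ∈ cellSets S :=
  ⟨_, h.some.support_mem, by simp⟩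

variable [Nonempty (Realization S)]

/-- The barycenter of a nonempty finite set of points in a common closed simplex (an arbitrary
point for other sets). -/
def bary (s : Finset (Realization S)) : Realization S :=
  if h : s ∈ cellSets S ∧ s.Nonempty then
    ⟨∑ x ∈ s, (s.card : ℝ)⁻¹ • x.1, by
      obtain ⟨⟨t, ht, hts⟩, hn⟩ := h
      have := Realization.convex_mem (p := fun x => x) ht hts
        (w := fun _ => (s.card : ℝ)⁻¹) (fun _ _ => by positivity) (by
          have : (s.card : ℝ) ≠ 0 := by exact_mod_cast hn.card_pos.ne'
          rw [Finset.sum_const, nsmul_eq_mul, mul_inv_cancel₀ this])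
      exact ⟨this.1, this.2.1, this.2.2.1⟩⟩
  else Classical.arbitrary _

lemma bary_val {s : Finset (Realization S)} (hs : s ∈ cellSets S) (hn : s.Nonempty) :
    (bary s).1 = ∑ x ∈ s, (s.card : ℝ)⁻¹ • x.1 := by
  exact congrArg Subtype.val (dif_pos ⟨hs, hn⟩)

lemma bary_apply {s : Finset (Realization S)} (hs : s ∈ cellSets S) (hn : s.Nonempty) (v : V) :
    (bary s).1 v = (s.card : ℝ)⁻¹ * ∑ x ∈ s, x.1 v := by
  rw [bary_val hs hn, Finsupp.finsetSum_apply, Finset.mul_sum]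
  rfl

lemma support_bary_subset {s : Finset (Realization S)} (hs : s ∈ cellSets S) (hn : s.Nonempty)
    {t : Finset V} (ht : ∀ x ∈ s, x.1.support ⊆ t) : (bary s).1.support ⊆ t := by
  intro v hv
  rw [Finsupp.mem_support_iff, bary_apply hs hn] at hv
  obtain ⟨x, hx, hne⟩ := Finset.exists_ne_zero_of_sum_ne_zero (right_ne_zero_of_mul hv)
  exact ht x hx (Finsupp.mem_support_iff.2 hne)

lemma realize_bary {a : SimplicialMap S S} (ha : Function.Injective a.realize)
    {s : Finset (Realization S)} (hs : s ∈ cellSets S) (hn : s.Nonempty) :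
    bary (s.image a.realize) = a.realize (bary s) := by
  refine Subtype.ext ?_
  rw [bary_val (cellSets_image hs) (hn.image _), a.realize_val, bary_val hs hn,
    Finset.sum_image ha.injOn, Finset.card_image_of_injective _ ha,
    Finsupp.mapDomain_finsetSum]
  refine Finset.sum_congr rfl fun x _ => ?_
  rw [Finsupp.mapDomain_smul, a.realize_val]

lemma isFreeFamily_cellSets {a : SimplicialMap S S} (hinv : ∀ x, a.realize (a.realize x) = x)
    (hfree : ∀ x, a.realize x ≠ x) : IsFreeFamily (cellSets S) a.realize where
  involutive := hinv
  subset _ hs _ hts := cellSets_subset hs hts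
  image _ hs := cellSets_image hs
  free s hs hn h := by
    have := realize_bary (Function.Involutive.injective hinv) hs hn
    rw [h] at this
    exact hfree _ this.symm

/-- The `n`-fold iterated barycentric subdivision of affine chains. -/
def sdIter (S : Complex V) [Nonempty (Realization S)] (n : ℕ) :
    Chain (Realization S) →ₗ[ZMod 2] Chain (Realization S) :=
  (subdiv bary : Module.End (ZMod 2) (Chain (Realization S))) ^ n

@[simp] lemma sdIter_zero (c : Chain (Realization S)) : sdIter S 0 c = c := by
  simp [sdIter]

lemma sdIter_succ (n : ℕ) (c : Chain (Realization S)) :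
    sdIter S (n + 1) c = subdiv bary (sdIter S n c) := by
  rw [sdIter, pow_succ', Module.End.mul_apply, sdIter]

@[simp] lemma sdIter_empty (n : ℕ) : sdIter S n (simplex ∅) = simplex ∅ := by
  induction n with
  | zero => simp
  | succ n ih => rw [sdIter_succ, ih, subdiv_empty]

lemma bd_sdIter (n : ℕ) (c : Chain (Realization S)) :
    bd (sdIter S n c) = sdIter S n (bd c) := by
  induction n with
  | zero => simp
  | succ n ih => rw [sdIter_succ, sdIter_succ, bd_subdiv, ih]

lemma subdiv_bary_mem {R R' : Set (Finset (Realization S))}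
    (h : ∀ s ∈ R, ∀ t, IsFlagImage bary s t → t.card = s.card → t ∈ R')
    {c : Chain (Realization S)} (hc : c ∈ chainsIn R) : subdiv bary c ∈ chainsIn R' :=
  map_mem_of_chainsIn hc _ fun s hs =>
    Finsupp.supported_mono (fun t ht => h s hs t ht.1 ht.2) (subdiv_mem bary s)

lemma sdIter_mem {R : Set (Finset (Realization S))}
    (h : ∀ s ∈ R, ∀ t, IsFlagImage bary s t → t.card = s.card → t ∈ R) (n : ℕ)
    {c : Chain (Realization S)} (hc : c ∈ chainsIn R) : sdIter S n c ∈ chainsIn R := by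
  induction n with
  | zero => simpa using hc
  | succ n ih =>
    rw [sdIter_succ]
    exact subdiv_bary_mem h ih

lemma flagImage_points {Q : Realization S → Prop} {s t : Finset (Realization S)}
    (hQ : ∀ r ⊆ s, r.Nonempty → (∀ x ∈ r, Q x) → Q (bary r))
    (hsQ : ∀ x ∈ s, Q x) (ht : IsFlagImage bary s t) : ∀ x ∈ t, Q x := by
  obtain ⟨F, hF, -, rfl⟩ := ht
  intro x hx
  obtain ⟨r, hr, rfl⟩ := Finset.mem_image.1 hx
  exact hQ r (hF r hr).1 (hF r hr).2 fun x hx => hsQ x ((hF r hr).1 hx)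

lemma flagImage_mem_cellSets {s t : Finset (Realization S)} (hs : s ∈ cellSets S)
    (ht : IsFlagImage bary s t) : t ∈ cellSets S := by
  obtain ⟨r, hr, h⟩ := id hs
  exact ⟨r, hr, flagImage_points (fun q hq hn h' =>
    support_bary_subset (cellSets_subset hs hq) hn h') h ht⟩

lemma push_sdIter {a : SimplicialMap S S} (ha : Function.Injective a.realize) (n : ℕ)
    {c : Chain (Realization S)} (hc : c ∈ chainsIn (cellSets S)) :
    push a.realize (sdIter S n c) = sdIter S n (push a.realize c) := by
  induction n with
  | zero => simp
  | succ n ih =>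
    rw [sdIter_succ, sdIter_succ, ← ih]
    refine eqOn_chainsIn (F := push a.realize ∘ₗ subdiv bary) (F' := subdiv bary ∘ₗ push a.realize)
      (sdIter_mem (fun s hs t ht _ => flagImage_mem_cellSets hs ht) n hc) fun s hs => ?_
    rw [LinearMap.comp_apply, LinearMap.comp_apply, push_subdiv]
    exact (subdiv_push fun t ht hn => realize_bary ha (cellSets_subset hs ht) hn).symm

/-! #### Mesh -/

lemma abs_average_sub_le {X : Type*} {f : X → ℝ} {r r' : Finset X} (hr : r ⊆ r')
    (hn : r.Nonempty) {N : ℕ} (hN : r'.card ≤ N) {D : ℝ}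
    (hD : ∀ x ∈ r', ∀ y ∈ r', |f x - f y| ≤ D) :
    |(r.card : ℝ)⁻¹ * ∑ x ∈ r, f x - (r'.card : ℝ)⁻¹ * ∑ x ∈ r', f x|
      ≤ (1 - (N : ℝ)⁻¹) * D := by
  have hr0 : (0 : ℝ) < r.card := by exact_mod_cast hn.card_pos
  have hr'0 : (0 : ℝ) < r'.card := by exact_mod_cast (hn.mono hr).card_pos
  have hrN : (r'.card : ℝ) ≤ N := by exact_mod_cast hN
  set A := (r'.card : ℝ)⁻¹ * ∑ x ∈ r', f x with hA
  have hD0 : 0 ≤ D := by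
    obtain ⟨x, hx⟩ := hn
    have := hD x (hr hx) x (hr hx)
    rwa [sub_self, abs_zero] at this
  have h1 : ∀ q ∈ r, |f q - A| ≤ (1 - (N : ℝ)⁻¹) * D := by
    intro q hq
    have h2 : f q - A = (r'.card : ℝ)⁻¹ * ∑ y ∈ r'.erase q, (f q - f y) := by
      have : ∑ y ∈ r'.erase q, (f q - f y) = ∑ y ∈ r', (f q - f y) := by
        rw [← Finset.add_sum_erase r' _ (hr hq), sub_self, zero_add]
      rw [this, Finset.sum_sub_distrib, Finset.sum_const, nsmul_eq_mul, hA]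
      field_simp
    have h3 : |∑ y ∈ r'.erase q, (f q - f y)| ≤ ((r'.card : ℝ) - 1) * D := by
      refine (Finset.abs_sum_le_sum_abs _ _).trans ?_
      refine (Finset.sum_le_sum fun y hy => hD q (hr hq) y (Finset.mem_of_mem_erase hy)).trans ?_
      rw [Finset.sum_const, nsmul_eq_mul, Finset.card_erase_of_mem (hr hq),
        Nat.cast_sub (Finset.card_pos.2 ⟨q, hr hq⟩), Nat.cast_one]
    rw [h2, abs_mul, abs_of_pos (inv_pos.2 hr'0)]
    calc _ ≤ (r'.card : ℝ)⁻¹ * (((r'.card : ℝ) - 1) * D) :=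
          mul_le_mul_of_nonneg_left h3 (inv_pos.2 hr'0).le
      _ = (1 - (r'.card : ℝ)⁻¹) * D := by field_simp
      _ ≤ (1 - (N : ℝ)⁻¹) * D := by
          refine mul_le_mul_of_nonneg_right ?_ hD0
          have := inv_anti₀ hr'0 hrN
          linarith
  have h4 : (r.card : ℝ)⁻¹ * ∑ x ∈ r, f x - A = (r.card : ℝ)⁻¹ * ∑ x ∈ r, (f x - A) := by
    rw [Finset.sum_sub_distrib, Finset.sum_const, nsmul_eq_mul]
    field_simp
  rw [h4, abs_mul, abs_of_pos (inv_pos.2 hr0), inv_mul_le_iff₀ hr0]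
  refine (Finset.abs_sum_le_sum_abs _ _).trans ((Finset.sum_le_sum h1).trans ?_)
  rw [Finset.sum_const, nsmul_eq_mul]

/-- The sets of at most `N` points in a common closed simplex that are pairwise `D`-close in
barycentric coordinates. -/
def fineSets (S : Complex V) (D : ℝ) (N : ℕ) : Set (Finset (Realization S)) :=
  {s | s ∈ cellSets S ∧ s.card ≤ N ∧ ∀ x ∈ s, ∀ y ∈ s, ∀ v, |x.1 v - y.1 v| ≤ D}

omit [Nonempty (Realization S)] in
lemma fineSets_subset {D : ℝ} {N : ℕ} {s t : Finset (Realization S)} (hs : s ∈ fineSets S D N)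
    (hts : t ⊆ s) : t ∈ fineSets S D N :=
  ⟨cellSets_subset hs.1 hts, (Finset.card_le_card hts).trans hs.2.1,
    fun x hx y hy => hs.2.2 x (hts hx) y (hts hy)⟩

lemma flagImage_mem_fineSets {D : ℝ} {N : ℕ} {s t : Finset (Realization S)}
    (hs : s ∈ fineSets S D N) (ht : IsFlagImage bary s t) (hc : t.card = s.card) :
    t ∈ fineSets S ((1 - (N : ℝ)⁻¹) * D) N := by
  refine ⟨flagImage_mem_cellSets hs.1 ht, hc.trans_le hs.2.1, ?_⟩
  obtain ⟨F, hF, hch, rfl⟩ := ht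
  have key : ∀ r ∈ F, ∀ r' ∈ F, r ⊆ r' → ∀ v,
      |(bary r).1 v - (bary r').1 v| ≤ (1 - (N : ℝ)⁻¹) * D := by
    intro r hr r' hr' hrr v
    rw [bary_apply (cellSets_subset hs.1 (hF r hr).1) (hF r hr).2,
      bary_apply (cellSets_subset hs.1 (hF r' hr').1) (hF r' hr').2]
    exact abs_average_sub_le (f := fun x : Realization S => x.1 v) hrr (hF r hr).2
      ((Finset.card_le_card (hF r' hr').1).trans hs.2.1)
      fun x hx y hy => hs.2.2 x ((hF r' hr').1 hx) y ((hF r' hr').1 hy) v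
  intro x hx y hy v
  obtain ⟨r, hr, rfl⟩ := Finset.mem_image.1 hx
  obtain ⟨r', hr', rfl⟩ := Finset.mem_image.1 hy
  rcases hch.total hr hr' with h | h
  · exact key r hr r' hr' h v
  · rw [abs_sub_comm]
    exact key r' hr' r hr h v

/-- Sufficiently fine iterated subdivisions consist of small simplices. -/
lemma exists_sdIter_fine (N : ℕ) {δ : ℝ} (hδ : 0 < δ) :
    ∃ n, ∀ c ∈ chainsIn (cellSets S ∩ {s | s.card ≤ N}),
      sdIter S (n + 1) c ∈ chainsIn (fineSets S δ N) := by
  have h0 : 0 ≤ 1 - (N : ℝ)⁻¹ := by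
    have := Nat.cast_inv_le_one (α := ℝ) N
    linarith
  have h1 : ∀ n, ∀ c ∈ chainsIn (cellSets S ∩ {s | s.card ≤ N}),
      sdIter S n c ∈ chainsIn (fineSets S ((1 - (N : ℝ)⁻¹) ^ n) N) := by
    intro n
    induction n with
    | zero =>
      intro c hc
      rw [sdIter_zero]
      refine chainsIn_mono hc fun s hs => ⟨hs.1, hs.2, fun x _ y _ v => ?_⟩
      rw [pow_zero, abs_le]
      have := x.nonneg v
      have := y.nonneg v
      have := x.le_one v
      have := y.le_one v
      constructor <;> linarith
    | succ n ih =>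
      intro c hc
      rw [sdIter_succ, pow_succ']
      exact subdiv_bary_mem (fun s hs t ht hct => flagImage_mem_fineSets hs ht hct) (ih c hc)
  rcases Nat.eq_zero_or_pos N with rfl | hN
  · refine ⟨0, fun c hc => ?_⟩
    refine chainsIn_mono (h1 1 c hc) fun s hs => ⟨hs.1, hs.2.1, fun x hx => ?_⟩
    have := Finset.card_pos.2 ⟨x, hx⟩
    have := hs.2.1
    omega
  · have h2 : 1 - (N : ℝ)⁻¹ < 1 := by
      have : (0 : ℝ) < (N : ℝ)⁻¹ := by positivity
      linarith
    obtain ⟨n, hn⟩ := exists_pow_lt_of_lt_one hδ h2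
    refine ⟨n, fun c hc => ?_⟩
    refine chainsIn_mono (h1 (n + 1) c hc) fun s hs =>
      ⟨hs.1, hs.2.1, fun x hx y hy v => ?_⟩
    refine (hs.2.2 x hx y hy v).trans (le_trans ?_ hn.le)
    rw [pow_succ]
    exact mul_le_of_le_one_right (pow_nonneg h0 n) h2.le

end Sd

/-! ### The degree in terms of chains -/

section Degree

open scoped Classical

variable {V V' : Type*}

/-- The simplices of a complex together with the empty set. -/
def withEmpty (K : Complex V) : Set (Finset V) := {s | s.Nonempty → s ∈ K.faces}

lemma withEmpty_subset {K : Complex V} : ∀ s ∈ withEmpty K, ∀ t ⊆ s, t ∈ withEmpty K :=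
  fun _ hs _ hts hn => faces_subset (hs (hn.mono hts)) hts hn

lemma withEmpty_erase {K : Complex V} : ∀ s ∈ withEmpty K, ∀ v ∈ s, s.erase v ∈ withEmpty K :=
  fun s hs _ _ => withEmpty_subset s hs _ (Finset.erase_subset _ _)

lemma mem_withEmpty {K : Complex V} {s : Finset V} (hs : s ∈ K.faces) : s ∈ withEmpty K :=
  fun _ => hs

lemma empty_mem_withEmpty (K : Complex V) : ∅ ∈ withEmpty K := fun h => absurd h (by simp)

lemma IsSubdivision.isAffineOn {K : Complex V} {K' : Complex V'}
    {p : V' → Realization K} (h : IsSubdivision K K' p) : IsAffineOn K' p := h.carrier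

lemma IsSubdivision.bijective_affineMap {K : Complex V} {K' : Complex V'}
    {p : V' → Realization K} (h : IsSubdivision K K' p) :
    Function.Bijective (affineMap h.isAffineOn) := by
  rw [Function.bijective_iff_existsUnique]
  intro x
  obtain ⟨y, hy, hu⟩ := h.bijective x
  exact ⟨y, Subtype.ext hy, fun z hz => hu z (congrArg Subtype.val hz)⟩

lemma affineMap_val {K : Complex V} {K' : Complex V'} {p : V' → Realization K}
    (hp : IsAffineOn K' p) (x : Realization K') {s : Finset V'} (hs : x.1.support ⊆ s) :
    (affineMap hp x).1 = ∑ v ∈ s, x.1 v • (p v).1 :=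
  Finsupp.sum_of_support_subset _ hs (fun v t => t • (p v).1) fun _ _ => zero_smul _ _

lemma affineMap_mk {K : Complex V} {K' : Complex V'} {p : V' → Realization K}
    (hp : IsAffineOn K' p) {s : Finset V'} (hs : s ∈ K'.faces) (f : V' → ℝ)
    (hf : ∀ v ∈ s, 0 ≤ f v) (h1 : ∑ v ∈ s, f v = 1) :
    (affineMap hp (Realization.mk s hs f hf h1)).1 = ∑ v ∈ s, f v • (p v).1 := by
  rw [affineMap_val hp _ (Realization.support_mk_subset s hs f hf h1)]
  refine Finset.sum_congr rfl fun v hv => ?_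
  rw [Realization.mk_apply, if_pos hv]

/-- A subdivision of a complex yields a subdivision of the corresponding cones. -/
lemma IsSubdivision.isFan {K : Complex V} {K' : Complex V'} {p : V' → Realization K}
    (h : IsSubdivision K K' p) : IsFan (withEmpty K) (withEmpty K') fun v => (p v).1 where
  finite := by
    refine (h.finite.insert ∅).subset fun s hs => ?_
    rcases s.eq_empty_or_nonempty with rfl | hn
    · exact Or.inl rfl
    · exact Or.inr (hs hn)
  empty_mem := empty_mem_withEmpty K'
  subset := withEmpty_subset
  subset_base := withEmpty_subset
  nonneg v i := (p v).nonneg i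
  inj := by
    intro s hs t ht f g hf hg he
    -- both sides are normalized to have total weight one
    let tot : (V →₀ ℝ) →ₗ[ℝ] ℝ := Finsupp.linearCombination ℝ fun _ => (1 : ℝ)
    have htot : ∀ x : Realization K, tot x.1 = 1 := fun x => by
      have := x.sum_eq_one subset_rfl
      simpa [tot, Finsupp.linearCombination_apply, Finsupp.sum] using this
    have hT : ∑ v ∈ s, f v = ∑ v ∈ t, g v := by
      have := congrArg tot he
      simpa [map_sum, htot] using this
    set T := ∑ v ∈ s, f v with hTdef
    rcases (Finset.sum_nonneg hf).eq_or_lt with h0 | h0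
    · have hf0 := (Finset.sum_eq_zero_iff_of_nonneg hf).1 h0.symm
      have hg0 := (Finset.sum_eq_zero_iff_of_nonneg hg).1 (hT.symm.trans h0.symm)
      intro v
      have e1 : (if v ∈ s then f v else 0) = 0 := ite_eq_right_iff.2 (hf0 v)
      have e2 : (if v ∈ t then g v else 0) = 0 := ite_eq_right_iff.2 (hg0 v)
      rw [e1, e2]
    · have hT0 : T ≠ 0 := h0.ne'
      have hsn : s.Nonempty := by
        by_contra hn
        rw [Finset.not_nonempty_iff_eq_empty] at hn
        rw [hn, Finset.sum_empty] at h0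
        exact lt_irrefl _ h0
      have htn : t.Nonempty := by
        by_contra hn
        rw [Finset.not_nonempty_iff_eq_empty] at hn
        rw [hn, Finset.sum_empty] at hT
        exact hT0 hT
      have hs1 : ∑ v ∈ s, f v / T = 1 := by rw [← Finset.sum_div, div_self hT0]
      have ht1 : ∑ v ∈ t, g v / T = 1 := by rw [← Finset.sum_div, ← hT, div_self hT0]
      have hxy := h.bijective_affineMap.1
        (a₁ := Realization.mk s (hs hsn) (fun v => f v / T)
          (fun v hv => div_nonneg (hf v hv) h0.le) hs1)
        (a₂ := Realization.mk t (ht htn) (fun v => g v / T)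
          (fun v hv => div_nonneg (hg v hv) h0.le) ht1) (by
          refine Subtype.ext ?_
          rw [affineMap_mk, affineMap_mk]
          simp only [div_eq_inv_mul, mul_smul, ← Finset.smul_sum]
          rw [he])
      intro v
      have hv : (Realization.mk s (hs hsn) (fun v => f v / T) _ hs1).1 v
        = (Realization.mk t (ht htn) (fun v => g v / T) _ ht1).1 v :=
        congrArg (fun x : Realization K' => x.1 v) hxy
      rw [Realization.mk_apply, Realization.mk_apply] at hv
      split_ifs at hv ⊢ with h1 h2 h2
      · exact (div_left_inj' hT0).1 hv
      · exact (div_eq_zero_iff.1 hv).resolve_right hT0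
      · exact ((div_eq_zero_iff.1 hv.symm).resolve_right hT0).symm
      · rfl
  surj := by
    intro x hx hxK
    rcases eq_or_ne x 0 with rfl | hx0
    · exact ⟨∅, empty_mem_withEmpty K', fun _ => 0, by simp, by simp⟩
    have hn : x.support.Nonempty := Finsupp.support_nonempty_iff.2 hx0
    have hpos : ∀ v ∈ x.support, 0 < x v := fun v hv =>
      (hx v).lt_of_ne (Finsupp.mem_support_iff.1 hv).symm
    set T := ∑ v ∈ x.support, x v with hT
    have hT0 : 0 < T := Finset.sum_pos hpos hn
    obtain ⟨y, hy⟩ := h.bijective_affineMap.2 (Realization.mk x.support (hxK hn)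
      (fun v => x v / T) (fun v hv => div_nonneg (hx v) hT0.le)
      (by rw [← Finset.sum_div, div_self hT0.ne']))
    refine ⟨y.1.support, mem_withEmpty y.support_mem, fun v => T * y.1 v,
      fun v hv => mul_pos hT0 ((y.pos_iff v).2 hv), ?_⟩
    simp only [mul_smul, ← Finset.smul_sum]
    have hy' : (affineMap h.isAffineOn y).1 = (Realization.mk x.support (hxK hn)
      (fun v => x v / T) _ _).1 := congrArg Subtype.val hy
    rw [affineMap_val _ y subset_rfl] at hy'
    rw [hy']
    ext v
    rw [Finsupp.smul_apply, Realization.mk_apply, smul_eq_mul]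
    split_ifs with hv
    · exact mul_div_cancel₀ _ hT0.ne'
    · rw [mul_zero]
      exact (Finsupp.notMem_support_iff.1 hv).symm

/-- Injective affine maps commute with barycenters. -/
lemma affineMap_bary {K : Complex V} {K' : Complex V'} [Nonempty (Realization K)]
    [Nonempty (Realization K')] {p : V' → Realization K} (hp : IsAffineOn K' p)
    (hinj : Function.Injective (affineMap hp)) {s : Finset (Realization K')}
    (hs : s ∈ cellSets K') (hn : s.Nonempty) :
    s.image (affineMap hp) ∈ cellSets K ∧
      bary (s.image (affineMap hp)) = affineMap hp (bary s) := by
  have hmem : s.image (affineMap hp) ∈ cellSets K := by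
    obtain ⟨t, ht, hst⟩ := hs
    obtain ⟨r, hr, htr⟩ := hp t ht
    refine ⟨r, hr, fun x hx => ?_⟩
    obtain ⟨y, hy, rfl⟩ := Finset.mem_image.1 hx
    exact support_affineMap_subset hp y fun v hv => htr v (hst y hy hv)
  refine ⟨hmem, Subtype.ext ?_⟩
  have hlin : ∀ y : Realization K', (affineMap hp y).1
      = Finsupp.linearCombination ℝ (fun v => (p v).1) y.1 := fun y =>
    (Finsupp.linearCombination_apply ℝ y.1).symm
  rw [bary_val hmem (hn.image _), hlin, bary_val hs hn, Finset.sum_image hinj.injOn,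
    Finset.card_image_of_injective _ hinj, map_sum]
  refine Finset.sum_congr rfl fun x _ => ?_
  rw [map_smul, hlin]

/-! #### Vertices -/

/-- The vertex `v` as a point of the realization (an arbitrary point if `v` is not a vertex). -/
def vtx (K : Complex V) [Nonempty (Realization K)] (v : V) : Realization K :=
  if h : {v} ∈ K.faces then Realization.vertex v h else Classical.arbitrary _

lemma singleton_mem_faces {K : Complex V} {s : Finset V} (hs : s ∈ K.faces) {v : V}
    (hv : v ∈ s) : {v} ∈ K.faces :=
  faces_subset hs (Finset.singleton_subset_iff.2 hv) (Finset.singleton_nonempty v)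

section vtx

variable {K : Complex V} [Nonempty (Realization K)]

lemma vtx_val {v : V} (hv : {v} ∈ K.faces) : (vtx K v).1 = Finsupp.single v 1 := by
  rw [vtx, dif_pos hv, Realization.vertex_val]

lemma support_vtx {v : V} (hv : {v} ∈ K.faces) : (vtx K v).1.support = {v} := by
  rw [vtx_val hv]
  exact Finsupp.support_single _ one_ne_zero

lemma vtx_injOn {u v : V} (hu : {u} ∈ K.faces) (hv : {v} ∈ K.faces) (h : vtx K u = vtx K v) :
    u = v := by
  have := support_vtx hu
  rw [h, support_vtx hv] at this
  exact (Finset.singleton_injective this).symm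

lemma vtx_image_mem {s : Finset V} (hs : s ∈ withEmpty K) : s.image (vtx K) ∈ cellSets K := by
  rcases s.eq_empty_or_nonempty with rfl | hn
  · rw [Finset.image_empty]
    exact empty_mem_cellSets
  · refine ⟨s, hs hn, fun x hx => ?_⟩
    obtain ⟨v, hv, rfl⟩ := Finset.mem_image.1 hx
    rw [support_vtx (singleton_mem_faces (hs hn) hv)]
    exact Finset.singleton_subset_iff.2 hv

lemma affineMap_vtx {L : Complex V'} {p : V → Realization L} (hp : IsAffineOn K p) {v : V}
    (hv : {v} ∈ K.faces) : affineMap hp (vtx K v) = p v := by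
  refine Subtype.ext ?_
  rw [affineMap_val hp _ (support_vtx hv).subset, Finset.sum_singleton, vtx_val hv,
    Finsupp.single_eq_same, one_smul]

lemma realize_vtx (a : SimplicialMap K K) {v : V} (hv : {v} ∈ K.faces) :
    {a.toFun v} ∈ K.faces ∧ a.realize (vtx K v) = vtx K (a.toFun v) := by
  have hv' : {a.toFun v} ∈ K.faces := by
    have := a.image_mem' hv
    rwa [Finset.image_singleton] at this
  refine ⟨hv', Subtype.ext ?_⟩
  rw [a.realize_val, vtx_val hv, vtx_val hv', Finsupp.mapDomain_single]

end vtx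

/-! #### Labels -/

/-- The vertices of the cross-polytope in whose open stars the point `z` of the sphere lies. -/
def labelSet {m : ℕ} (z : Sphere m) : Set (ℕ × ℤˣ) :=
  {l | ∃ i : Fin (m + 1), l.1 = i ∧ 0 < ((l.2 : ℤ) : ℝ) * z.1 i}

lemma mem_crossFaces_of_subset {m : ℕ} {z : Sphere m} {t : Finset (ℕ × ℤˣ)}
    (ht : (t : Set (ℕ × ℤˣ)) ⊆ labelSet z) : t ∈ crossFaces (m + 1) := by
  refine ⟨fun l hl => ?_, fun l hl l' hl' h => ?_⟩
  · obtain ⟨i, hi, -⟩ := ht hl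
    rw [hi]
    exact i.2
  · obtain ⟨i, hi, hpos⟩ := ht hl
    obtain ⟨i', hi', hpos'⟩ := ht hl'
    have hii : i = i' := Fin.ext (by rw [← hi, ← hi', h])
    subst hii
    refine Prod.ext h ?_
    rcases Int.units_eq_one_or l.2 with h1 | h1 <;>
      rcases Int.units_eq_one_or l'.2 with h2 | h2
    · rw [h1, h2]
    · rw [h1] at hpos
      rw [h2] at hpos'
      simp at hpos hpos'
      linarith
    · rw [h1] at hpos
      rw [h2] at hpos'
      simp at hpos hpos'
      linarith
    · rw [h1, h2]

/-- An equivariant choice of a large coordinate of each point of the sphere, with its sign. -/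
lemma exists_label (m : ℕ) : ∃ lab : Sphere m → Fin (m + 1) × ℤˣ,
    (∀ z, lab (-z) = ((lab z).1, -(lab z).2)) ∧
      ∀ z, ((m : ℝ) + 1)⁻¹ ≤ (((lab z).2 : ℤ) : ℝ) * z.1 (lab z).1 := by
  choose idx hidx using fun f : Fin (m + 1) → ℝ => Finite.exists_max f
  have hm : (0 : ℝ) < (m : ℝ) + 1 := by positivity
  -- the chosen index depends only on the absolute values of the coordinates
  let I : Sphere m → Fin (m + 1) := fun z => idx fun i => |z.1 i|
  have hI : ∀ (z : Sphere m) i, |z.1 i| ≤ |z.1 (I z)| := fun z i => hidx (fun i => |z.1 i|) i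
  have hbig : ∀ z : Sphere m, ((m : ℝ) + 1)⁻¹ ≤ |z.1 (I z)| := by
    intro z
    by_contra hlt
    push Not at hlt
    have h1 : ∑ i, z.1 i ^ 2 = 1 := by
      rw [← EuclideanSpace.real_norm_sq_eq, mem_sphere_zero_iff_norm.1 z.2, one_pow]
    -- otherwise the squares of the coordinates would add up to less than one
    have h2 : ∀ i, z.1 i ^ 2 < ((m : ℝ) + 1)⁻¹ := by
      intro i
      have h3 : |z.1 i| < ((m : ℝ) + 1)⁻¹ := (hI z i).trans_lt hlt
      have h4 : ((m : ℝ) + 1)⁻¹ ≤ 1 := inv_le_one_of_one_le₀ (by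
        have : (0 : ℝ) ≤ m := Nat.cast_nonneg m
        linarith)
      have h5 : 0 ≤ |z.1 i| := abs_nonneg _
      rw [← sq_abs]
      nlinarith
    have h3 : ∑ i, z.1 i ^ 2 < ∑ _i : Fin (m + 1), ((m : ℝ) + 1)⁻¹ :=
      Finset.sum_lt_sum_of_nonempty Finset.univ_nonempty fun i _ => h2 i
    rw [h1, Finset.sum_const, Finset.card_univ, Fintype.card_fin, nsmul_eq_mul, Nat.cast_add,
      Nat.cast_one, mul_inv_cancel₀ hm.ne'] at h3
    exact lt_irrefl _ h3
  have hIneg : ∀ z : Sphere m, I (-z) = I z := by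
    intro z
    simp only [I]
    congr 1
    funext i
    simp
  refine ⟨fun z => (I z, if 0 < z.1 (I z) then 1 else -1), fun z => ?_, fun z => ?_⟩
  · have hne : z.1 (I z) ≠ 0 := by
      intro h0
      have := hbig z
      rw [h0, abs_zero] at this
      exact absurd (inv_pos.2 hm) (not_lt.2 this)
    have hneg : (-z).1 (I z) = -z.1 (I z) := by simp
    rw [Prod.mk.injEq]
    refine ⟨hIneg z, ?_⟩
    rw [hIneg, hneg]
    rcases lt_or_gt_of_ne hne with h | h
    · simp [h, h.not_gt]
    · simp [h, h.not_gt]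
  · have := hbig z
    dsimp only
    split_ifs with h
    · rw [abs_of_pos h] at this
      simpa using this
    · rw [abs_of_nonpos (not_lt.1 h)] at this
      simpa using this

/-- Equivariant labels of the points of a finite complex, compatible with nearby points. -/
lemma exists_pointLabel {S : Complex V} (hS : S.faces.Finite) {m : ℕ}
    (φ : C(Realization S, Sphere m)) (A : Realization S → Realization S)
    (hA : ∀ x, φ (A x) = -φ x) :
    ∃ γ : Realization S → ℕ × ℤˣ, (∀ x, γ (A x) = negLabel (γ x)) ∧
      ∃ δ : ℝ, 0 < δ ∧ ∀ x y : Realization S, (∀ v, |x.1 v - y.1 v| ≤ δ) →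
        γ x ∈ labelSet (φ y) := by
  obtain ⟨lab, hneg, hlab⟩ := exists_label m
  have hm : (0 : ℝ) < ((m : ℝ) + 1)⁻¹ := by positivity
  have hcont : ∀ i, Continuous fun x => (φ x).1 i := fun i =>
    (EuclideanSpace.proj (𝕜 := ℝ) i).continuous.comp
      (continuous_subtype_val.comp φ.continuous)
  obtain ⟨δ, hδ, h⟩ := Realization.exists_lebesgue hS
    (fun q : Realization S => ⋂ i, {x | |(φ x).1 i - (φ q).1 i| < ((m : ℝ) + 1)⁻¹ / 2})
    (fun q => isOpen_iInter_of_finite fun i =>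
      isOpen_lt (((hcont i).sub continuous_const).abs) continuous_const)
    (fun x => ⟨x, by simpa using hm⟩)
  refine ⟨fun x => ((lab (φ x)).1, (lab (φ x)).2), fun x => ?_, δ / 2, by positivity,
    fun x y hxy => ?_⟩
  · dsimp only
    rw [hA, hneg]
    rfl
  · obtain ⟨q, hq⟩ := h x
    have h1 := Set.mem_iInter.1 (hq x fun v => by simpa using hδ) (lab (φ x)).1
    have h2 := Set.mem_iInter.1 (hq y fun v => by
      rw [abs_sub_comm]
      exact (hxy v).trans_lt (by linarith)) (lab (φ x)).1
    simp only [Set.mem_ofPred_eq] at h1 h2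
    refine ⟨(lab (φ x)).1, rfl, ?_⟩
    have h3 := hlab (φ x)
    rw [abs_lt] at h1 h2
    dsimp only
    rcases Int.units_eq_one_or (lab (φ x)).2 with h4 | h4
    · rw [h4] at h3 ⊢
      simp only [Units.val_one, Int.cast_one, one_mul] at h3 ⊢
      linarith
    · rw [h4] at h3 ⊢
      simp only [Units.val_neg, Units.val_one, Int.cast_neg, Int.cast_one, neg_mul, one_mul]
        at h3 ⊢
      linarith

end Degree

/-! ### The odd cycle carried by an essential cycle -/

section OddCycle

open scoped Classical

/-- An `A`-invariant `m`-cycle `c` modulo two with simplices in the family `G`, on which some dual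
Smith cochain (hence every one, if `G` is free) takes the value `1`. -/
structure IsOddCycle {X : Type*} (m : ℕ) (G : Set (Finset X)) (A : X → X) (c : Chain X) :
    Prop where
  mem : c ∈ chainsIn (G ∩ {s | s.card = m + 1})
  inv : push A c = c
  cycle : bd c = 0
  odd : ∃ θ, IsDualSmith (G ∩ {s | s.card ≤ m + 1}) A θ ∧ chainLift θ c = 1

variable {V V' : Type*} {S : Complex V} {m : ℕ}

/-- The sum of all `m`-simplices of a finite complex. -/
def fundChain (hS : S.faces.Finite) (m : ℕ) : Chain V :=
  ∑ s ∈ hS.toFinset.filter fun s => s.card = m + 1, simplex s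

lemma fundChain_apply (hS : S.faces.Finite) (s : Finset V) :
    fundChain hS m s = if s ∈ S.faces ∧ s.card = m + 1 then 1 else 0 := by
  rw [fundChain, Finsupp.finsetSum_apply]
  simp only [Finsupp.single_apply]
  rw [Finset.sum_ite_eq']
  simp

lemma mem_support_fundChain (hS : S.faces.Finite) {s : Finset V} :
    s ∈ (fundChain hS m).support ↔ s ∈ S.faces ∧ s.card = m + 1 := by
  rw [Finsupp.mem_support_iff, fundChain_apply]
  simp

lemma fundChain_mem (hS : S.faces.Finite) :
    fundChain hS m ∈ chainsIn (withEmpty S ∩ {s | s.card = m + 1}) := by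
  refine (Finsupp.mem_supported _ _).2 fun s hs => ?_
  have := (mem_support_fundChain hS).1 hs
  exact ⟨mem_withEmpty this.1, this.2⟩

namespace IsEssentialCycle

variable {a : SimplicialMap S S}

lemma involutive_vertex [Nonempty (Realization S)] (h : IsEssentialCycle m S a) {v : V}
    (hv : {v} ∈ S.faces) :
    a.toFun (a.toFun v) = v := by
  obtain ⟨h1, h2⟩ := realize_vtx a hv
  obtain ⟨h3, h4⟩ := realize_vtx a h1
  refine vtx_injOn h3 hv ?_
  rw [← h4, ← h2, h.involutive]

lemma vertex_ne [Nonempty (Realization S)] (h : IsEssentialCycle m S a) {v : V}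
    (hv : {v} ∈ S.faces) : a.toFun v ≠ v := by
  intro hav
  refine h.free (vtx S v) ?_
  rw [(realize_vtx a hv).2, hav]

lemma image_image [Nonempty (Realization S)] (h : IsEssentialCycle m S a) {s : Finset V}
    (hs : s ∈ S.faces) :
    (s.image a.toFun).image a.toFun = s := by
  rw [Finset.image_image]
  refine (Finset.image_congr fun v hv => ?_).trans Finset.image_id
  exact h.involutive_vertex (singleton_mem_faces hs hv)

lemma injOn [Nonempty (Realization S)] (h : IsEssentialCycle m S a) {s : Finset V}
    (hs : s ∈ S.faces) :
    Set.InjOn a.toFun s := by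
  intro u hu v hv huv
  rw [← h.involutive_vertex (singleton_mem_faces hs hu), huv,
    h.involutive_vertex (singleton_mem_faces hs hv)]

lemma bd_fundChain [Nonempty (Realization S)] (h : IsEssentialCycle m S a) :
    bd (fundChain h.finite m) = 0 := by
  ext t
  rw [bd_apply, Finsupp.zero_apply]
  by_cases htm : t.card = m
  · rcases t.eq_empty_or_nonempty with rfl | hn
    · -- the vertices of a `0`-dimensional cycle are exchanged in pairs
      rw [Finset.cast_card]
      refine Finset.sum_involution (fun s _ => s.image a.toFun) (fun s _ => by decide)
        (fun s hs _ he => ?_) (fun s hs => ?_) (fun s hs => ?_)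
      · obtain ⟨hs, -, hc⟩ := Finset.mem_filter.1 hs
        obtain ⟨v, rfl⟩ := Finset.card_eq_one.1 hc
        rw [Finset.image_singleton, Finset.singleton_inj] at he
        exact h.vertex_ne ((mem_support_fundChain h.finite).1 hs).1 he
      · obtain ⟨hs, -, hc⟩ := Finset.mem_filter.1 hs
        obtain ⟨hs, hc'⟩ := (mem_support_fundChain h.finite).1 hs
        have hci := Finset.card_image_of_injOn (h.injOn hs)
        exact Finset.mem_filter.2 ⟨(mem_support_fundChain h.finite).2
          ⟨a.image_mem' hs, hci.trans hc'⟩, Finset.empty_subset _, hci.trans hc⟩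
      · obtain ⟨hs, -, hc⟩ := Finset.mem_filter.1 hs
        exact h.image_image ((mem_support_fundChain h.finite).1 hs).1
    · by_cases ht : t ∈ S.faces
      · have he := h.even t ht htm
        have hset : {s | s ∈ S.faces ∧ t ⊆ s ∧ s.card = m + 1}
            = ((fundChain h.finite m).support.filter fun s => t ⊆ s ∧ s.card = t.card + 1 :
              Finset (Finset V)) := by
          ext s
          simp only [Finset.coe_filter, mem_support_fundChain, Set.mem_ofPred_eq, htm]
          tauto
        rw [hset, Set.ncard_coe_finset] at he
        exact (ZMod.natCast_eq_zero_iff_even).2 he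
      · rw [Finset.filter_false_of_mem, Finset.card_empty, Nat.cast_zero]
        rintro s hs ⟨hts, -⟩
        exact ht (faces_subset ((mem_support_fundChain h.finite).1 hs).1 hts hn)
  · rw [Finset.filter_false_of_mem, Finset.card_empty, Nat.cast_zero]
    rintro s hs ⟨-, hc⟩
    have := ((mem_support_fundChain h.finite).1 hs).2
    omega

lemma push_fundChain [Nonempty (Realization S)] (h : IsEssentialCycle m S a) :
    push a.toFun (fundChain h.finite m) = fundChain h.finite m := by
  have hT : ∀ s, s ∈ h.finite.toFinset.filter (fun s => s.card = m + 1) ↔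
      s ∈ S.faces ∧ s.card = m + 1 := fun s => by simp
  have hm : ∀ s ∈ h.finite.toFinset.filter (fun s => s.card = m + 1),
      s.image a.toFun ∈ h.finite.toFinset.filter fun s => s.card = m + 1 := fun s hs => by
    rw [hT] at hs ⊢
    exact ⟨a.image_mem' hs.1, (Finset.card_image_of_injOn (h.injOn hs.1)).trans hs.2⟩
  rw [fundChain, map_sum]
  refine Finset.sum_nbij' (fun s => s.image a.toFun) (fun s => s.image a.toFun) hm hm
    (fun s hs => h.image_image ((hT s).1 hs).1) (fun s hs => h.image_image ((hT s).1 hs).1)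
    fun s hs => ?_
  exact push_simplex_of_injOn (h.injOn ((hT s).1 hs).1)

end IsEssentialCycle

/-- In a pure complex, the subdivided fundamental chain consists of all `m`-simplices of the
subdivision. -/
lemma IsSubdivision.mem_support_chainMap_fundChain {K' : Complex V'} {p : V' → Realization S}
    (h : IsSubdivision S K' p) (hS : S.faces.Finite)
    (pure : ∀ s ∈ S.faces, ∃ t ∈ S.faces, s ⊆ t ∧ t.card = m + 1) (t : Finset V') :
    t ∈ (h.isFan.chainMap (fundChain hS m)).support ↔ t ∈ K'.faces ∧ t.card = m + 1 := by
  have key : h.isFan.chainMap (fundChain hS m) t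
      = ∑ σ ∈ hS.toFinset.filter fun s => s.card = m + 1,
        if t ∈ IsFan.top (withEmpty K') (fun v => (p v).1) σ then (1 : ZMod 2) else 0 := by
    rw [fundChain, map_sum, Finsupp.finsetSum_apply]
    exact Finset.sum_congr rfl fun σ _ => h.isFan.chainMap_simplex_apply σ t
  rw [Finsupp.mem_support_iff, key]
  constructor
  · intro hne
    obtain ⟨σ, hσ, h1⟩ := Finset.exists_ne_zero_of_sum_ne_zero hne
    rw [ne_eq, ite_eq_right_iff, Classical.not_imp] at h1
    obtain ⟨⟨⟨h2, -⟩, h3⟩, -⟩ := h1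
    have hc : t.card = m + 1 := h3.trans (Finset.mem_filter.1 hσ).2
    exact ⟨h2 (Finset.card_pos.1 (by omega)), hc⟩
  · rintro ⟨ht, hc⟩
    obtain ⟨ρ, hρ, hpρ⟩ := h.carrier t ht
    -- the carrier of `t` has at least `m + 1` vertices, so it is an `m`-simplex, the only one whose
    -- subdivision contains `t`
    set σ₀ := t.biUnion fun v => (p v).1.support with hσ₀
    have hcell : t ∈ IsFan.inCell (withEmpty K') (fun v => (p v).1) σ₀ :=
      ⟨mem_withEmpty ht, fun v hv => Finset.subset_biUnion_of_mem (fun v => (p v).1.support) hv⟩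
    have hle := h.isFan.card_le hcell
    obtain ⟨τ, hτ, hρτ, hτc⟩ := pure ρ hρ
    have h1 : σ₀ = τ := Finset.eq_of_subset_of_card_le
      ((Finset.biUnion_subset.2 hpρ).trans hρτ) (by omega)
    rw [Finset.sum_eq_single τ]
    · rw [if_pos]
      · exact one_ne_zero
      · rw [← h1]
        exact ⟨hcell, by rw [Set.mem_ofPred_eq, h1, hc, hτc]⟩
    · intro σ hσ hne
      rw [if_neg]
      rintro ⟨⟨-, h2⟩, h3⟩
      have hσc := (Finset.mem_filter.1 hσ).2
      have hsub : σ₀ ⊆ σ := Finset.biUnion_subset.2 h2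
      rw [h1] at hsub
      exact hne (Finset.eq_of_subset_of_card_le hsub (by omega)).symm
    · intro hn
      exact absurd (Finset.mem_filter.2 ⟨hS.mem_toFinset.2 hτ, hτc⟩) hn

lemma push_apply_of_injective {X Y : Type*} {f : X → Y} (hf : Function.Injective f) (c : Chain X)
    (t : Finset X) : push f c (t.image f) = c t := by
  refine eq_of_simplex (F := Finsupp.lapply (t.image f) ∘ₗ push f) (F' := Finsupp.lapply t)
    (fun s => ?_) c
  simp only [LinearMap.comp_apply, Finsupp.lapply_apply, push_simplex_of_injective hf,
    Finsupp.single_apply, (Finset.image_injective hf).eq_iff]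

/-- Iterated barycentric subdivision commutes with injective affine maps. -/
lemma sdIter_push_affineMap {K' : Complex V'} [Nonempty (Realization S)]
    [Nonempty (Realization K')] {p : V' → Realization S} (hp : IsAffineOn K' p)
    (hinj : Function.Injective (affineMap hp)) (n : ℕ) {c : Chain (Realization K')}
    (hc : c ∈ chainsIn (cellSets K')) :
    sdIter S n (push (affineMap hp) c) = push (affineMap hp) (sdIter K' n c) := by
  induction n with
  | zero => simp
  | succ n ih =>
    rw [sdIter_succ, sdIter_succ, ih, push_subdiv]
    refine eqOn_chainsIn (sdIter_mem (fun s hs t ht _ => flagImage_mem_cellSets hs ht) n hc)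
      (F := subdiv bary ∘ₗ push (affineMap hp))
      (F' := subdiv fun s => affineMap hp (bary s)) fun s hs => ?_
    exact subdiv_push fun t ht hn => (affineMap_bary hp hinj (cellSets_subset hs ht) hn).2

/-- The support of a barycenter of a set of points is the union of the supports. -/
lemma support_subset_bary [Nonempty (Realization S)] {s : Finset (Realization S)}
    (hs : s ∈ cellSets S) {x : Realization S} (hx : x ∈ s) :
    x.1.support ⊆ (bary s).1.support := by
  intro v hv
  rw [← Realization.pos_iff] at hv ⊢
  rw [bary_apply hs ⟨x, hx⟩]
  refine mul_pos (inv_pos.2 (by exact_mod_cast Finset.card_pos.2 ⟨x, hx⟩)) ?_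
  exact Finset.sum_pos' (fun y _ => y.nonneg v) ⟨x, hx, hv⟩

lemma nested_of_flagImage [Nonempty (Realization S)] {s t : Finset (Realization S)}
    (hs : s ∈ cellSets S) (ht : IsFlagImage bary s t) :
    ∀ x ∈ t, ∀ y ∈ t, x.1.support ⊆ y.1.support ∨ y.1.support ⊆ x.1.support := by
  obtain ⟨F, hF, hchain, rfl⟩ := ht
  have key : ∀ r ∈ F, ∀ r' ∈ F, r ⊆ r' → (bary r).1.support ⊆ (bary r').1.support := by
    intro r hr r' hr' hrr
    refine support_bary_subset (cellSets_subset hs (hF r hr).1) (hF r hr).2 fun x hx => ?_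
    exact support_subset_bary (cellSets_subset hs (hF r' hr').1) (hrr hx)
  intro x hx y hy
  obtain ⟨r, hr, rfl⟩ := Finset.mem_image.1 hx
  obtain ⟨r', hr', rfl⟩ := Finset.mem_image.1 hy
  rcases hchain.total hr hr' with h | h
  · exact Or.inl (key r hr r' hr' h)
  · exact Or.inr (key r' hr' r hr h)

end OddCycle

section OddDegree

open scoped Classical

variable {V V' : Type*} {S : Complex V} {m : ℕ}

/-- The vertex of the cross-polytope, as a label. -/
def toLabel (l : Fin (m + 1) × ℤˣ) : ℕ × ℤˣ := ((l.1 : ℕ), l.2)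

lemma toLabel_injective : Function.Injective (toLabel (m := m)) := by
  rintro ⟨i, ε⟩ ⟨j, ε'⟩ h
  simp only [toLabel, Prod.mk.injEq] at h
  exact Prod.ext (Fin.ext h.1) h.2

lemma image_toLabel (m : ℕ) :
    (Finset.univ.image fun i : Fin (m + 1) => (i, (1 : ℤˣ))).image toLabel
      = crossFacet (m + 1) 1 := by
  ext l
  simp only [Finset.mem_image, Finset.mem_univ, true_and, crossFacet, Finset.mem_range, toLabel]
  constructor
  · rintro ⟨_, ⟨i, rfl⟩, rfl⟩
    exact ⟨i, i.2, rfl⟩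
  · rintro ⟨i, hi, rfl⟩
    exact ⟨_, ⟨⟨i, hi⟩, rfl⟩, rfl⟩

/-- A point in the interior of a simplex. -/
lemma exists_support_eq {s : Finset V} (hs : s ∈ S.faces) :
    ∃ x : Realization S, x.1.support = s := by
  have hn := faces_nonempty hs
  have hc : (0 : ℝ) < s.card := by exact_mod_cast hn.card_pos
  have h1 : ∑ _v ∈ s, (s.card : ℝ)⁻¹ = 1 := by
    rw [Finset.sum_const, nsmul_eq_mul, mul_inv_cancel₀ hc.ne']
  refine ⟨Realization.mk s hs (fun _ => (s.card : ℝ)⁻¹) (fun _ _ => by positivity) h1, ?_⟩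
  ext v
  rw [← Realization.pos_iff, Realization.mk_apply]
  split_ifs with h
  · exact ⟨fun _ => h, fun _ => by positivity⟩
  · simp [h]

/-- Counting with the labels of a simplicial approximation agrees with counting with the labels of
nearby points, on a fine iterated barycentric subdivision. -/
lemma push_label_sdIter [Nonempty (Realization S)] {K' : Complex V'} {p : V' → Realization S}
    (hp : IsAffineOn K' p) (hinj : Function.Injective (affineMap hp))
    {φ : Realization S → Sphere m} {g : V' → ℕ × ℤˣ}
    (hg : ∀ y : Realization K', ∀ v ∈ y.1.support, g v ∈ labelSet (φ (affineMap hp y)))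
    {γ : Realization S → ℕ × ℤˣ} {δ : ℝ}
    (hγ : ∀ x y : Realization S, (∀ v, |x.1 v - y.1 v| ≤ δ) → γ x ∈ labelSet (φ y)) {n : ℕ}
    (hn : ∀ c ∈ chainsIn (cellSets S ∩ {s | s.card ≤ m + 2}),
      sdIter S (n + 1) c ∈ chainsIn (fineSets S δ (m + 2)))
    {c : Chain V'} (hc : c ∈ chainsIn (withEmpty K' ∩ {s | s.card = m + 1})) (hbc : bd c = 0) :
    push γ (sdIter S (n + 1) (push p c)) = push g c := by
  rcases isEmpty_or_nonempty (Realization K') with hE | hne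
  · have h0 : c = 0 := by
      rw [← Finsupp.support_eq_empty, Finset.eq_empty_iff_forall_notMem]
      intro s hs
      have := (Finsupp.mem_supported _ _).1 hc hs
      obtain ⟨x, -⟩ := exists_support_eq (this.1 (Finset.card_pos.1 (by
        have : s.card = m + 1 := this.2
        omega)))
      exact hE.elim x
    rw [h0]
    simp
  have hcw := chainsIn_mono hc Set.inter_subset_left
  set e := affineMap hp with he
  set d := push (vtx K') c with hd
  have hdm : d ∈ chainsIn (cellSets K') := push_mem (fun s hs => vtx_image_mem hs) hcw
  have hdc : d ∈ chainsIn {s | s.card = m + 1} :=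
    map_mem_of_chainsIn hc _ fun s hs => chainsIn_mono (push_simplex_mem _ s)
      fun t ht => ht.2.trans hs.2
  have hpd : push p c = push e d := by
    rw [hd, push_push]
    refine eqOn_chainsIn hcw fun s hs => push_congr fun v hv => ?_
    exact (affineMap_vtx hp (singleton_mem_faces (hs ⟨v, hv⟩) hv)).symm
  set D := sdIter K' (n + 1) d with hD
  have hDe : sdIter S (n + 1) (push p c) = push e D := by
    rw [hpd]
    exact sdIter_push_affineMap hp hinj _ hdm
  -- the simplices of the subdivided cycle `D` are fine, and the supports of their vertices nested
  let G : Set (Finset (Realization K')) := {t | (∀ x ∈ t, ∀ y ∈ t,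
    x.1.support ⊆ y.1.support ∨ y.1.support ⊆ x.1.support) ∧
      ∀ x ∈ t, ∀ y ∈ t, ∀ v, |(e x).1 v - (e y).1 v| ≤ δ}
  have hDcard : D ∈ chainsIn {t | t.card = m + 1} :=
    sdIter_mem (fun s hs t _ htc => htc.trans hs) _ hdc
  have hDnest : D ∈ chainsIn {t | ∀ x ∈ t, ∀ y ∈ t,
      x.1.support ⊆ y.1.support ∨ y.1.support ⊆ x.1.support} := by
    rw [hD, sdIter_succ]
    exact subdiv_bary_mem (R := cellSets K') (fun s hs t ht _ => nested_of_flagImage hs ht)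
      (sdIter_mem (fun s hs t ht _ => flagImage_mem_cellSets hs ht) n hdm)
  have hDfine : push e D ∈ chainsIn (fineSets S δ (m + 2)) := by
    rw [← hDe]
    refine hn _ ?_
    rw [hpd]
    refine map_mem_of_chainsIn hc (push e ∘ₗ push (vtx K')) fun s hs => ?_
    rw [LinearMap.comp_apply, push_push]
    refine chainsIn_mono (push_simplex_mem _ s) ?_
    rintro t ⟨rfl, ht⟩
    refine ⟨?_, by
      have : s.card = m + 1 := hs.2
      rw [Set.mem_ofPred_eq, ht, this]
      omega⟩
    rw [← Finset.image_image]
    rcases (s.image (vtx K')).eq_empty_or_nonempty with h0 | h0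
    · rw [h0, Finset.image_empty]
      exact empty_mem_cellSets
    · exact (affineMap_bary hp hinj (vtx_image_mem hs.1) h0).1
  have hDG : D ∈ chainsIn (G ∩ {t | t.card = m + 1}) := by
    refine (Finsupp.mem_supported _ _).2 fun t ht => ?_
    refine ⟨⟨(Finsupp.mem_supported _ _).1 hDnest ht, fun x hx y hy v => ?_⟩,
      (Finsupp.mem_supported _ _).1 hDcard ht⟩
    have ht' : t.image e ∈ (push e D).support := by
      rw [Finsupp.mem_support_iff, push_apply_of_injective hinj]
      exact Finsupp.mem_support_iff.1 ht
    exact ((Finsupp.mem_supported _ _).1 hDfine ht').2.2 _ (Finset.mem_image_of_mem _ hx) _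
      (Finset.mem_image_of_mem _ hy) v
  -- a vertex of the carrier of a point
  choose w hw using fun y : Realization K' => y.exists_pos
  have hw' : ∀ y : Realization K', w y ∈ y.1.support := fun y => (y.pos_iff _).1 (hw y)
  have hbD : bd D = 0 := by
    rw [hD, bd_sdIter, hd, bd_push, hbc, map_zero, map_zero]
  rw [hDe, push_push]
  -- both chain maps carry a simplex to labels that are compatible at a common point of the sphere,
  -- hence to chains without room for an additional dimension
  trans push (fun y => g (w y)) D
  · refine eq_of_carried (G := G) (w := fun t => if h : t.Nonempty then γ (e h.choose) else (0, 1))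
      (κ := fun t => (fun y => g (w y)) '' t ∪ (γ ∘ e) '' t) (n := m + 1)
      (fun s hs v _ => ⟨fun x hx y hy => hs.1 x (Finset.mem_of_mem_erase hx) y
        (Finset.mem_of_mem_erase hy), fun x hx y hy => hs.2 x (Finset.mem_of_mem_erase hx) y
        (Finset.mem_of_mem_erase hy)⟩)
      (fun s _ v _ => ?_) (fun s _ h => ?_) (fun s _ => ?_) (fun s _ => ?_)
      (fun s _ => bd_push _ _) (fun s _ => bd_push _ _) (by simp) (fun s hs t ht => ?_)
      hDG hbD
    · have : ((s.erase v : Finset _) : Set (Realization K')) ⊆ s := by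
        exact_mod_cast Finset.erase_subset v s
      exact Set.union_subset_union (Set.image_mono this) (Set.image_mono this)
    · rw [dif_pos h]
      exact Or.inr ⟨_, h.choose_spec, rfl⟩
    · refine chainsIn_mono (push_simplex_mem _ s) ?_
      rintro t ⟨rfl, ht⟩
      refine ⟨?_, ht⟩
      rw [Finset.coe_image]
      exact Set.subset_union_right
    · refine chainsIn_mono (push_simplex_mem _ s) ?_
      rintro t ⟨rfl, ht⟩
      refine ⟨?_, ht⟩
      rw [Finset.coe_image]
      exact Set.subset_union_left
    · rcases s.eq_empty_or_nonempty with rfl | hsn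
      · have : t = ∅ := by
          rw [← Finset.coe_eq_empty, ← Set.subset_empty_iff]
          simpa using ht
        rw [this, Finset.card_empty]
        omega
      -- all labels occur near a vertex of `s` whose carrier is maximal
      · obtain ⟨x, hx, hmax⟩ := s.exists_max_image (fun x => x.1.support.card) hsn
        have hsub : ∀ y ∈ s, y.1.support ⊆ x.1.support := fun y hy => by
          rcases hs.1 y hy x hx with h1 | h1
          · exact h1
          · exact (Finset.eq_of_subset_of_card_le h1 (hmax y hy)).symm.subset
        refine card_le_of_mem_crossFaces (mem_crossFaces_of_subset (z := φ (e x)) (ht.trans ?_))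
        rintro _ (⟨y, hy, rfl⟩ | ⟨y, hy, rfl⟩)
        · exact hg x _ (hsub y hy (hw' y))
        · exact hγ _ _ fun v => hs.2 y hy x hx v
  · have hlin : push (fun y => g (w y)) D
        = (push (fun y => g (w y)) ∘ₗ sdIter K' (n + 1) ∘ₗ push (vtx K')) c := rfl
    rw [hlin]
    have hpt : ∀ s ∈ withEmpty K', sdIter K' (n + 1) (push (vtx K') (simplex s)) ∈
        chainsIn ({t | ∀ x ∈ t, x.1.support ⊆ s} ∩ {t | t.card = s.card}) := by
      intro s hs
      refine chainsIn_mono (sdIter_mem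
        (R := {t | t ∈ cellSets K' ∧ (∀ x ∈ t, x.1.support ⊆ s) ∧ t.card = s.card})
        (fun t ht r hr hrc => ⟨flagImage_mem_cellSets ht.1 hr, ?_, hrc.trans ht.2.2⟩) _ ?_)
        fun t ht => ht.2
      · obtain ⟨F, hF, -, rfl⟩ := hr
        intro x hx
        obtain ⟨q, hq, rfl⟩ := Finset.mem_image.1 hx
        exact support_bary_subset (cellSets_subset ht.1 (hF q hq).1) (hF q hq).2
          fun z hz => ht.2.1 z ((hF q hq).1 hz)
      · refine chainsIn_mono (push_simplex_mem _ s) ?_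
        rintro t ⟨rfl, ht⟩
        refine ⟨vtx_image_mem hs, fun x hx => ?_, ht⟩
        obtain ⟨v, hv, rfl⟩ := Finset.mem_image.1 hx
        rw [support_vtx (singleton_mem_faces (hs ⟨v, hv⟩) hv)]
        exact Finset.singleton_subset_iff.2 hv
    -- the labels `g (w y)` of points `y` in a simplex `s` are among the labels of the vertices of
    -- `s`
    refine eq_of_carried (G := withEmpty K')
      (w := fun s => if h : s.Nonempty then g h.choose else (0, 1))
      (κ := fun s => g '' s) (n := m + 1) withEmpty_erase
      (fun s _ v _ => Set.image_mono (by exact_mod_cast Finset.erase_subset v s))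
      (fun s _ h => ?_) (fun s hs => ?_) (fun s _ => ?_) (fun s _ => ?_)
      (fun s _ => bd_push _ _) (by simp) (fun s hs t ht => ?_) hc hbc
    · rw [dif_pos h]
      exact ⟨_, h.choose_spec, rfl⟩
    · refine map_mem_of_chainsIn (hpt s hs) (push fun y => g (w y)) fun t ht => ?_
      refine chainsIn_mono (push_simplex_mem _ t) ?_
      rintro r ⟨rfl, hr⟩
      refine ⟨?_, hr.trans ht.2⟩
      intro l hl
      obtain ⟨y, hy, rfl⟩ := Finset.mem_image.1 (Finset.mem_coe.1 hl)
      exact ⟨w y, ht.1 y hy (hw' y), rfl⟩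
    · refine chainsIn_mono (push_simplex_mem _ s) ?_
      rintro t ⟨rfl, ht⟩
      exact ⟨by rw [Finset.coe_image], ht⟩
    · simp only [LinearMap.comp_apply, bd_push, bd_sdIter]
    · rcases s.eq_empty_or_nonempty with rfl | hsn
      · have : t = ∅ := by
          rw [← Finset.coe_eq_empty, ← Set.subset_empty_iff]
          simpa using ht
        rw [this, Finset.card_empty]
        omega
      · obtain ⟨x, hx⟩ := exists_support_eq (hs hsn)
        refine card_le_of_mem_crossFaces
          (mem_crossFaces_of_subset (z := φ (e x)) (ht.trans ?_))
        rintro _ ⟨v, hv, rfl⟩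
        exact hg x v (by rw [hx]; exact hv)

/-- Replacing the `m`-simplices of a complex by those of a subdivision does not change the labels
of a fine iterated barycentric subdivision. -/
lemma push_sdIter_chainMap [Nonempty (Realization S)] {K' : Complex V'} {p : V' → Realization S}
    (h : IsSubdivision S K' p) {φ : Realization S → Sphere m}
    {γ : Realization S → ℕ × ℤˣ} {δ : ℝ}
    (hγ : ∀ x y : Realization S, (∀ v, |x.1 v - y.1 v| ≤ δ) → γ x ∈ labelSet (φ y)) {n : ℕ}
    (hn : ∀ c ∈ chainsIn (cellSets S ∩ {s | s.card ≤ m + 2}),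
      sdIter S (n + 1) c ∈ chainsIn (fineSets S δ (m + 2)))
    {c : Chain V} (hc : c ∈ chainsIn (withEmpty S ∩ {s | s.card = m + 1})) (hbc : bd c = 0) :
    push γ (sdIter S (n + 1) (push p (h.isFan.chainMap c)))
      = push γ (sdIter S (n + 1) (push (vtx S) c)) := by
  set F : Chain V →ₗ[ZMod 2] Chain (Realization S) := push p ∘ₗ h.isFan.chainMap
  set w : Finset V → Realization S := fun s =>
    if h : s.Nonempty then vtx S h.choose else Classical.arbitrary _
  have hF : ∀ s ∈ withEmpty S, F (simplex s) ∈
      chainsIn {t | (t : Set (Realization S)) ⊆ {x | x.1.support ⊆ s} ∧ t.card = s.card} := by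
    intro s hs
    refine map_mem_of_chainsIn (h.isFan.chainMap_simplex_mem s) (push p) fun t ht => ?_
    refine chainsIn_mono (push_simplex_mem _ t) ?_
    rintro r ⟨rfl, hr⟩
    refine ⟨?_, hr.trans ht.2⟩
    intro x hx
    obtain ⟨v, hv, rfl⟩ := Finset.mem_image.1 (Finset.mem_coe.1 hx)
    exact ht.1.2 v hv
  have hF' : ∀ s ∈ withEmpty S, push (vtx S) (simplex s) ∈
      chainsIn {t | (t : Set (Realization S)) ⊆ {x | x.1.support ⊆ s} ∧ t.card = s.card} := by
    intro s hs
    refine chainsIn_mono (push_simplex_mem _ s) ?_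
    rintro r ⟨rfl, hr⟩
    refine ⟨?_, hr⟩
    intro x hx
    obtain ⟨v, hv, rfl⟩ := Finset.mem_image.1 (Finset.mem_coe.1 hx)
    rw [Set.mem_ofPred_eq, support_vtx (singleton_mem_faces (hs ⟨v, hv⟩) hv)]
    exact Finset.singleton_subset_iff.2 hv
  have hbF : ∀ s ∈ withEmpty S, bd (F (simplex s)) = F (bd (simplex s)) := by
    intro s hs
    simp only [F, LinearMap.comp_apply, bd_push, h.isFan.bd_chainMap hs]
  -- the two chain maps are carried by closed simplices, so a cone homotopy `e` connects their
  -- values at the cycle `c`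
  have hhom := bd_homotopy withEmpty_erase w hbF (F' := push (vtx S))
    (fun s _ => bd_push _ _) (by simp [F, h.isFan.chainMap_empty])
    (chainsIn_mono hc Set.inter_subset_left)
  rw [hbc, map_zero, add_zero] at hhom
  have hκ : ∀ s ∈ withEmpty S, ∀ v ∈ s, {x : Realization S | x.1.support ⊆ s.erase v}
      ⊆ {x | x.1.support ⊆ s} := fun s _ v _ x hx =>
    Finset.Subset.trans hx (Finset.erase_subset v s)
  have hw : ∀ s ∈ withEmpty S, s.Nonempty → w s ∈ {x : Realization S | x.1.support ⊆ s} := by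
    intro s hs hn
    simp only [w, dif_pos hn]
    rw [Set.mem_ofPred_eq, support_vtx (singleton_mem_faces (hs hn) hn.choose_spec)]
    exact Finset.singleton_subset_iff.2 hn.choose_spec
  have hhom' : ∀ s ∈ withEmpty S, homotopy F (push (vtx S)) w (simplex s) ∈ chainsIn
      {t | (t : Set (Realization S)) ⊆ {x | x.1.support ⊆ s} ∧ t.card = s.card + 1} :=
    fun s hs => homotopy_mem withEmpty_erase hκ hw hF hF' hs
  set e := homotopy F (push (vtx S)) w c
  have he : e ∈ chainsIn (cellSets S ∩ {s | s.card = m + 2}) := by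
    refine map_mem_of_chainsIn hc _ fun s hs => chainsIn_mono (hhom' s hs.1) ?_
    rintro t ⟨ht, htc⟩
    have hsc : s.card = m + 1 := hs.2
    exact ⟨⟨s, hs.1 (Finset.card_pos.1 (by omega)), fun x hx => ht hx⟩, by
      rw [Set.mem_ofPred_eq, htc, hsc]⟩
  clear_value e
  have hfine := hn e (chainsIn_mono he fun s hs => ⟨hs.1, (show s.card = m + 2 from hs.2).le⟩)
  have hcard : sdIter S (n + 1) e ∈ chainsIn {s | s.card = m + 2} :=
    sdIter_mem (fun s hs t _ htc => Eq.trans htc hs) _ (chainsIn_mono he Set.inter_subset_right)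
  -- `m + 2` nearby points cannot have `m + 2` distinct labels, as these are compatible
  have hzero : push γ (sdIter S (n + 1) e) = 0 := by
    have : sdIter S (n + 1) e ∈ chainsIn (fineSets S δ (m + 2) ∩ {s | s.card = m + 2}) := by
      refine (Finsupp.mem_supported _ _).2 fun s hs => ?_
      exact ⟨(Finsupp.mem_supported _ _).1 hfine hs, (Finsupp.mem_supported _ _).1 hcard hs⟩
    refine (eqOn_chainsIn (F := push γ) (F' := 0) this fun s hs => ?_).trans rfl
    refine push_simplex_of_not_injOn fun hinj => ?_
    have hsc : s.card = m + 2 := hs.2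
    obtain ⟨x, hx⟩ := Finset.card_pos.1 (show 0 < s.card by omega)
    have h1 : s.image γ ∈ crossFaces (m + 1) := mem_crossFaces_of_subset (z := φ x) (by
      intro l hl
      obtain ⟨y, hy, rfl⟩ := Finset.mem_image.1 (Finset.mem_coe.1 hl)
      exact hγ y x fun v => hs.1.2.2 y hy x hx v)
    have h2 := card_le_of_mem_crossFaces h1
    rw [Finset.card_image_of_injOn hinj] at h2
    omega
  have := congrArg (fun c => push γ (sdIter S (n + 1) c)) hhom
  simp only [← bd_sdIter, ← bd_push, hzero, map_zero, map_add] at this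
  rw [← sub_eq_zero, ZModModule.sub_eq_add]
  exact this.symm

lemma IsEssentialCycle.nonempty {a : SimplicialMap S S} (h : IsEssentialCycle m S a) :
    Nonempty (Realization S) := by
  obtain ⟨φ, -, W, K', p, g, -, -, hodd⟩ := h.exists_odd
  have hne : {s | s ∈ K'.faces ∧ s.card = m + 1 ∧
      s.image g = Finset.univ.image fun i : Fin (m + 1) => (i, (1 : ℤˣ))}.Nonempty := by
    rw [Set.nonempty_iff_ne_empty]
    intro h0
    rw [h0, Set.ncard_empty] at hodd
    exact absurd hodd (by decide)
  obtain ⟨s, hs, -⟩ := hne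
  obtain ⟨v, -⟩ := faces_nonempty hs
  exact ⟨p v⟩

/-- The fundamental chain of an essential cycle is odd: the dual Smith cochain counts the simplices
of a fine subdivision whose labels are `e_0, …, e_m`. -/
theorem IsEssentialCycle.exists_isOddCycle {a : SimplicialMap S S} (h : IsEssentialCycle m S a) :
    ∃ c, IsOddCycle m (cellSets S) a.realize c := by
  have := h.nonempty
  obtain ⟨φ, hφ, W, K', p, g, hsub, hg, hodd⟩ := h.exists_odd
  obtain ⟨γ, hγA, δ, hδ, hγ⟩ := exists_pointLabel h.finite φ a.realize hφ
  obtain ⟨n, hn⟩ := exists_sdIter_fine (S := S) (m + 2) hδ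
  have hinj : Function.Injective a.realize := Function.Involutive.injective h.involutive
  set c := fundChain h.finite m
  have hc := fundChain_mem (m := m) h.finite
  have hvc : ∀ s ∈ withEmpty S, s.card = m + 1 →
      push (vtx S) (simplex s) ∈ chainsIn (cellSets S ∩ {s | s.card = m + 1}) := fun s hs hsc =>
    chainsIn_mono (push_simplex_mem _ s) (by
      rintro t ⟨rfl, ht⟩
      exact ⟨vtx_image_mem hs, ht.trans hsc⟩)
  set G := cellSets S ∩ {s | s.card ≤ m + 1}
  refine ⟨push (vtx S) c, map_mem_of_chainsIn hc _ fun s hs => hvc s hs.1 hs.2, ?_, ?_, ?_⟩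
  · have h1 : push (a.realize ∘ vtx S) c = push (vtx S ∘ a.toFun) c :=
      eqOn_chainsIn (chainsIn_mono hc Set.inter_subset_left) fun s hs => push_congr fun v hv =>
        (realize_vtx a (singleton_mem_faces (hs ⟨v, hv⟩) hv)).2
    rw [push_push, h1, ← push_push, h.push_fundChain]
  · rw [bd_push, h.bd_fundChain, map_zero]
  · have hfine : ∀ s ∈ G, sdIter S (n + 1) (simplex s) ∈ chainsIn (fineSets S δ (m + 2)) :=
      fun s hs => hn _ (simplex_mem ⟨hs.1, Nat.le_succ_of_le hs.2⟩)
    refine ⟨_, (isDualSmith_fanCochain (m + 1) 1).comp negLabel_involutive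
      (push γ ∘ₗ sdIter S (n + 1)) (by simp) (fun s hs => ?_) (fun s _ => ?_) (fun s hs => ?_), ?_⟩
    · refine map_mem_of_chainsIn (hfine s hs) (push γ) fun t ht => ?_
      refine chainsIn_mono (push_simplex_mem _ t) ?_
      rintro r ⟨rfl, -⟩
      rcases t.eq_empty_or_nonempty with rfl | ⟨x, hx⟩
      · rw [Finset.image_empty]
        exact ⟨by simp, by simp⟩
      · refine mem_crossFaces_of_subset (z := φ x) ?_
        intro l hl
        obtain ⟨y, hy, rfl⟩ := Finset.mem_image.1 (Finset.mem_coe.1 hl)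
        exact hγ y x fun v => ht.2.2 y hy x hx v
    · simp only [LinearMap.comp_apply, bd_push, bd_sdIter]
    · simp only [LinearMap.comp_apply]
      rw [← push_simplex_of_injective hinj, ← push_sdIter hinj _ (simplex_mem hs.1), push_push,
        push_push]
      congr 2
      funext x
      exact hγA x
    -- the value at the cycle is computed with the given subdivision and simplicial approximation
    · have h1 := push_sdIter_chainMap hsub (φ := φ) hγ hn hc h.bd_fundChain
      set c' := hsub.isFan.chainMap c
      have hsupp : ∀ t, t ∈ c'.support ↔ t ∈ K'.faces ∧ t.card = m + 1 :=
        hsub.mem_support_chainMap_fundChain h.finite h.pure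
      have hc' : c' ∈ chainsIn (withEmpty K' ∩ {s | s.card = m + 1}) := by
        refine (Finsupp.mem_supported _ _).2 fun t ht => ?_
        have := (hsupp t).1 ht
        exact ⟨mem_withEmpty this.1, this.2⟩
      have hbc' : bd c' = 0 := by
        have : bd c' = hsub.isFan.chainMap (bd c) := eqOn_chainsIn
          (F := bd ∘ₗ hsub.isFan.chainMap) (F' := hsub.isFan.chainMap ∘ₗ bd)
          (chainsIn_mono hc Set.inter_subset_left) fun s hs => hsub.isFan.bd_chainMap hs
        rw [this, h.bd_fundChain, map_zero]
      have h2 := push_label_sdIter hsub.isAffineOn hsub.bijective_affineMap.1 (φ := φ)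
        (g := fun v => toLabel (g v)) (fun y v hv => ⟨(g v).1, rfl,
          hg _ y rfl v ((y.pos_iff v).2 hv)⟩) hγ hn hc' hbc'
      rw [chainLift_comp, LinearMap.comp_apply, ← h1, h2, chainLift_fanCochain]
      · rw [push_apply, ZMod.natCast_eq_one_iff_odd]
        convert hodd using 1
        rw [← Set.ncard_coe_finset]
        congr 1
        ext s
        have hcard : (crossFacet (m + 1) 1).card = m + 1 := by
          rw [crossFacet, Finset.card_image_of_injective _ (fun i j hij => (Prod.ext_iff.1 hij).1),
            Finset.card_range]
        have himg : s.image (fun v => toLabel (g v)) = (s.image g).image toLabel := by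
          rw [Finset.image_image]
          rfl
        have hiff : (s.image g).image toLabel = crossFacet (m + 1) 1 ↔
            s.image g = Finset.univ.image fun i : Fin (m + 1) => (i, (1 : ℤˣ)) := by
          rw [← image_toLabel, (Finset.image_injective toLabel_injective).eq_iff]
        simp only [Finset.coe_filter, Set.mem_ofPred_eq, hsupp, hcard, himg, hiff]
        tauto
      · refine map_mem_of_chainsIn hc' _ fun s hs => ?_
        refine chainsIn_mono (push_simplex_mem _ s) ?_
        rintro t ⟨-, ht⟩
        exact ht.trans hs.2

end OddDegree

/-! ### Essential cycles from odd cycles -/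

section Essential

open scoped Classical

/-- The complex generated by the simplices of a chain. -/
def chainComplex {Y : Type*} (Φ : Chain Y) : Complex Y where
  faces := {t | t.Nonempty ∧ ∃ T ∈ Φ.support, t ⊆ T}
  isRelLowerSet_faces := fun _ ⟨hs, T, hT, hsT⟩ =>
    ⟨hs, fun _ hts ht => ⟨ht, T, hT, Finset.Subset.trans hts hsT⟩⟩

lemma finite_chainComplex {Y : Type*} (Φ : Chain Y) : (chainComplex Φ).faces.Finite := by
  refine (Φ.support.biUnion Finset.powerset).finite_toSet.subset ?_
  rintro t ⟨-, T, hT, htT⟩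
  exact Finset.mem_coe.2 (Finset.mem_biUnion.2 ⟨T, hT, Finset.mem_powerset.2 htT⟩)

lemma sum_vtx {V : Type*} {K : Complex V} [Nonempty (Realization K)] (y : Realization K) :
    (y.1.sum fun v t => t • (vtx K v).1) = y.1 := by
  refine Eq.trans (Finsupp.sum_congr fun v hv => ?_) (Finsupp.sum_single y.1)
  rw [vtx_val (singleton_mem_faces y.support_mem hv), Finsupp.smul_single_one]

/-- The complex `K` is a subdivision of itself. -/
lemma isSubdivision_self {V : Type*} {K : Complex V} [Nonempty (Realization K)]
    (hK : K.faces.Finite) : IsSubdivision K K (vtx K) where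
  finite := hK
  carrier s hs := ⟨s, hs, fun v hv => by
    rw [support_vtx (singleton_mem_faces hs hv)]
    exact Finset.singleton_subset_iff.2 hv⟩
  bijective x := ⟨x, sum_vtx x, fun y hy => Subtype.ext ((sum_vtx y).symm.trans hy)⟩

/-- The normalization of a nowhere vanishing vector field. -/
def normalize {Z : Type*} {m : ℕ} (v : Z → EuclideanSpace ℝ (Fin (m + 1))) (hv : ∀ x, v x ≠ 0)
    (x : Z) : Sphere m :=
  ⟨‖v x‖⁻¹ • v x, by
    rw [mem_sphere_zero_iff_norm, norm_smul, norm_inv, norm_norm,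
      inv_mul_cancel₀ (norm_ne_zero_iff.2 (hv x))]⟩

lemma continuous_normalize {Z : Type*} [TopologicalSpace Z] {m : ℕ}
    {v : Z → EuclideanSpace ℝ (Fin (m + 1))} (hv : ∀ x, v x ≠ 0) (hc : Continuous v) :
    Continuous (normalize v hv) :=
  Continuous.subtype_mk ((hc.norm.inv₀ fun x => norm_ne_zero_iff.2 (hv x)).smul hc) _

variable {X : Type*} {m : ℕ} {G : Set (Finset X)} {A : X → X} {c : Chain X}

/-- `t` is a flag of nonempty faces of the member `s` of `G`: a simplex of the barycentric
subdivision of `s`. -/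
def IsFlag (G : Set (Finset X)) (s : Finset X) (t : Finset (Finset X)) : Prop :=
  s ∈ G ∧ (∀ r ∈ t, r ⊆ s ∧ r.Nonempty) ∧ IsChain (· ⊆ ·) (t : Set (Finset X))

lemma IsFlag.eq_of_card {s : Finset X} {t : Finset (Finset X)} (h : IsFlag G s t)
    {r r' : Finset X} (hr : r ∈ t) (hr' : r' ∈ t) (hc : r.card = r'.card) : r = r' := by
  rcases h.2.2.total hr hr' with h1 | h1
  · exact Finset.eq_of_subset_of_card_le h1 hc.ge
  · exact (Finset.eq_of_subset_of_card_le h1 hc.le).symm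

lemma IsFlag.mono {s : Finset X} {t t' : Finset (Finset X)} (h : IsFlag G s t) (ht : t' ⊆ t) :
    IsFlag G s t' :=
  ⟨h.1, fun r hr => h.2.1 r (ht hr), h.2.2.mono (by exact_mod_cast ht)⟩

lemma subdiv_flag_mem (hc : c ∈ chainsIn (G ∩ {s | s.card = m + 1})) :
    subdiv (fun s => s) c ∈ chainsIn {t | (∃ s, s.card = m + 1 ∧ IsFlag G s t) ∧
      t.card = m + 1} := by
  refine map_mem_of_chainsIn hc _ fun s hs => chainsIn_mono (subdiv_mem _ s) ?_
  rintro t ⟨⟨F, hF, hch, rfl⟩, ht⟩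
  simp only [Finset.image_id'] at ht ⊢
  exact ⟨⟨s, hs.2, hs.1, hF, hch⟩, ht.trans hs.2⟩

/-- The label of a vertex of the barycentric subdivision. -/
def flagLabel (ε : Finset X → ℤˣ) (s : Finset X) : ℕ × ℤˣ := (s.card - 1, ε s)

lemma flagLabel_mem {s : Finset X} (hsm : s.card ≤ m + 1) {t : Finset (Finset X)}
    (h : IsFlag G s t) (ε : Finset X → ℤˣ) : t.image (flagLabel ε) ∈ crossFaces (m + 1) := by
  have hpos : ∀ r ∈ t, 0 < r.card ∧ r.card ≤ m + 1 := fun r hr =>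
    ⟨(h.2.1 r hr).2.card_pos, (Finset.card_le_card (h.2.1 r hr).1).trans hsm⟩
  refine ⟨fun l hl => ?_, fun l hl l' hl' hll => ?_⟩
  · obtain ⟨r, hr, rfl⟩ := Finset.mem_image.1 hl
    have := hpos r hr
    change r.card - 1 < m + 1
    omega
  · obtain ⟨r, hr, rfl⟩ := Finset.mem_image.1 (Finset.mem_coe.1 hl)
    obtain ⟨r', hr', rfl⟩ := Finset.mem_image.1 (Finset.mem_coe.1 hl')
    have h1 := hpos r hr
    have h2 := hpos r' hr'
    have h3 : r.card - 1 = r'.card - 1 := hll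
    rw [h.eq_of_card hr hr' (by omega)]

/-- The barycentric subdivision of an odd cycle, with vertices labelled by dimension and an
equivariant sign, hits the facet `e_0, …, e_m` an odd number of times. -/
lemma IsOddCycle.push_flagLabel (hG : IsFreeFamily G A) (hc : IsOddCycle m G A c)
    {ε : Finset X → ℤˣ} (hε : ∀ s ∈ G, s.Nonempty → ε (s.image A) = -ε s) :
    push (flagLabel ε) (subdiv (fun s => s) c) (crossFacet (m + 1) 1) = 1 := by
  obtain ⟨θ, hθ, hθc⟩ := hc.odd
  have hfree : IsFreeFamily (G ∩ {s | s.card ≤ m + 1}) A := hG.mono Set.inter_subset_left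
    (fun s hs t hts => ⟨hG.subset s hs.1 t hts, (Finset.card_le_card hts).trans hs.2⟩)
    fun s hs => ⟨hG.image s hs.1, Finset.card_image_le.trans hs.2⟩
  have hθ' : IsDualSmith (G ∩ {s | s.card ≤ m + 1}) A fun s =>
      chainLift (fanCochain (m + 1) 1) ((push (flagLabel ε) ∘ₗ subdiv fun s => s) (simplex s)) := by
    refine (isDualSmith_fanCochain (m + 1) 1).comp negLabel_involutive _ (by simp)
      (fun s hs => ?_) (fun s _ => ?_) (fun s hs => ?_)
    · refine map_mem_of_chainsIn (subdiv_mem _ s) (push (flagLabel ε)) ?_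
      rintro t ⟨⟨F, hF, hch, rfl⟩, -⟩
      refine chainsIn_mono (push_simplex_mem _ _) ?_
      rintro r ⟨rfl, -⟩
      rw [Finset.image_id']
      exact flagLabel_mem (G := G) hs.2 ⟨hs.1, hF, hch⟩ ε
    · simp only [LinearMap.comp_apply, bd_push, bd_subdiv]
    · simp only [LinearMap.comp_apply, push_subdiv]
      rw [← push_simplex_of_injective hG.involutive.injective]
      refine subdiv_push fun t ht hn => ?_
      have htG := hG.subset s hs.1 t ht
      simp only [flagLabel, negLabel, hε t htG hn,
        Finset.card_image_of_injective _ hG.involutive.injective]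
  have hcm : c ∈ chainsIn (G ∩ {s | s.card ≤ m + 1} ∩ {s | s.card = m + 1}) :=
    chainsIn_mono hc.mem fun s hs => ⟨⟨hs.1, (show s.card = m + 1 from hs.2).le⟩, hs.2⟩
  have h1 := hθ'.eval_eq hfree hθ hcm hc.inv hc.cycle
  rw [hθc, chainLift_comp, LinearMap.comp_apply, chainLift_fanCochain] at h1
  · exact h1
  · refine map_mem_of_chainsIn (subdiv_flag_mem hc.mem) _ fun t ht =>
      chainsIn_mono (push_simplex_mem _ t) ?_
    rintro r ⟨-, hr⟩
    exact hr.trans ht.2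

/-- The complex of flags of an odd cycle. -/
abbrev flagComplex (c : Chain X) : Complex (Finset X) := chainComplex (subdiv (fun s => s) c)

lemma image_image_mem_support (hA : Function.Involutive A) (hc : push A c = c)
    {t : Finset (Finset X)} (ht : t ∈ (subdiv (fun s => s) c).support) :
    t.image (fun s => s.image A) ∈ (subdiv (fun s => s) c).support := by
  have hA' : Function.Involutive fun s : Finset X => s.image A := fun s =>
    image_image_of_involutive hA s
  have h1 : push (fun s => s.image A) (subdiv (fun s => s) c) = subdiv (fun s => s) c := by
    conv_rhs => rw [← hc]
    rw [push_subdiv]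
    exact (eq_of_simplex (F := subdiv (fun s => s) ∘ₗ push A) (F' := subdiv fun s => s.image A)
      (fun s => subdiv_push fun t _ _ => rfl) c).symm
  rw [Finsupp.mem_support_iff] at ht ⊢
  rwa [← push_involutive_apply hA', h1]

/-- The involution of the flag complex. -/
def flagInvolution (hA : Function.Involutive A) (hc : push A c = c) :
    SimplicialMap (flagComplex c) (flagComplex c) where
  toFun s := s.image A
  image_mem := by
    rintro t ⟨hn, T, hT, htT⟩
    have hmem : (t.image fun s => s.image A) ∈ (flagComplex c).faces :=
      ⟨hn.image _, _, image_image_mem_support hA hc hT, Finset.image_subset_image htT⟩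
    convert hmem

lemma isFlag_of_mem_flagComplex (hc : c ∈ chainsIn (G ∩ {s | s.card = m + 1}))
    {t : Finset (Finset X)} (ht : t ∈ (flagComplex c).faces) :
    ∃ s, s.card = m + 1 ∧ IsFlag G s t := by
  obtain ⟨-, T, hT, htT⟩ := ht
  obtain ⟨⟨s, hs, h⟩, -⟩ := (Finsupp.mem_supported _ _).1 (subdiv_flag_mem hc) hT
  exact ⟨s, hs, h.mono htT⟩

lemma mem_flagComplex_iff (hc : c ∈ chainsIn (G ∩ {s | s.card = m + 1}))
    {t : Finset (Finset X)} : t ∈ (flagComplex c).faces ∧ t.card = m + 1 ↔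
      t ∈ (subdiv (fun s => s) c).support := by
  have hcard : ∀ T ∈ (subdiv (fun s => s) c).support, T.card = m + 1 := fun T hT =>
    ((Finsupp.mem_supported _ _).1 (subdiv_flag_mem hc) hT).2
  constructor
  · rintro ⟨⟨-, T, hT, htT⟩, h⟩
    rwa [Finset.eq_of_subset_of_card_le htT (by rw [h, hcard T hT])]
  · intro ht
    exact ⟨⟨Finset.card_pos.1 (by rw [hcard t ht]; omega), t, ht, subset_rfl⟩, hcard t ht⟩

/-- The signed barycentric coordinates, indexed by dimension. -/
def flagVector (ε : Finset X → ℤˣ) (m : ℕ) (x : Realization (flagComplex c)) :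
    EuclideanSpace ℝ (Fin (m + 1)) :=
  WithLp.toLp 2 fun i => ∑ s ∈ (subdiv (fun s => s) c).support.biUnion id,
    if s.card = i + 1 then x.1 s * ((ε s : ℤ) : ℝ) else 0

lemma flagVector_apply (ε : Finset X → ℤˣ) (x : Realization (flagComplex c)) (i : Fin (m + 1)) :
    flagVector ε m x i = ∑ s ∈ (subdiv (fun s => s) c).support.biUnion id,
      if s.card = i + 1 then x.1 s * ((ε s : ℤ) : ℝ) else 0 := rfl

/-- Each dimension occurs at most once in a flag, so there is no cancellation. -/
lemma flagVector_of_mem (hc : c ∈ chainsIn (G ∩ {s | s.card = m + 1})) (ε : Finset X → ℤˣ)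
    (x : Realization (flagComplex c)) {s : Finset X} (hs : s ∈ x.1.support) {i : Fin (m + 1)}
    (hi : s.card = i + 1) : flagVector ε m x i = x.1 s * ((ε s : ℤ) : ℝ) := by
  obtain ⟨_, -, h⟩ := isFlag_of_mem_flagComplex hc x.support_mem
  rw [flagVector_apply, Finset.sum_eq_single s, if_pos hi]
  · intro r _ hr
    split_ifs with hri
    · have : r ∉ x.1.support := fun h' => hr (h.eq_of_card h' hs (hri.trans hi.symm))
      rw [Finsupp.notMem_support_iff.1 this, zero_mul]
    · rfl
  · intro hn
    obtain ⟨-, T, hT, hsub⟩ := x.support_mem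
    exact absurd (Finset.mem_biUnion.2 ⟨T, hT, hsub hs⟩) hn

lemma exists_index (hc : c ∈ chainsIn (G ∩ {s | s.card = m + 1}))
    (x : Realization (flagComplex c)) {s : Finset X} (hs : s ∈ x.1.support) :
    ∃ i : Fin (m + 1), s.card = i + 1 := by
  obtain ⟨r, hr, h⟩ := isFlag_of_mem_flagComplex hc x.support_mem
  have h1 := (h.2.1 s hs).2.card_pos
  have h2 := Finset.card_le_card (h.2.1 s hs).1
  exact ⟨⟨s.card - 1, by omega⟩, by
    change s.card = s.card - 1 + 1
    omega⟩

lemma unit_ne_zero (u : ℤˣ) : ((u : ℤ) : ℝ) ≠ 0 := by exact_mod_cast u.ne_zero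

lemma flagVector_ne_zero (hc : c ∈ chainsIn (G ∩ {s | s.card = m + 1})) (ε : Finset X → ℤˣ)
    (x : Realization (flagComplex c)) : flagVector ε m x ≠ 0 := by
  obtain ⟨s, hs⟩ := x.exists_pos
  obtain ⟨i, hi⟩ := exists_index hc x ((x.pos_iff s).1 hs)
  intro h0
  have h1 := flagVector_of_mem hc ε x ((x.pos_iff s).1 hs) hi
  rw [h0] at h1
  exact mul_ne_zero hs.ne' (unit_ne_zero _) h1.symm

lemma continuous_flagVector (ε : Finset X → ℤˣ) (m : ℕ) :
    Continuous (flagVector (c := c) ε m) := by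
  refine (PiLp.continuous_toLp 2 _).comp (continuous_pi fun i => ?_)
  refine continuous_finsetSum _ fun s _ => ?_
  split_ifs
  · exact (Realization.continuous_coord s).mul continuous_const
  · exact continuous_const

section involution

variable (hG : IsFreeFamily G A) (hc : IsOddCycle m G A c)

lemma flagInvolution_apply (x : Realization (flagComplex c)) (s : Finset X) :
    ((flagInvolution hG.involutive hc.inv).realize x).1 (s.image A) = x.1 s := by
  rw [SimplicialMap.realize_val]
  exact Finsupp.mapDomain_apply (Finset.image_injective hG.involutive.injective) _ _

lemma flagInvolution_involutive (x : Realization (flagComplex c)) :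
    (flagInvolution hG.involutive hc.inv).realize
      ((flagInvolution hG.involutive hc.inv).realize x) = x := by
  refine Realization.ext fun s => ?_
  rw [← image_image_of_involutive hG.involutive s, flagInvolution_apply hG hc,
    flagInvolution_apply hG hc,
    image_image_of_involutive hG.involutive s]

lemma flagInvolution_ne (x : Realization (flagComplex c)) :
    (flagInvolution hG.involutive hc.inv).realize x ≠ x := by
  intro hx
  obtain ⟨s, hs⟩ := x.exists_pos
  obtain ⟨r, -, h⟩ := isFlag_of_mem_flagComplex hc.mem x.support_mem
  have h1 := flagInvolution_apply hG hc x s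
  rw [hx] at h1
  have hs1 := (x.pos_iff s).1 hs
  have hs2 : s.image A ∈ x.1.support := (x.pos_iff _).1 (h1 ▸ hs)
  have := h.eq_of_card hs2 hs1 (Finset.card_image_of_injective _ hG.involutive.injective)
  exact hG.free s (hG.subset r h.1 s (h.2.1 s hs1).1) (h.2.1 s hs1).2 this

lemma flagVector_flagInvolution {ε : Finset X → ℤˣ}
    (hε : ∀ s ∈ G, s.Nonempty → ε (s.image A) = -ε s) (x : Realization (flagComplex c)) :
    flagVector ε m ((flagInvolution hG.involutive hc.inv).realize x) = -flagVector ε m x := by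
  ext i
  rw [PiLp.neg_apply, flagVector_apply, flagVector_apply, ← Finset.sum_neg_distrib]
  have hm : ∀ s ∈ (subdiv (fun s => s) c).support.biUnion id,
      s.image A ∈ (subdiv (fun s => s) c).support.biUnion id := fun s hs => by
    obtain ⟨T, hT, hsT⟩ := Finset.mem_biUnion.1 hs
    exact Finset.mem_biUnion.2 ⟨_, image_image_mem_support hG.involutive hc.inv hT,
      Finset.mem_image_of_mem _ hsT⟩
  refine Finset.sum_nbij' (fun s => s.image A) (fun s => s.image A) hm hm
    (fun s _ => image_image_of_involutive hG.involutive s)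
    (fun s _ => image_image_of_involutive hG.involutive s) fun s hs => ?_
  have hx := flagInvolution_apply hG hc x (s.image A)
  rw [image_image_of_involutive hG.involutive s] at hx
  rw [hx, Finset.card_image_of_injective _ hG.involutive.injective]
  split_ifs
  · obtain ⟨T, hT, hsT⟩ := Finset.mem_biUnion.1 hs
    obtain ⟨⟨r, -, h⟩, -⟩ := (Finsupp.mem_supported _ _).1 (subdiv_flag_mem hc.mem) hT
    rw [hε s (hG.subset r h.1 s (h.2.1 s hsT).1) (h.2.1 s hsT).2]
    push_cast
    ring
  · simp

/-- The complex of flags of an odd cycle is an essential cycle. -/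
theorem isEssentialCycle_flagComplex :
    IsEssentialCycle m (flagComplex c) (flagInvolution hG.involutive hc.inv) := by
  have hA' : Function.Involutive fun s : Finset X => s.image A := fun s =>
    image_image_of_involutive hG.involutive s
  obtain ⟨ε, hε'⟩ := exists_sign hA'
  have hε : ∀ s ∈ G, s.Nonempty → ε (s.image A) = -ε s := fun s hs hn =>
    hε' s (hG.free s hs hn)
  -- the equivariant map to the sphere sends the barycenter of an `i`-simplex `s` to `ε s • e_i`;
  -- with respect to the triangulation by flags it is its own simplicial approximation
  have hodd := hc.push_flagLabel hG hε
  have hne : Nonempty (Realization (flagComplex c)) := by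
    by_contra hE
    have h0 : subdiv (fun s => s) c = 0 := by
      rw [← Finsupp.support_eq_empty, Finset.eq_empty_iff_forall_notMem]
      intro t ht
      obtain ⟨x, -⟩ := exists_support_eq ((mem_flagComplex_iff hc.mem).2 ht).1
      exact hE ⟨x⟩
    rw [h0, map_zero, Finsupp.zero_apply] at hodd
    exact zero_ne_one hodd
  refine ⟨finite_chainComplex _, ?_, ?_, flagInvolution_involutive hG hc, flagInvolution_ne hG hc,
    ⟨normalize _ (flagVector_ne_zero hc.mem ε),
      continuous_normalize _ (continuous_flagVector ε m)⟩, fun x => ?_, Finset X, flagComplex c,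
    vtx _, fun s => (Fin.ofNat (m + 1) (s.card - 1), ε s), isSubdivision_self
      (finite_chainComplex _), fun x y hy v hv => ?_, ?_⟩
  -- the complex is the union of its top simplices
  · rintro s ⟨hn, T, hT, hsT⟩
    have := (mem_flagComplex_iff hc.mem).2 hT
    exact ⟨T, this.1, hsT, this.2⟩
  -- every simplex of codimension one is a face of an even number of top simplices
  · intro s _ hs
    have h1 : bd (subdiv (fun s => s) c) s = 0 := by
      rw [bd_subdiv, hc.cycle, map_zero, Finsupp.zero_apply]
    rw [bd_apply, ZMod.natCast_eq_zero_iff_even, ← Set.ncard_coe_finset] at h1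
    convert h1 using 2
    ext t
    rw [Finset.coe_filter, Set.mem_ofPred_eq, Set.mem_ofPred_eq, ← mem_flagComplex_iff hc.mem, hs]
    tauto
  · refine Subtype.ext ?_
    change ‖_‖⁻¹ • _ = -(‖_‖⁻¹ • _)
    rw [flagVector_flagInvolution hG hc hε, norm_neg, smul_neg]
  -- the labels form a simplicial approximation
  · obtain rfl : y = x := Subtype.ext ((sum_vtx y).symm.trans hy)
    have hv' := (y.pos_iff v).1 hv
    obtain ⟨i, hi⟩ := exists_index hc.mem y hv'
    have hi' : Fin.ofNat (m + 1) (v.card - 1) = i := by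
      rw [hi, Nat.add_sub_cancel]
      exact Fin.ofNat_val_eq_self i
    change 0 < _ * (‖_‖⁻¹ * flagVector ε m y _)
    dsimp only
    rw [hi', flagVector_of_mem hc.mem ε y hv' hi]
    have h1 := inv_pos.2 (norm_pos_iff.2 (flagVector_ne_zero hc.mem ε y))
    have h2 : ((ε v : ℤ) : ℝ) * ((ε v : ℤ) : ℝ) = 1 := by
      rcases Int.units_eq_one_or (ε v) with h | h <;> simp [h]
    calc 0 < ‖flagVector ε m y‖⁻¹ * y.1 v := mul_pos h1 hv
      _ = ‖flagVector ε m y‖⁻¹ * y.1 v * (((ε v : ℤ) : ℝ) * ((ε v : ℤ) : ℝ)) := by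
        rw [h2, mul_one]
      _ = _ := by ring
  -- the number of top simplices with labels `e_0, …, e_m` is odd
  · rw [push_apply, ZMod.natCast_eq_one_iff_odd, ← Set.ncard_coe_finset] at hodd
    convert hodd using 2
    ext t
    have hcard : (crossFacet (m + 1) 1).card = m + 1 := by
      rw [crossFacet, Finset.card_image_of_injective _ (fun i j hij => (Prod.ext_iff.1 hij).1),
        Finset.card_range]
    rw [Finset.coe_filter, Set.mem_ofPred_eq, Set.mem_ofPred_eq, hcard,
      ← mem_flagComplex_iff hc.mem,
      ← image_toLabel]
    have himg : t ∈ (flagComplex c).faces → t.image (flagLabel ε) =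
        (t.image fun s => (Fin.ofNat (m + 1) (s.card - 1), ε s)).image toLabel := by
      intro ht
      obtain ⟨r, hr, h⟩ := isFlag_of_mem_flagComplex hc.mem ht
      rw [Finset.image_image]
      refine Finset.image_congr fun s hs => ?_
      have h1 := Finset.card_le_card (h.2.1 s hs).1
      have h2 := (h.2.1 s hs).2.card_pos
      refine Prod.ext ?_ rfl
      change s.card - 1 = (s.card - 1) % (m + 1)
      rw [Nat.mod_eq_of_lt (by omega)]
    constructor
    · rintro ⟨h1, h2, h3⟩
      exact ⟨⟨h1, h2⟩, by rw [himg h1, h3], h2⟩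
    · rintro ⟨⟨h1, h2⟩, h3, -⟩
      rw [himg h1, (Finset.image_injective toLabel_injective).eq_iff] at h3
      exact ⟨h1, h2, h3⟩

end involution

end Essential

/-! ### Maps defined on the complex of flags -/

section FlagMap

open scoped Classical

variable {X V : Type*} {m : ℕ} {G : Set (Finset X)} {A : X → X} {c : Chain X}

lemma affineMap_realize {W : Type*} {K : Complex X} {L : Complex W} {p : X → Realization L}
    (hp : IsAffineOn K p) (a : SimplicialMap K K) (b : SimplicialMap L L) (x : Realization K)
    (h : ∀ v ∈ x.1.support, p (a.toFun v) = b.realize (p v)) :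
    affineMap hp (a.realize x) = b.realize (affineMap hp x) := by
  refine Subtype.ext ?_
  have h1 : (affineMap hp (a.realize x)).1
      = (x.1.mapDomain a.toFun).sum fun v t => t • (p v).1 := rfl
  have h2 : (b.realize (affineMap hp x)).1
      = Finsupp.lmapDomain ℝ ℝ b.toFun (∑ v ∈ x.1.support, x.1 v • (p v).1) := rfl
  rw [h1, h2, map_sum]
  refine (Finsupp.sum_mapDomain_index (h := fun v t => t • (p v).1) (fun _ => zero_smul _ _)
    (fun _ _ _ => add_smul _ _ _)).trans ?_
  refine Finset.sum_congr rfl fun v hv => ?_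
  rw [map_smul]
  exact congrArg (fun z : Realization L => x.1 v • z.1) (h v hv)

/-- An equivariant map from the vertices of an odd cycle to a complex extends affinely over the
complex of flags, with values near those at the vertices. -/
lemma IsOddCycle.exists_map (hG : IsFreeFamily G A) (hc : IsOddCycle m G A c) {T : Complex V}
    [Nonempty (Realization T)] {b : SimplicialMap T T} (hb : Function.Injective b.realize)
    {q : X → Realization T} (hq : ∀ s ∈ G, s.image q ∈ cellSets T)
    (hqA : ∀ x, q (A x) = b.realize (q x)) :
    ∃ f : C(Realization (flagComplex c), Realization T),
      (∀ x, f ((flagInvolution hG.involutive hc.inv).realize x) = b.realize (f x)) ∧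
        ∀ x, ∃ s ∈ G, s.Nonempty ∧ ∀ (v : V) (y D : ℝ), (∀ z ∈ s, |(q z).1 v - y| ≤ D) →
          |(f x).1 v - y| ≤ D := by
  -- the vertex `r` of the complex of flags is sent to the barycenter of the points `q z`, `z ∈ r`
  have hp : IsAffineOn (flagComplex c) fun r => bary (r.image q) := by
    intro t ht
    obtain ⟨s, -, h⟩ := isFlag_of_mem_flagComplex hc.mem ht
    obtain ⟨t₀, ht₀, hs⟩ := hq s h.1
    refine ⟨t₀, ht₀, fun r hr => ?_⟩
    have hrs := Finset.image_subset_image (f := q) (h.2.1 r hr).1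
    exact support_bary_subset (cellSets_subset (hq s h.1) hrs) ((h.2.1 r hr).2.image q)
      fun x hx => hs x (hrs hx)
  refine ⟨⟨affineMap hp, continuous_affineMap hp⟩, fun x => ?_, fun x => ?_⟩
  · refine affineMap_realize hp _ b x fun r hr => ?_
    obtain ⟨s, -, h⟩ := isFlag_of_mem_flagComplex hc.mem x.support_mem
    have hrs := Finset.image_subset_image (f := q) (h.2.1 r hr).1
    have h1 : (r.image A).image q = (r.image q).image b.realize := by
      rw [Finset.image_image, Finset.image_image]
      exact Finset.image_congr fun z _ => hqA z
    change bary ((r.image A).image q) = _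
    rw [h1]
    exact realize_bary hb (cellSets_subset (hq s h.1) hrs) ((h.2.1 r hr).2.image q)
  -- a value is a convex combination of barycenters of points `q z`, `z ∈ s`
  · obtain ⟨s, hsc, h⟩ := isFlag_of_mem_flagComplex hc.mem x.support_mem
    refine ⟨s, h.1, Finset.card_pos.1 (by omega), fun v y D hD => ?_⟩
    have hb : ∀ r ∈ x.1.support, |(bary (r.image q)).1 v - y| ≤ D := by
      intro r hr
      have hn := (h.2.1 r hr).2.image q
      have hrs := Finset.image_subset_image (f := q) (h.2.1 r hr).1
      rw [bary_apply (cellSets_subset (hq s h.1) hrs) hn]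
      have hpos : (0 : ℝ) < (r.image q).card := by exact_mod_cast hn.card_pos
      have e1 : ((r.image q).card : ℝ)⁻¹ * ∑ z ∈ r.image q, z.1 v - y
          = ((r.image q).card : ℝ)⁻¹ * ∑ z ∈ r.image q, (z.1 v - y) := by
        rw [Finset.sum_sub_distrib, Finset.sum_const, nsmul_eq_mul, mul_sub,
          inv_mul_cancel_left₀ hpos.ne']
      rw [e1, abs_mul, abs_of_pos (inv_pos.2 hpos), inv_mul_le_iff₀ hpos, ← nsmul_eq_mul]
      refine (Finset.abs_sum_le_sum_abs _ _).trans (Finset.sum_le_card_nsmul _ _ _ fun z hz => ?_)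
      obtain ⟨u, hu, rfl⟩ := Finset.mem_image.1 hz
      exact hD u ((h.2.1 r hr).1 hu)
    change |(affineMap hp x).1 v - y| ≤ D
    have h1 := x.sum_eq_one subset_rfl
    have e1 : (affineMap hp x).1 v - y
        = ∑ r ∈ x.1.support, x.1 r * ((bary (r.image q)).1 v - y) := by
      rw [affineMap_apply hp x subset_rfl]
      simp only [mul_sub, Finset.sum_sub_distrib, ← Finset.sum_mul]
      rw [h1, one_mul]
    rw [e1]
    calc |∑ r ∈ x.1.support, x.1 r * ((bary (r.image q)).1 v - y)|
        ≤ ∑ r ∈ x.1.support, |x.1 r * ((bary (r.image q)).1 v - y)| :=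
          Finset.abs_sum_le_sum_abs _ _
      _ ≤ ∑ r ∈ x.1.support, x.1 r * D := Finset.sum_le_sum fun r hr => by
          rw [abs_mul, abs_of_nonneg (x.nonneg r)]
          exact mul_le_mul_of_nonneg_left (hb r hr) (x.nonneg r)
      _ = D := by rw [← Finset.sum_mul, h1, one_mul]

end FlagMap

/-! ### Essential cycles in covers -/

section Cover

open scoped Classical

variable {V : Type*} {S : Complex V} {m : ℕ} {a : SimplicialMap S S}

lemma IsEssentialCycle.realize_apply (h : IsEssentialCycle m S a) (x : Realization S) (v : V) :
    (a.realize x).1 v = if {v} ∈ S.faces then x.1 (a.toFun v) else 0 := by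
  have := h.nonempty
  split_ifs with hv
  · rw [a.realize_apply x subset_rfl]
    have h1 : ∀ u ∈ x.1.support, (if a.toFun u = v then x.1 u else 0)
        = if u = a.toFun v then x.1 u else 0 := fun u hu => by
      have hu' := singleton_mem_faces x.support_mem hu
      refine if_congr ⟨?_, ?_⟩ rfl rfl
      · rintro rfl
        exact (h.involutive_vertex hu').symm
      · rintro rfl
        exact h.involutive_vertex hv
    rw [Finset.sum_congr rfl h1, Finset.sum_ite_eq']
    split_ifs with h2
    · rfl
    · exact (Finsupp.notMem_support_iff.1 h2).symm
  · by_contra hne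
    exact hv (singleton_mem_faces (a.realize x).support_mem (Finsupp.mem_support_iff.2 hne))

/-- The involution preserves the sup distance in barycentric coordinates. -/
lemma IsEssentialCycle.exists_abs_sub_eq (h : IsEssentialCycle m S a) (x y : Realization S)
    (v : V) : (∃ u, |(a.realize x).1 v - (a.realize y).1 v| = |x.1 u - y.1 u|) ∨
      |(a.realize x).1 v - (a.realize y).1 v| = 0 := by
  rw [h.realize_apply, h.realize_apply]
  split_ifs
  · exact Or.inl ⟨_, rfl⟩
  · exact Or.inr (by simp)

lemma isFreeFamily_fineSets [Nonempty (Realization S)] (h : IsEssentialCycle m S a) {D : ℝ}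
    (hD : 0 ≤ D) (N : ℕ)
    {P : Realization S → Prop} (hP : ∀ x, P x → P (a.realize x)) :
    IsFreeFamily {s | s ∈ fineSets S D N ∧ ∀ x ∈ s, P x} a.realize := by
  refine (isFreeFamily_cellSets h.involutive h.free).mono (fun s hs => hs.1.1)
    (fun s hs t hts => ⟨fineSets_subset hs.1 hts, fun x hx => hs.2 x (hts hx)⟩) fun s hs => ?_
  refine ⟨⟨cellSets_image hs.1.1, Finset.card_image_le.trans hs.1.2.1, ?_⟩, ?_⟩
  · intro x hx y hy v
    obtain ⟨x, hxs, rfl⟩ := Finset.mem_image.1 hx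
    obtain ⟨y, hys, rfl⟩ := Finset.mem_image.1 hy
    rcases h.exists_abs_sub_eq x y v with ⟨u, hu⟩ | h0
    · rw [hu]
      exact hs.1.2.2 x hxs y hys u
    · rwa [h0]
  · intro x hx
    obtain ⟨x, hxs, rfl⟩ := Finset.mem_image.1 hx
    exact hP x (hs.2 x hxs)

/-- If an essential `(p + q)`-cycle is covered by two invariant open sets, then an essential
`p`-cycle maps to the first one or an essential `q`-cycle maps to the second one. Otherwise dual
Smith cochains of the two parts could be truncated in dimensions `p` and `q`, and their join would
vanish in dimension `p + q`. -/
theorem IsEssentialCycle.exists_of_cover {V : Type} {S : Complex V} {a : SimplicialMap S S}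
    {p q : ℕ} (h : IsEssentialCycle (p + q) S a) (hp : 0 < p) (hq : 0 < q)
    {A B : Set (Realization S)} (hA : IsOpen A) (hB : IsOpen B)
    (hAa : ∀ x, a.realize x ∈ A → x ∈ A) (hcov : ∀ x, x ∈ A ∨ x ∈ B) :
    HasEssentialCycleIn p a.realize A ∨ HasEssentialCycleIn q a.realize B := by
  have := h.nonempty
  have hainj : Function.Injective a.realize := Function.Involutive.injective h.involutive
  obtain ⟨δ, hδ, hleb⟩ := Realization.exists_lebesgue h.finite (fun i : Bool => cond i A B)
    (by rintro (_ | _) <;> assumption) (fun x => by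
      rcases hcov x with hx | hx
      · exact ⟨true, hx⟩
      · exact ⟨false, hx⟩)
  -- the points are divided into those whose `δ`-neighborhood lies in `A`, and the others, whose
  -- `δ`-neighborhood lies in `B`
  let P : Realization S → Prop := fun x =>
    ∀ y : Realization S, (∀ v, |y.1 v - x.1 v| < δ) → y ∈ A
  have hP : ∀ x, P x → P (a.realize x) := by
    intro x hx y hy
    refine hAa y (hx _ fun v => ?_)
    rcases h.exists_abs_sub_eq y (a.realize x) v with ⟨u, hu⟩ | h0
    · rw [h.involutive] at hu
      rw [hu]
      exact hy u
    · rw [h.involutive] at h0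
      rwa [h0]
  have hP' : ∀ x, ¬ P x → ¬ P (a.realize x) := fun x hx hx' => hx (by
    have := hP _ hx'
    rwa [h.involutive] at this)
  have hPB : ∀ x, ¬ P x → ∀ y : Realization S, (∀ v, |y.1 v - x.1 v| < δ) → y ∈ B := by
    intro x hx
    obtain ⟨_ | _, hi⟩ := hleb x
    · exact hi
    · exact absurd hi hx
  set N := p + q + 1 with hN
  obtain ⟨n, hn⟩ := exists_sdIter_fine (S := S) N (half_pos hδ)
  have hGA := isFreeFamily_fineSets h (half_pos hδ).le N hP
  have hGB := isFreeFamily_fineSets h (half_pos hδ).le N hP'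
  set GA := {s | s ∈ fineSets S (δ / 2) N ∧ ∀ x ∈ s, P x}
  set GB := {s | s ∈ fineSets S (δ / 2) N ∧ ∀ x ∈ s, ¬ P x}
  obtain ⟨c, hc⟩ := h.exists_isOddCycle
  obtain ⟨θ, hθ, hθc⟩ := hc.odd
  -- an odd cycle consisting of small simplices maps to the corresponding open set
  have key : ∀ (r : ℕ) (Q : Realization S → Prop) (U : Set (Realization S)),
      IsFreeFamily {s | s ∈ fineSets S (δ / 2) N ∧ ∀ x ∈ s, Q x} a.realize →
      (∀ x, Q x → ∀ y : Realization S, (∀ v, |y.1 v - x.1 v| < δ) → y ∈ U) →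
      ∀ z, IsOddCycle r {s | s ∈ fineSets S (δ / 2) N ∧ ∀ x ∈ s, Q x} a.realize z →
        HasEssentialCycleIn r a.realize U := by
    intro r Q U hfree hQU z hz
    obtain ⟨f, hf, hf'⟩ := hz.exists_map hfree hainj (q := fun x => x) (fun s hs => by
      rw [Finset.image_id']
      exact hs.1.1) fun x => rfl
    refine ⟨_, _, _, isEssentialCycle_flagComplex hfree hz, f, hf, fun x => ?_⟩
    obtain ⟨s, hs, ⟨y, hy⟩, hs'⟩ := hf' x
    refine hQU y (hs.2 y hy) _ fun v => ?_
    exact (hs' v _ _ fun z hz => hs.1.2.2 z hz y hy v).trans_lt (half_lt_self hδ)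
  -- without such odd cycles, all characteristic numbers vanish and the cochains can be truncated
  by_cases hexA : ∃ z, IsOddCycle p GA a.realize z
  · obtain ⟨z, hz⟩ := hexA
    exact Or.inl (key p P A hGA (fun x hx => hx) z hz)
  by_cases hexB : ∃ z, IsOddCycle q GB a.realize z
  · obtain ⟨z, hz⟩ := hexB
    exact Or.inr (key q _ B hGB hPB z hz)
  exfalso
  have hone : ∀ z : ZMod 2, z ≠ 1 → z = 0 := by decide
  have htrunc : ∀ (r : ℕ) (H : Set (Finset (Realization S))), 0 < r → r ≤ p + q →
      H ⊆ cellSets S → IsFreeFamily H a.realize → (¬ ∃ z, IsOddCycle r H a.realize z) →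
      ∃ θ', IsDualSmith H a.realize θ' ∧ ∀ s, r < s.card → θ' s = 0 := by
    intro r H hr hr' hHS hH hno
    have hθH : IsDualSmith (H ∩ {s | s.card ≤ r + 1}) a.realize θ :=
      hθ.mono fun s hs => ⟨hHS hs.1, le_trans (show s.card ≤ r + 1 from hs.2) (by omega)⟩
    exact hθH.exists_truncated hH hr fun z hz hz1 hz2 => hone _ fun hz3 =>
      hno ⟨z, hz, hz1, hz2, θ, hθH, hz3⟩
  obtain ⟨α, hα, hα0⟩ := htrunc p GA hp (by omega) (fun s hs => hs.1.1) hGA hexA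
  obtain ⟨β, hβ, hβ0⟩ := htrunc q GB hq (by omega) (fun s hs => hs.1.1) hGB hexB
  have hjoin := IsDualSmith.join (G := fineSets S (δ / 2) N) hGA.involutive hα hβ P
    (fun x => ⟨fun hx => by
      have := hP _ hx
      rwa [h.involutive] at this, hP x⟩)
    (fun s hs => ⟨fineSets_subset hs (Finset.filter_subset _ _), fun x hx =>
      (Finset.mem_filter.1 hx).2⟩)
    (fun s hs => ⟨fineSets_subset hs (Finset.filter_subset _ _), fun x hx =>
      (Finset.mem_filter.1 hx).2⟩) hGB.image
  set κ := fun s : Finset (Realization S) =>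
    α (s.filter P) * β ((s.filter fun x => ¬ P x).image (a.realize^[(s.filter P).card]))
  have hfine : ∀ s ∈ cellSets S ∩ {s | s.card ≤ p + q + 1},
      sdIter S (n + 1) (simplex s) ∈ chainsIn (fineSets S (δ / 2) N) :=
    fun s hs => hn _ (simplex_mem hs)
  have hpull := hjoin.comp h.involutive (sdIter S (n + 1)) (by simp) hfine
    (fun s _ => bd_sdIter _ _) (fun s hs => by
      rw [← push_simplex_of_injective hainj, push_sdIter hainj _ (simplex_mem hs.1)])
  have hfree : IsFreeFamily (cellSets S ∩ {s | s.card ≤ p + q + 1}) a.realize :=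
    (isFreeFamily_cellSets h.involutive h.free).mono Set.inter_subset_left
      (fun s hs t hts => ⟨cellSets_subset hs.1 hts, (Finset.card_le_card hts).trans hs.2⟩)
      fun s hs => ⟨cellSets_image hs.1, Finset.card_image_le.trans hs.2⟩
  have hcm : c ∈ chainsIn (cellSets S ∩ {s | s.card ≤ p + q + 1} ∩ {s | s.card = p + q + 1}) :=
    chainsIn_mono hc.mem fun s hs => ⟨⟨hs.1, (show s.card = p + q + 1 from hs.2).le⟩, hs.2⟩
  -- the value of a dual Smith sequence at the cycle is `1`, whichever sequence is used
  have heq := hpull.eval_eq hfree hθ hcm hc.inv hc.cycle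
  rw [hθc, chainLift_comp] at heq
  have hcard : sdIter S (n + 1) c ∈ chainsIn {s | s.card = p + q + 1} :=
    sdIter_mem (fun s hs t _ htc => Eq.trans htc hs) _
      (chainsIn_mono hc.mem Set.inter_subset_right)
  have hzero : chainLift κ (sdIter S (n + 1) c) = 0 := by
    refine (eqOn_chainsIn (F := chainLift κ) (F' := 0) hcard fun s hs => ?_).trans rfl
    rw [chainLift_simplex, LinearMap.zero_apply]
    have h1 : (s.filter P).card + (s.filter fun x => ¬ P x).card = p + q + 1 :=
      (Finset.card_filter_add_card_filter_not (s := s) P).trans hs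
    -- of `p + q + 1` vertices, more than `p` satisfy `P` or more than `q` do not
    by_cases h2 : p < (s.filter P).card
    · exact mul_eq_zero_of_left (hα0 _ h2) _
    · refine mul_eq_zero_of_right _ (hβ0 _ ?_)
      rw [Finset.card_image_of_injective _ (hainj.iterate _)]
      omega
  rw [hzero] at heq
  exact zero_ne_one heq

end Cover

/-! ### Joins of odd cycles -/

section Join

open scoped Classical

variable {X₁ X₂ : Type*}

/-- Equality in disjoint unions is decided classically, like equality in other types of vertices. -/
@[reducible]
def decidableEqSum : DecidableEq (X₁ ⊕ X₂) := fun a b => Classical.propDecidable (a = b)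

attribute [local instance] decidableEqSum

/-- The join of two chains. -/
def joinChain : Chain X₁ →ₗ[ZMod 2] Chain X₂ →ₗ[ZMod 2] Chain (X₁ ⊕ X₂) :=
  chainLift fun s => chainLift fun t => simplex (s.disjSum t)

@[simp] lemma joinChain_simplex (s : Finset X₁) (t : Finset X₂) :
    joinChain (simplex s) (simplex t) = simplex (s.disjSum t) := by
  rw [joinChain, chainLift_simplex, chainLift_simplex]

/-- A bilinear identity for chains may be checked on simplices. -/
lemma eqOn_chainsIn₂ {M : Type*} [AddCommGroup M] [Module (ZMod 2) M] {G₁ : Set (Finset X₁)}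
    {G₂ : Set (Finset X₂)} {F F' : Chain X₁ →ₗ[ZMod 2] Chain X₂ →ₗ[ZMod 2] M} {c₁ : Chain X₁}
    {c₂ : Chain X₂} (h₁ : c₁ ∈ chainsIn G₁) (h₂ : c₂ ∈ chainsIn G₂)
    (h : ∀ s ∈ G₁, ∀ t ∈ G₂, F (simplex s) (simplex t) = F' (simplex s) (simplex t)) :
    F c₁ c₂ = F' c₁ c₂ :=
  eqOn_chainsIn (F := F.flip c₂) (F' := F'.flip c₂) h₁ fun s hs =>
    eqOn_chainsIn (F := F (simplex s)) (F' := F' (simplex s)) h₂ fun t ht => h s hs t ht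

lemma bd_joinChain (c₁ : Chain X₁) (c₂ : Chain X₂) :
    bd (joinChain c₁ c₂) = joinChain (bd c₁) c₂ + joinChain c₁ (bd c₂) := by
  refine eqOn_chainsIn₂ (F := joinChain.compr₂ bd)
    (F' := joinChain.comp bd + joinChain.compl₂ bd) (mem_chainsIn_univ c₁) (mem_chainsIn_univ c₂)
    fun s _ t _ => ?_
  simp only [LinearMap.compr₂_apply, LinearMap.add_apply, LinearMap.comp_apply,
    LinearMap.compl₂_apply, joinChain_simplex, bd_simplex, map_sum, LinearMap.sum_apply,
    Finset.sum_disjSum]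
  congr 1
  · refine Finset.sum_congr rfl fun v _ => ?_
    congr 1
    ext (x | x) <;> simp
  · refine Finset.sum_congr rfl fun v _ => ?_
    congr 1
    ext (x | x) <;> simp

lemma image_disjSum {Y₁ Y₂ : Type*} (f₁ : X₁ → Y₁) (f₂ : X₂ → Y₂) (s : Finset X₁)
    (t : Finset X₂) : (s.disjSum t).image (Sum.map f₁ f₂)
      = (s.image f₁).disjSum (t.image f₂) := by
  ext (x | x) <;> simp

lemma push_joinChain {A₁ : X₁ → X₁} {A₂ : X₂ → X₂} (h₁ : Function.Injective A₁)
    (h₂ : Function.Injective A₂) (c₁ : Chain X₁) (c₂ : Chain X₂) :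
    push (Sum.map A₁ A₂) (joinChain c₁ c₂) = joinChain (push A₁ c₁) (push A₂ c₂) := by
  refine eqOn_chainsIn₂ (F := joinChain.compr₂ (push (Sum.map A₁ A₂)))
    (F' := joinChain.compl₁₂ (push A₁) (push A₂)) (mem_chainsIn_univ c₁) (mem_chainsIn_univ c₂)
    fun s _ t _ => ?_
  simp only [LinearMap.compr₂_apply, LinearMap.compl₁₂_apply, joinChain_simplex]
  rw [push_simplex_of_injective (h₁.sumMap h₂), push_simplex_of_injective h₁,
    push_simplex_of_injective h₂, joinChain_simplex, image_disjSum]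

/-- The join of two families of finite sets, of bounded cardinality. -/
def joinFamily (G₁ : Set (Finset X₁)) (G₂ : Set (Finset X₂)) (m₁ m₂ : ℕ) :
    Set (Finset (X₁ ⊕ X₂)) :=
  {s | (s.toLeft ∈ G₁ ∧ s.toLeft.card ≤ m₁ + 1) ∧ s.toRight ∈ G₂ ∧ s.toRight.card ≤ m₂ + 1}

lemma toLeft_image_sumMap (A₁ : X₁ → X₁) (A₂ : X₂ → X₂) (s : Finset (X₁ ⊕ X₂)) :
    (s.image (Sum.map A₁ A₂)).toLeft = s.toLeft.image A₁ := by
  ext x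
  simp

lemma toRight_image_sumMap (A₁ : X₁ → X₁) (A₂ : X₂ → X₂) (s : Finset (X₁ ⊕ X₂)) :
    (s.image (Sum.map A₁ A₂)).toRight = s.toRight.image A₂ := by
  ext x
  simp

variable {G₁ : Set (Finset X₁)} {G₂ : Set (Finset X₂)} {A₁ : X₁ → X₁} {A₂ : X₂ → X₂}
  {m₁ m₂ : ℕ}

lemma isFreeFamily_joinFamily (h₁ : IsFreeFamily G₁ A₁) (h₂ : IsFreeFamily G₂ A₂) :
    IsFreeFamily (joinFamily G₁ G₂ m₁ m₂) (Sum.map A₁ A₂) where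
  involutive := by
    rintro (x | x)
    · exact congrArg Sum.inl (h₁.involutive x)
    · exact congrArg Sum.inr (h₂.involutive x)
  subset s hs t hts := by
    have hl : t.toLeft ⊆ s.toLeft := Finset.toLeft_monotone hts
    have hr : t.toRight ⊆ s.toRight := Finset.toRight_monotone hts
    exact ⟨⟨h₁.subset _ hs.1.1 _ hl, (Finset.card_le_card hl).trans hs.1.2⟩,
      h₂.subset _ hs.2.1 _ hr, (Finset.card_le_card hr).trans hs.2.2⟩
  image s hs := by
    refine ⟨?_, ?_⟩
    · rw [toLeft_image_sumMap]
      exact ⟨h₁.image _ hs.1.1, Finset.card_image_le.trans hs.1.2⟩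
    · rw [toRight_image_sumMap]
      exact ⟨h₂.image _ hs.2.1, Finset.card_image_le.trans hs.2.2⟩
  free s hs hn he := by
    have hl : s.toLeft.image A₁ = s.toLeft := by rw [← toLeft_image_sumMap, he]
    have hr : s.toRight.image A₂ = s.toRight := by rw [← toRight_image_sumMap, he]
    obtain ⟨x | x, hx⟩ := hn
    · exact h₁.free _ hs.1.1 ⟨x, Finset.mem_toLeft.2 hx⟩ hl
    · exact h₂.free _ hs.2.1 ⟨x, Finset.mem_toRight.2 hx⟩ hr

/-- The pullback of a dual Smith cochain to one side of a join. -/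
lemma IsDualSmith.pullback {X Y : Type*} {G : Set (Finset Y)} {H : Set (Finset X)} {A : Y → Y}
    {B : X → X} (hA : Function.Involutive A) (hB : Function.Injective B) {θ : Finset Y → ZMod 2}
    (h : IsDualSmith G A θ) (g : X → Y) (hg : ∀ s ∈ H, s.image g ∈ G)
    (he : ∀ s ∈ H, ∀ x ∈ s, g (B x) = A (g x)) :
    IsDualSmith H B fun s => chainLift θ (push g (simplex s)) := by
  refine h.comp hA (push g) (by simp) (fun s hs => ?_) (fun s _ => bd_push _ _) fun s hs => ?_
  · refine chainsIn_mono (push_simplex_mem g s) ?_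
    rintro t ⟨rfl, -⟩
    exact hg s hs
  · rw [← push_simplex_of_injective hB, push_push, push_push]
    exact push_congr fun x hx => he s hs x hx

lemma push_iterate {X : Type*} {A : X → X} {c : Chain X} (h : push A c = c) (n : ℕ) :
    push A^[n] c = c := by
  induction n with
  | zero => exact push_id c
  | succ n ih => rw [Function.iterate_succ, ← push_push, h, ih]

lemma IsOddCycle.nonempty {X : Type*} {m : ℕ} {G : Set (Finset X)} {A : X → X} {c : Chain X}
    (h : IsOddCycle m G A c) : Nonempty X := by
  obtain ⟨θ, -, hθ⟩ := h.odd
  have h0 : c ≠ 0 := by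
    rintro rfl
    rw [map_zero] at hθ
    exact zero_ne_one hθ
  obtain ⟨s, hs⟩ := Finsupp.support_nonempty_iff.2 h0
  have hsc : s.card = m + 1 := ((Finsupp.mem_supported _ _).1 h.mem hs).2
  obtain ⟨x, -⟩ := Finset.card_pos.1 (show 0 < s.card by omega)
  exact ⟨x⟩

/-- The join of two odd cycles is an odd cycle. -/
theorem IsOddCycle.join (hG₁ : IsFreeFamily G₁ A₁) (hG₂ : IsFreeFamily G₂ A₂) {c₁ : Chain X₁}
    {c₂ : Chain X₂} (h₁ : IsOddCycle m₁ G₁ A₁ c₁) (h₂ : IsOddCycle m₂ G₂ A₂ c₂) :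
    IsOddCycle (m₁ + m₂ + 1) (joinFamily G₁ G₂ m₁ m₂) (Sum.map A₁ A₂) (joinChain c₁ c₂) := by
  have hfree := isFreeFamily_joinFamily (m₁ := m₁) (m₂ := m₂) hG₁ hG₂
  refine ⟨?_, ?_, ?_, ?_⟩
  · refine map_mem_of_chainsIn h₁.mem (joinChain.flip c₂) fun s hs => ?_
    refine map_mem_of_chainsIn h₂.mem (joinChain (simplex s)) fun t ht => ?_
    have hsc : s.card = m₁ + 1 := hs.2
    have htc : t.card = m₂ + 1 := ht.2
    rw [joinChain_simplex]
    refine simplex_mem ⟨⟨?_, ?_⟩, ?_⟩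
    · rw [Finset.toLeft_disjSum]
      exact ⟨hs.1, hsc.le⟩
    · rw [Finset.toRight_disjSum]
      exact ⟨ht.1, htc.le⟩
    · rw [Set.mem_ofPred_eq, Finset.card_disjSum]
      omega
  · rw [push_joinChain hG₁.involutive.injective hG₂.involutive.injective, h₁.inv, h₂.inv]
  · rw [bd_joinChain, h₁.cycle, h₂.cycle]
    simp
  obtain ⟨θ₁, hθ₁, hc₁⟩ := h₁.odd
  obtain ⟨θ₂, hθ₂, hc₂⟩ := h₂.odd
  have hne₁ := h₁.nonempty
  have hne₂ := h₂.nonempty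
  -- the cochains are pulled back to the two ends of the join; the values of `g₁` and `g₂` on the
  -- opposite ends do not matter, and are arbitrary
  let g₁ : X₁ ⊕ X₂ → X₁ := Sum.elim (fun x => x) fun _ => Classical.arbitrary _
  let g₂ : X₁ ⊕ X₂ → X₂ := Sum.elim (fun _ => Classical.arbitrary _) fun x => x
  let H₁ : Set (Finset (X₁ ⊕ X₂)) := {s | s.toLeft ∈ G₁ ∩ {s | s.card ≤ m₁ + 1} ∧ s.toRight = ∅}
  let H₂ : Set (Finset (X₁ ⊕ X₂)) := {s | s.toRight ∈ G₂ ∩ {s | s.card ≤ m₂ + 1} ∧ s.toLeft = ∅}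
  have hg₁ : ∀ s : Finset (X₁ ⊕ X₂), s.toRight = ∅ → s.image g₁ = s.toLeft := by
    intro s hs
    conv_lhs => rw [← Finset.toLeft_disjSum_toRight (u := s), hs]
    ext x
    simp [g₁, Finset.mem_image]
  have hg₂ : ∀ s : Finset (X₁ ⊕ X₂), s.toLeft = ∅ → s.image g₂ = s.toRight := by
    intro s hs
    conv_lhs => rw [← Finset.toLeft_disjSum_toRight (u := s), hs]
    ext x
    simp [g₂, Finset.mem_image]
  have hα := hθ₁.pullback (H := H₁) hG₁.involutive hfree.involutive.injective g₁
    (fun s hs => by rw [hg₁ s hs.2]; exact hs.1) (by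
      rintro s hs (x | x) hx
      · rfl
      · exact absurd (Finset.mem_toRight.2 hx) (by rw [hs.2]; simp))
  have hβ := hθ₂.pullback (H := H₂) hG₂.involutive hfree.involutive.injective g₂
    (fun s hs => by rw [hg₂ s hs.2]; exact hs.1) (by
      rintro s hs (x | x) hx
      · exact absurd (Finset.mem_toLeft.2 hx) (by rw [hs.2]; simp)
      · rfl)
  have hfl : ∀ s : Finset (X₁ ⊕ X₂), (s.filter fun x => x.isLeft = true).toLeft = s.toLeft ∧
      (s.filter fun x => x.isLeft = true).toRight = ∅ := fun s =>
    ⟨by ext; simp, by ext; simp⟩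
  have hfr : ∀ s : Finset (X₁ ⊕ X₂), (s.filter fun x => ¬ x.isLeft = true).toRight = s.toRight ∧
      (s.filter fun x => ¬ x.isLeft = true).toLeft = ∅ := fun s =>
    ⟨by ext; simp, by ext; simp⟩
  refine ⟨_, (IsDualSmith.join (G := joinFamily G₁ G₂ m₁ m₂) hfree.involutive hα hβ
    (fun x => x.isLeft = true) (by rintro (x | x) <;> rfl) (fun s hs => ?_) (fun s hs => ?_)
    fun s hs => ?_).mono Set.inter_subset_left, ?_⟩
  · exact ⟨by rw [(hfl s).1]; exact hs.1, (hfl s).2⟩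
  · exact ⟨by rw [(hfr s).1]; exact hs.2, (hfr s).2⟩
  · refine ⟨?_, ?_⟩
    · rw [toRight_image_sumMap]
      exact ⟨hG₂.image _ hs.1.1, Finset.card_image_le.trans hs.1.2⟩
    · rw [toLeft_image_sumMap, hs.2, Finset.image_empty]
  · set κ := fun s : Finset (X₁ ⊕ X₂) =>
      chainLift θ₁ (push g₁ (simplex (s.filter fun x => x.isLeft = true))) *
        chainLift θ₂ (push g₂ (simplex ((s.filter fun x => ¬ x.isLeft = true).image
          (Sum.map A₁ A₂)^[(s.filter fun x => x.isLeft = true).card])))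
    -- the power of the involution disappears on the invariant chain `c₂`
    have hev : chainLift κ (joinChain c₁ c₂)
        = chainLift θ₁ c₁ * chainLift θ₂ (push A₂^[m₁ + 1] c₂) := by
      refine eqOn_chainsIn₂ (F := joinChain.compr₂ (chainLift κ))
        (F' := (LinearMap.mul (ZMod 2) (ZMod 2)).compl₁₂ (chainLift θ₁)
          (chainLift θ₂ ∘ₗ push A₂^[m₁ + 1])) h₁.mem (mem_chainsIn_univ c₂) fun s hs t _ => ?_
      simp only [LinearMap.compr₂_apply, LinearMap.compl₁₂_apply, joinChain_simplex,
        LinearMap.comp_apply, LinearMap.mul_apply', chainLift_simplex, κ]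
      have hL : (s.disjSum t).filter (fun x => x.isLeft = true) = s.image Sum.inl := by
        ext (x | x) <;> simp
      have hR : (s.disjSum t).filter (fun x => ¬ x.isLeft = true) = t.image Sum.inr := by
        ext (x | x) <;> simp
      have hcard : (s.image (Sum.inl : X₁ → X₁ ⊕ X₂)).card = m₁ + 1 :=
        (Finset.card_image_of_injective _ Sum.inl_injective).trans hs.2
      have hiter : ∀ n x, (Sum.map A₁ A₂)^[n] (Sum.inr x) = Sum.inr (A₂^[n] x) := by
        intro n
        induction n with
        | zero => exact fun x => rfl
        | succ n ih =>
          intro x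
          rw [Function.iterate_succ_apply, Function.iterate_succ_apply, Sum.map_inr, ih]
      rw [hL, hR, hcard, ← push_simplex_of_injective Sum.inl_injective,
        ← push_simplex_of_injective (hfree.involutive.injective.iterate _),
        ← push_simplex_of_injective Sum.inr_injective, push_push, push_push, push_push]
      have e₁ : push (g₁ ∘ Sum.inl) (simplex s) = simplex s := push_id _
      have e₂ : (g₂ ∘ (Sum.map A₁ A₂)^[m₁ + 1]) ∘ Sum.inr = A₂^[m₁ + 1] := by
        funext x
        simp only [Function.comp_apply, hiter]
        rfl
      rw [e₁, e₂, chainLift_simplex]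
    rw [hev, push_iterate h₂.inv, hc₁, hc₂, one_mul]

end Join

/-! ### Maps from joins to products of contractible spaces -/

section Part

variable {V W Y : Type*} {S : Complex V} {J : Complex W} {i : V → W}

/-- The barycentric coordinates of a point in the direction of a set of vertices. -/
def partVal (hi : Function.Injective i) (z : Realization J) : V →₀ ℝ :=
  z.1.comapDomain i hi.injOn

/-- The total weight of a point in the direction of a set of vertices. -/
def mass (hi : Function.Injective i) (z : Realization J) : ℝ :=
  (partVal hi z).sum fun _ t => t

/-- The simplices of `S` are the traces of the simplices of `J`. -/
def IsTrace (S : Complex V) (J : Complex W) (i : V → W) : Prop :=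
  ∀ s ∈ J.faces, ∀ t : Finset V, t.Nonempty → (∀ v ∈ t, i v ∈ s) → t ∈ S.faces

lemma support_partVal_mem (hi : Function.Injective i) (hJ : IsTrace S J i) (z : Realization J)
    (hn : (partVal hi z).support.Nonempty) : (partVal hi z).support ∈ S.faces :=
  hJ _ z.support_mem _ hn fun _ hv => by
    rw [Finsupp.mem_support_iff] at hv ⊢
    exact hv

/-- The normalized part of a point in the direction of a set of vertices. -/
def part (hi : Function.Injective i) (hJ : IsTrace S J i) (z : Realization J)
    (h : 0 < mass hi z) : Realization S :=
  ⟨(mass hi z)⁻¹ • partVal hi z, by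
    refine ⟨fun v => ?_, ?_, ?_⟩
    · exact mul_nonneg (inv_nonneg.2 h.le) (z.nonneg _)
    · rw [Finsupp.sum_smul_index (fun _ => rfl), ← Finsupp.mul_sum]
      exact inv_mul_cancel₀ h.ne'
    · rw [Finsupp.support_smul_eq (inv_ne_zero h.ne')]
      refine support_partVal_mem hi hJ z ?_
      rw [Finset.nonempty_iff_ne_empty]
      intro h0
      rw [mass, Finsupp.sum, h0, Finset.sum_empty] at h
      exact lt_irrefl _ h⟩

lemma part_apply (hi : Function.Injective i) (hJ : IsTrace S J i) (z : Realization J)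
    (h : 0 < mass hi z) (v : V) : (part hi hJ z h).1 v = (mass hi z)⁻¹ * z.1 (i v) := rfl

lemma continuous_mass (hi : Function.Injective i) (hJ : IsTrace S J i) (hS : S.faces.Finite) :
    Continuous (mass (J := J) hi) := by
  classical
  have h : mass (J := J) hi = fun z => ∑ v ∈ hS.toFinset.biUnion id, z.1 (i v) := by
    funext z
    refine Finsupp.sum_of_support_subset _ (fun v hv => ?_) _ fun _ _ => rfl
    have := support_partVal_mem hi hJ z ⟨v, hv⟩
    exact Finset.mem_biUnion.2 ⟨_, hS.mem_toFinset.2 this, hv⟩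
  rw [h]
  exact continuous_finsetSum _ fun v _ => Realization.continuous_coord _

lemma continuous_part (hi : Function.Injective i) (hJ : IsTrace S J i) (hS : S.faces.Finite) :
    Continuous fun z : {z : Realization J // 0 < mass hi z} => part hi hJ z.1 z.2 := by
  refine Realization.continuous_of_coord (fun v => ?_) hS subset_rfl fun z =>
    ⟨_, (part hi hJ z.1 z.2).support_mem, subset_rfl⟩
  simp only [part_apply]
  exact (((continuous_mass hi hJ hS).comp continuous_subtype_val).inv₀ fun z => z.2.ne').mul
    ((Realization.continuous_coord _).comp continuous_subtype_val)

/-- A map from `|S|` to a contractible space extends to `|J|`, after composition with the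
projection from the half of `|J|` that is close to `|S|`. -/
lemma exists_extension [TopologicalSpace Y] [ContractibleSpace Y] (hi : Function.Injective i)
    (hJ : IsTrace S J i) (hS : S.faces.Finite) (α : C(Realization S, Y)) :
    ∃ F : C(Realization J, Y), ∀ z (h : 0 < mass hi z), 1 / 2 ≤ mass hi z →
      F z = α (part hi hJ z h) := by
  classical
  obtain ⟨y₀, ⟨H⟩⟩ := id_nullhomotopic Y
  -- the contraction `H` is run backwards while the mass increases from `1/4` to `1/2`
  let clamp : ℝ → unitInterval := fun t => Set.projIcc 0 1 zero_le_one (2 - 4 * t)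
  have hclamp : Continuous clamp := by
    exact continuous_projIcc.comp (continuous_const.sub (continuous_const.mul continuous_id))
  have hmass := continuous_mass hi hJ hS
  let F : Realization J → Y := fun z =>
    if h : 0 < mass hi z then H (clamp (mass hi z), α (part hi hJ z h)) else y₀
  have hF0 : ∀ z, mass hi z < 1 / 4 → F z = y₀ := by
    intro z hz
    simp only [F]
    split_ifs with h
    · have : clamp (mass hi z) = 1 := Set.projIcc_of_right_le _ (by linarith)
      rw [this, H.apply_one]
      rfl
    · rfl
  have hFc : Continuous F := by
    rw [continuous_iff_continuousAt]
    intro z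
    by_cases hz : mass hi z < 1 / 4
    · refine continuousAt_const.congr (f := fun _ => y₀) ?_
      filter_upwards [(isOpen_lt hmass continuous_const).mem_nhds hz] with w hw
      exact (hF0 w hw).symm
    · have hz' : 0 < mass hi z := by linarith [not_lt.1 hz]
      have hopen : IsOpen {z : Realization J | 0 < mass hi z} := isOpen_lt continuous_const hmass
      refine (hopen.continuousOn_iff.1 ?_) hz'
      rw [continuousOn_iff_continuous_domRestrict]
      have : Set.domRestrict {z : Realization J | 0 < mass hi z} F
          = fun z => H (clamp (mass hi z.1), α (part hi hJ z.1 z.2)) := by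
        funext w
        exact dif_pos w.2
      rw [this]
      exact H.continuous.comp ((hclamp.comp (hmass.comp continuous_subtype_val)).prodMk
        (α.continuous.comp (continuous_part hi hJ hS)))
  refine ⟨⟨F, hFc⟩, fun z h hz => ?_⟩
  have : clamp (mass hi z) = 0 := Set.projIcc_of_le_left _ (by linarith)
  change F z = _
  simp only [F, dif_pos h]
  rw [this, H.apply_zero]
  rfl

/-- Compatibility of the parts of a point with simplicial maps. -/
lemma partVal_realize {a : SimplicialMap S S} {b : SimplicialMap J J}
    (hi : Function.Injective i) (hab : ∀ v, b.toFun (i v) = i (a.toFun v))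
    (hb : ∀ w, w ∉ Set.range i → b.toFun w ∉ Set.range i) (z : Realization J) :
    partVal hi (b.realize z) = (partVal hi z).mapDomain a.toFun := by
  let co : (W →₀ ℝ) →ₗ[ℝ] V →₀ ℝ := Finsupp.lcomapDomain i hi
  have key : co ∘ₗ Finsupp.lmapDomain ℝ ℝ b.toFun = Finsupp.lmapDomain ℝ ℝ a.toFun ∘ₗ co := by
    refine Finsupp.lhom_ext' fun w => LinearMap.ext_ring ?_
    ext u
    simp only [LinearMap.comp_apply, Finsupp.lsingle_apply, Finsupp.lmapDomain_apply,
      Finsupp.mapDomain_single]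
    by_cases hw : w ∈ Set.range i
    · obtain ⟨v, rfl⟩ := hw
      have e : ∀ v, co (Finsupp.single (i v) (1 : ℝ))
          = Finsupp.single v 1 := fun v => Finsupp.comapDomain_single _ _ _ _
      rw [hab, e, e, Finsupp.mapDomain_single]
    · have e : ∀ w, w ∉ Set.range i →
          co (Finsupp.single w (1 : ℝ)) = 0 := by
        intro w hw
        ext v
        exact Finsupp.single_eq_of_ne (a := w) (a' := i v) fun h => hw ⟨v, h⟩
      rw [e _ hw, e _ (hb _ hw), Finsupp.mapDomain_zero]
  exact LinearMap.congr_fun key z.1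

lemma mass_realize {a : SimplicialMap S S} {b : SimplicialMap J J}
    (hi : Function.Injective i) (hab : ∀ v, b.toFun (i v) = i (a.toFun v))
    (hb : ∀ w, w ∉ Set.range i → b.toFun w ∉ Set.range i) (z : Realization J) :
    mass hi (b.realize z) = mass hi z := by
  rw [mass, partVal_realize (a := a) hi hab hb,
    Finsupp.sum_mapDomain_index (fun _ => rfl) (fun _ _ _ => rfl)]
  rfl

lemma part_realize {a : SimplicialMap S S} {b : SimplicialMap J J}
    (hi : Function.Injective i) (hJ : IsTrace S J i)
    (hab : ∀ v, b.toFun (i v) = i (a.toFun v))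
    (hb : ∀ w, w ∉ Set.range i → b.toFun w ∉ Set.range i) (z : Realization J)
    (h : 0 < mass hi z) (h' : 0 < mass hi (b.realize z)) :
    part hi hJ (b.realize z) h' = a.realize (part hi hJ z h) := by
  refine Subtype.ext ?_
  change (mass hi (b.realize z))⁻¹ • partVal hi (b.realize z)
    = Finsupp.mapDomain a.toFun ((mass hi z)⁻¹ • partVal hi z)
  rw [mass_realize (a := a) hi hab hb, partVal_realize (a := a) hi hab hb,
    Finsupp.mapDomain_smul]

end Part

section JoinComplex

open scoped Classical

variable {V₁ V₂ : Type*}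

attribute [local instance] decidableEqSum

/-- The join of two complexes. -/
def joinComplex (S₁ : Complex V₁) (S₂ : Complex V₂) : Complex (V₁ ⊕ V₂) where
  faces := {s | s.Nonempty ∧ s.toLeft ∈ withEmpty S₁ ∧ s.toRight ∈ withEmpty S₂}
  isRelLowerSet_faces := fun _ ⟨hs, h₁, h₂⟩ => ⟨hs, fun _ hts ht => ⟨ht,
    withEmpty_subset _ h₁ _ (Finset.toLeft_monotone hts),
    withEmpty_subset _ h₂ _ (Finset.toRight_monotone hts)⟩⟩

variable {S₁ : Complex V₁} {S₂ : Complex V₂}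

lemma isTrace_inl : IsTrace S₁ (joinComplex S₁ S₂) Sum.inl := fun _ hs _ ht hts =>
  withEmpty_subset _ hs.2.1 _ (fun v hv => Finset.mem_toLeft.2 (hts v hv)) ht

lemma isTrace_inr : IsTrace S₂ (joinComplex S₁ S₂) Sum.inr := fun _ hs _ ht hts =>
  withEmpty_subset _ hs.2.2 _ (fun v hv => Finset.mem_toRight.2 (hts v hv)) ht

lemma mass_inl_add_mass_inr (z : Realization (joinComplex S₁ S₂)) :
    mass (Sum.inl_injective (β := V₂)) z + mass (Sum.inr_injective (α := V₁)) z = 1 := by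
  have hl : mass (Sum.inl_injective (β := V₂)) z = ∑ v ∈ z.1.support.toLeft, z.1 (Sum.inl v) :=
    Finsupp.sum_of_support_subset _ (fun v hv => Finset.mem_toLeft.2 (by
      rw [Finsupp.mem_support_iff] at hv ⊢
      exact hv)) _ fun _ _ => rfl
  have hr : mass (Sum.inr_injective (α := V₁)) z = ∑ v ∈ z.1.support.toRight, z.1 (Sum.inr v) :=
    Finsupp.sum_of_support_subset _ (fun v hv => Finset.mem_toRight.2 (by
      rw [Finsupp.mem_support_iff] at hv ⊢
      exact hv)) _ fun _ _ => rfl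
  rw [hl, hr, ← Finset.sum_disjSum _ _ fun v => z.1 v, Finset.toLeft_disjSum_toRight]
  exact z.sum_eq_one subset_rfl

/-- The left summand of a join. -/
def joinInl (S₁ : Complex V₁) (S₂ : Complex V₂) : SimplicialMap S₁ (joinComplex S₁ S₂) where
  toFun := Sum.inl
  image_mem s hs := by
    have h1 : (s.image (Sum.inl : V₁ → V₁ ⊕ V₂)).toLeft = s := by
      ext
      simp
    have h2 : (s.image (Sum.inl : V₁ → V₁ ⊕ V₂)).toRight = ∅ := by
      ext
      simp
    have hmem : s.image (Sum.inl : V₁ → V₁ ⊕ V₂) ∈ (joinComplex S₁ S₂).faces :=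
      ⟨(faces_nonempty hs).image _, by rw [h1]; exact mem_withEmpty hs,
        by rw [h2]; exact empty_mem_withEmpty S₂⟩
    convert hmem

/-- The right summand of a join. -/
def joinInr (S₁ : Complex V₁) (S₂ : Complex V₂) : SimplicialMap S₂ (joinComplex S₁ S₂) where
  toFun := Sum.inr
  image_mem s hs := by
    have h1 : (s.image (Sum.inr : V₂ → V₁ ⊕ V₂)).toRight = s := by
      ext
      simp
    have h2 : (s.image (Sum.inr : V₂ → V₁ ⊕ V₂)).toLeft = ∅ := by
      ext
      simp
    have hmem : s.image (Sum.inr : V₂ → V₁ ⊕ V₂) ∈ (joinComplex S₁ S₂).faces :=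
      ⟨(faces_nonempty hs).image _, by rw [h2]; exact empty_mem_withEmpty S₁,
        by rw [h1]; exact mem_withEmpty hs⟩
    convert hmem

/-- The join of two simplicial maps. -/
def joinMap (a₁ : SimplicialMap S₁ S₁) (a₂ : SimplicialMap S₂ S₂) :
    SimplicialMap (joinComplex S₁ S₂) (joinComplex S₁ S₂) where
  toFun := Sum.map a₁.toFun a₂.toFun
  image_mem s hs := by
    have hmem : s.image (Sum.map a₁.toFun a₂.toFun) ∈ (joinComplex S₁ S₂).faces := by
      refine ⟨hs.1.image _, fun hn => ?_, fun hn => ?_⟩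
      · rw [toLeft_image_sumMap] at hn ⊢
        exact a₁.image_mem' (hs.2.1 (Finset.image_nonempty.1 hn))
      · rw [toRight_image_sumMap] at hn ⊢
        exact a₂.image_mem' (hs.2.2 (Finset.image_nonempty.1 hn))
    convert hmem

lemma realize_comp {U V W : Type*} {K : Complex U} {L : Complex V} {M : Complex W}
    (f : SimplicialMap K L) (g : SimplicialMap L M) (x : Realization K) :
    (g.realize (f.realize x)).1 = x.1.mapDomain (g.toFun ∘ f.toFun) :=
  Finsupp.mapDomain_comp.symm

lemma joinMap_involutive {m₁ m₂ : ℕ} {a₁ : SimplicialMap S₁ S₁} {a₂ : SimplicialMap S₂ S₂}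
    (h₁ : IsEssentialCycle m₁ S₁ a₁) (h₂ : IsEssentialCycle m₂ S₂ a₂) :
    Function.Involutive (joinMap a₁ a₂).realize := by
  have := h₁.nonempty
  have := h₂.nonempty
  intro z
  refine Subtype.ext ((realize_comp _ _ z).trans ?_)
  refine Eq.trans (Finsupp.mapDomain_congr (g := id) ?_) Finsupp.mapDomain_id
  rintro (v | v) hv
  · have hv' := Finset.mem_toLeft.2 hv
    exact congrArg Sum.inl (h₁.involutive_vertex
      (singleton_mem_faces (z.support_mem.2.1 ⟨v, hv'⟩) hv'))
  · have hv' := Finset.mem_toRight.2 hv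
    exact congrArg Sum.inr (h₂.involutive_vertex
      (singleton_mem_faces (z.support_mem.2.2 ⟨v, hv'⟩) hv'))

end JoinComplex

section

attribute [local instance] decidableEqSum

open scoped Classical in
/-- The join of essential cycles for two contractible spaces. -/
theorem HasEssentialCycleIn.join {Y₁ Y₂ : Type*} [TopologicalSpace Y₁] [TopologicalSpace Y₂]
    [ContractibleSpace Y₁] [ContractibleSpace Y₂] {m₁ m₂ : ℕ} {F₁ : Set (Y₁ × Y₁)}
    {F₂ : Set (Y₂ × Y₂)} (h₁ : HasEssentialCycleIn m₁ Prod.swap F₁)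
    (h₂ : HasEssentialCycleIn m₂ Prod.swap F₂) :
    HasEssentialCycleIn (m₁ + m₂ + 1) (Prod.swap : (Y₁ × Y₂) × (Y₁ × Y₂) → _)
      {z | (z.1.1, z.2.1) ∈ F₁ ∨ (z.1.2, z.2.2) ∈ F₂} := by
  obtain ⟨V₁, S₁, a₁, hS₁, f₁, hf₁, hF₁⟩ := h₁
  obtain ⟨V₂, S₂, a₂, hS₂, f₂, hf₂, hF₂⟩ := h₂
  have hne₁ := hS₁.nonempty
  have hne₂ := hS₂.nonempty
  obtain ⟨c₁, hc₁⟩ := hS₁.exists_isOddCycle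
  obtain ⟨c₂, hc₂⟩ := hS₂.exists_isOddCycle
  have hG₁ := isFreeFamily_cellSets hS₁.involutive hS₁.free
  have hG₂ := isFreeFamily_cellSets hS₂.involutive hS₂.free
  have hG := isFreeFamily_joinFamily (m₁ := m₁) (m₂ := m₂) hG₁ hG₂
  have hc := hc₁.join hG₁ hG₂ hc₂
  -- the join of the odd cycles, consisting of simplices of points, is mapped to the join of the
  -- complexes
  let q : Realization S₁ ⊕ Realization S₂ → Realization (joinComplex S₁ S₂) :=
    Sum.elim (joinInl S₁ S₂).realize (joinInr S₁ S₂).realize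
  have hne : Nonempty (Realization (joinComplex S₁ S₂)) :=
    ⟨q (Sum.inl (Classical.arbitrary _))⟩
  have hb := joinMap_involutive hS₁ hS₂
  have hq : ∀ s ∈ joinFamily (cellSets S₁) (cellSets S₂) m₁ m₂,
      s.image q ∈ cellSets (joinComplex S₁ S₂) := by
    rintro s ⟨⟨⟨t₁, ht₁, hs₁⟩, -⟩, ⟨t₂, ht₂, hs₂⟩, -⟩
    refine ⟨t₁.disjSum t₂, ⟨?_, ?_, ?_⟩, fun x hx => ?_⟩
    · obtain ⟨v, hv⟩ := faces_nonempty ht₁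
      exact ⟨Sum.inl v, Finset.inl_mem_disjSum.2 hv⟩
    · rw [Finset.toLeft_disjSum]
      exact mem_withEmpty ht₁
    · rw [Finset.toRight_disjSum]
      exact mem_withEmpty ht₂
    · obtain ⟨x | x, hxs, rfl⟩ := Finset.mem_image.1 hx
      · intro w hw
        have := (joinInl S₁ S₂).support_realize_subset x (hs₁ x (Finset.mem_toLeft.2 hxs)) hw
        obtain ⟨v, hv, rfl⟩ := Finset.mem_image.1 this
        exact Finset.inl_mem_disjSum.2 hv
      · intro w hw
        have := (joinInr S₁ S₂).support_realize_subset x (hs₂ x (Finset.mem_toRight.2 hxs)) hw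
        obtain ⟨v, hv, rfl⟩ := Finset.mem_image.1 this
        exact Finset.inr_mem_disjSum.2 hv
  have hqA : ∀ x, q (Sum.map a₁.realize a₂.realize x) = (joinMap a₁ a₂).realize (q x) := by
    rintro (x | x)
    · refine Subtype.ext ((realize_comp a₁ (joinInl S₁ S₂) x).trans ?_)
      exact (realize_comp (joinInl S₁ S₂) (joinMap a₁ a₂) x).symm
    · refine Subtype.ext ((realize_comp a₂ (joinInr S₁ S₂) x).trans ?_)
      exact (realize_comp (joinInr S₁ S₂) (joinMap a₁ a₂) x).symm
  obtain ⟨f, hf, -⟩ := hc.exists_map hG hb.injective hq hqA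
  obtain ⟨E₁, hE₁⟩ := exists_extension Sum.inl_injective (isTrace_inl (S₁ := S₁) (S₂ := S₂))
    hS₁.finite (ContinuousMap.fst.comp f₁)
  obtain ⟨E₂, hE₂⟩ := exists_extension Sum.inr_injective (isTrace_inr (S₁ := S₁) (S₂ := S₂))
    hS₂.finite (ContinuousMap.fst.comp f₂)
  let b : C(Realization (joinComplex S₁ S₂), Realization (joinComplex S₁ S₂)) :=
    ⟨(joinMap a₁ a₂).realize, (joinMap a₁ a₂).continuous_realize⟩
  -- on the half of the join close to `S₁`, the pair `(E₁ z, E₁ (b z))` is the value of `f₁` at the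
  -- projection of `z`, since `f₁` is determined by its first component and equivariance
  let E := E₁.prodMk E₂
  refine ⟨_, _, _, isEssentialCycle_flagComplex hG hc, (E.prodMk (E.comp b)).comp f,
    fun x => ?_, fun x => ?_⟩
  · change (E (f _), E ((joinMap a₁ a₂).realize (f _)))
      = (E ((joinMap a₁ a₂).realize (f x)), E (f x))
    rw [hf, hb]
  · set z := f x
    change (E₁ z, E₁ ((joinMap a₁ a₂).realize z)) ∈ F₁ ∨ (E₂ z, E₂ ((joinMap a₁ a₂).realize z)) ∈ F₂
    have hl : ∀ w, w ∉ Set.range (Sum.inl : V₁ → V₁ ⊕ V₂) →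
        (joinMap a₁ a₂).toFun w ∉ Set.range Sum.inl := by
      rintro (w | w) hw
      · exact absurd ⟨w, rfl⟩ hw
      · rintro ⟨v, hv⟩
        exact Sum.inl_ne_inr hv
    have hr : ∀ w, w ∉ Set.range (Sum.inr : V₂ → V₁ ⊕ V₂) →
        (joinMap a₁ a₂).toFun w ∉ Set.range Sum.inr := by
      rintro (w | w) hw
      · rintro ⟨v, hv⟩
        exact Sum.inr_ne_inl hv
      · exact absurd ⟨w, rfl⟩ hw
    -- one of the two masses is at least `1/2`
    rcases le_total (1 / 2) (mass (Sum.inl_injective (β := V₂)) z) with h | h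
    · left
      have hz : 0 < mass (Sum.inl_injective (β := V₂)) z := by linarith
      have hm := mass_realize (a := a₁) (b := joinMap a₁ a₂) Sum.inl_injective (fun _ => rfl) hl z
      rw [hE₁ z hz h, hE₁ _ (hm ▸ hz) (hm ▸ h), part_realize (a := a₁) Sum.inl_injective
        isTrace_inl (fun _ => rfl) hl z hz (hm ▸ hz)]
      have := hF₁ (part Sum.inl_injective isTrace_inl z hz)
      simp only [ContinuousMap.comp_apply, hf₁]
      exact this
    · right
      have h' : 1 / 2 ≤ mass (Sum.inr_injective (α := V₁)) z := by
        linarith [mass_inl_add_mass_inr z]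
      have hz : 0 < mass (Sum.inr_injective (α := V₁)) z := by linarith
      have hm := mass_realize (a := a₂) (b := joinMap a₁ a₂) Sum.inr_injective (fun _ => rfl) hr z
      rw [hE₂ z hz h', hE₂ _ (hm ▸ hz) (hm ▸ h'), part_realize (a := a₂) Sum.inr_injective
        isTrace_inr (fun _ => rfl) hr z hz (hm ▸ hz)]
      have := hF₂ (part Sum.inr_injective isTrace_inr z hz)
      simp only [ContinuousMap.comp_apply, hf₂]
      exact this

end

/-! ### Transfer along equivariant maps -/

section Transfer

variable {Y Z Z₁ Z₂ : Type*} [TopologicalSpace Y] [TopologicalSpace Z] [TopologicalSpace Z₁]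
  [TopologicalSpace Z₂]

lemma HasEssentialCycleIn.comp {m : ℕ} {σ : Y → Y} {τ : Z → Z} {F : Set Y} {F' : Set Z}
    (h : HasEssentialCycleIn m σ F) (g : C(Y, Z)) (hg : ∀ y, g (σ y) = τ (g y))
    (hF : ∀ y ∈ F, g y ∈ F') : HasEssentialCycleIn m τ F' := by
  obtain ⟨V, S, a, hS, f, hf, hfF⟩ := h
  exact ⟨V, S, a, hS, g.comp f, fun x => by simp [hf, hg], fun x => hF _ (hfF x)⟩

lemma HasEssentialCycleIn.mono {m : ℕ} {σ : Y → Y} {F F' : Set Y}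
    (h : HasEssentialCycleIn m σ F) (hF : F ⊆ F') : HasEssentialCycleIn m σ F' :=
  h.comp (ContinuousMap.id Y) (fun _ => rfl) hF

/-- The covering theorem for essential cycles, pulled back from two equivariant maps. -/
lemma HasEssentialCycleIn.of_cover {p q : ℕ} (hp : 0 < p) (hq : 0 < q) {τ : Y → Y} {F : Set Y}
    (h : HasEssentialCycleIn (p + q) τ F) {σ₁ : Z₁ → Z₁} {σ₂ : Z₂ → Z₂} (g₁ : C(Y, Z₁))
    (g₂ : C(Y, Z₂)) (hg₁ : ∀ y, g₁ (τ y) = σ₁ (g₁ y)) (hg₂ : ∀ y, g₂ (τ y) = σ₂ (g₂ y))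
    {U₁ : Set Z₁} {U₂ : Set Z₂} (hU₁ : IsOpen U₁) (hU₂ : IsOpen U₂)
    (hσ : ∀ z, σ₁ z ∈ U₁ → z ∈ U₁) (hcov : ∀ y ∈ F, g₁ y ∈ U₁ ∨ g₂ y ∈ U₂) :
    HasEssentialCycleIn p σ₁ U₁ ∨ HasEssentialCycleIn q σ₂ U₂ := by
  obtain ⟨V, S, a, hS, f, hf, hfF⟩ := h
  have h₁ : ∀ x, (g₁.comp f) (a.realize x) = σ₁ ((g₁.comp f) x) := fun x => by simp [hf, hg₁]
  have h₂ : ∀ x, (g₂.comp f) (a.realize x) = σ₂ ((g₂.comp f) x) := fun x => by simp [hf, hg₂]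
  rcases hS.exists_of_cover hp hq (hU₁.preimage (g₁.comp f).continuous)
    (hU₂.preimage (g₂.comp f).continuous) (fun x hx => hσ _ (by rwa [← h₁]))
    (fun x => hcov _ (hfF x)) with h | h
  · exact Or.inl (h.comp (g₁.comp f) h₁ fun x hx => hx)
  · exact Or.inr (h.comp (g₂.comp f) h₂ fun x hx => hx)

end Transfer

/-! ### Products of metric proper obstructors -/

/-- The product of two metric proper obstructors. A cycle of dimension above `m₁ + m₂ + 1` of pairs
of distant points is covered by the two open sets of pairs that are distant in the first and in the
second coordinate. -/
theorem isMetricProperObstructor_prod {X₁ X₂ : Type*} [MetricSpace X₁] [MetricSpace X₂]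
    {m₁ m₂ : ℕ} (h₁ : IsMetricProperObstructor m₁ X₁) (h₂ : IsMetricProperObstructor m₂ X₂) :
    IsMetricProperObstructor (m₁ + m₂ + 1) (X₁ × X₂) := by
  have := h₁.1
  have := h₂.1
  refine ⟨inferInstance, fun r hr => ?_, fun k hk => ?_⟩
  · refine ((h₁.2.1 r hr).join (h₂.2.1 r hr)).mono ?_
    rintro z (hz | hz)
    · exact (show r ≤ dist z.1.1 z.2.1 from hz).trans (le_max_left _ _)
    · exact (show r ≤ dist z.1.2 z.2.2 from hz).trans (le_max_right _ _)
  by_contra! hlt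
  obtain ⟨q, rfl⟩ : ∃ q, k = (m₁ + 1) + q := ⟨k - (m₁ + 1), by omega⟩
  have hn₁ : ¬ ∀ r : ℝ, 0 < r → HasEssentialCycleIn (m₁ + 1) (Prod.swap : X₁ × X₁ → X₁ × X₁)
      {z | r ≤ dist z.1 z.2} := fun h => by
    have := h₁.2.2 h
    omega
  have hn₂ : ¬ ∀ r : ℝ, 0 < r → HasEssentialCycleIn q (Prod.swap : X₂ × X₂ → X₂ × X₂)
      {z | r ≤ dist z.1 z.2} := fun h => by
    have := h₂.2.2 h
    omega
  push Not at hn₁ hn₂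
  obtain ⟨r₁, hr₁, hn₁⟩ := hn₁
  obtain ⟨r₂, hr₂, hn₂⟩ := hn₂
  -- with strict inequalities the two sets are open
  have hcov : ∀ z ∈ {z : (X₁ × X₂) × (X₁ × X₂) | max r₁ r₂ + 1 ≤ dist z.1 z.2},
      (z.1.1, z.2.1) ∈ {z : X₁ × X₁ | r₁ < dist z.1 z.2} ∨
        (z.1.2, z.2.2) ∈ {z : X₂ × X₂ | r₂ < dist z.1 z.2} := by
    intro z hz
    have h1 : max r₁ r₂ + 1 ≤ max (dist z.1.1 z.2.1) (dist z.1.2 z.2.2) := hz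
    rcases le_max_iff.1 h1 with h2 | h2
    · exact Or.inl (show r₁ < dist z.1.1 z.2.1 by linarith [le_max_left r₁ r₂])
    · exact Or.inr (show r₂ < dist z.1.2 z.2.2 by linarith [le_max_right r₁ r₂])
  rcases (hk (max r₁ r₂ + 1) (by positivity)).of_cover (Nat.succ_pos m₁)
    (show 0 < q by omega)
    (σ₁ := (Prod.swap : X₁ × X₁ → X₁ × X₁)) (σ₂ := (Prod.swap : X₂ × X₂ → X₂ × X₂))
    ⟨fun z => (z.1.1, z.2.1), by fun_prop⟩ ⟨fun z => (z.1.2, z.2.2), by fun_prop⟩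
    (fun _ => rfl) (fun _ => rfl)
    (U₁ := {z | r₁ < dist z.1 z.2}) (U₂ := {z | r₂ < dist z.1 z.2})
    (isOpen_lt continuous_const continuous_dist) (isOpen_lt continuous_const continuous_dist)
    (fun z hz => by
      rw [Set.mem_ofPred_eq, dist_comm]
      exact hz) hcov with h | h
  · exact hn₁ (h.mono fun z (hz : r₁ < _) => hz.le)
  · exact hn₂ (h.mono fun z (hz : r₂ < _) => hz.le)

/-! ### Products of ordered complexes -/

section Product

open scoped Classical

variable {V W Z : Type*} [PartialOrder V] [PartialOrder W] {K : Complex V} {L : Complex W}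

lemma exists_greatest {s : Finset V} (hs : IsChain (· ≤ ·) (s : Set V)) (hn : s.Nonempty) :
    ∃ a ∈ s, ∀ b ∈ s, b ≤ a := by
  obtain ⟨a, ha⟩ := s.exists_maximal hn
  refine ⟨a, ha.1, fun b hb => ?_⟩
  rcases hs.total hb ha.1 with h | h
  · exact h
  · exact ha.2 hb h

/-- The total weight of a finitely supported function. -/
abbrev total {X : Type*} : (X →₀ ℝ) →ₗ[ℝ] ℝ := Finsupp.linearCombination ℝ fun _ => (1 : ℝ)

lemma total_eq {X : Type*} (f : X →₀ ℝ) : total f = f.sum fun _ t => t := by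
  simp [total, Finsupp.linearCombination_apply]

lemma total_eq_sum {X : Type*} (f : X →₀ ℝ) {s : Finset X} (hs : f.support ⊆ s) :
    total f = ∑ x ∈ s, f x :=
  (total_eq f).trans (Finsupp.sum_of_support_subset _ hs _ fun _ _ => rfl)

/-- Extending a monotone coupling by a top pair. -/
lemma isChain_insert_top {s : Finset V} {t : Finset W} {a : V} {b : W} (ha : ∀ v ∈ s, v ≤ a)
    (hb : ∀ w ∈ t, w ≤ b) {z : V × W →₀ ℝ} (hz : z.support ⊆ s ×ˢ t)
    (hc : IsChain (· ≤ ·) (z.support : Set (V × W))) (α : ℝ) :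
    IsChain (· ≤ ·) ((z + Finsupp.single (a, b) α).support : Set (V × W)) := by
  have hsub : ((z + Finsupp.single (a, b) α).support : Set (V × W)) ⊆
      insert (a, b) (z.support : Set (V × W)) := by
    intro p hp
    rcases Finset.mem_union.1 (Finsupp.support_add hp) with h | h
    · exact Or.inr h
    · exact Or.inl (Finset.mem_singleton.1 (Finsupp.support_single_subset h))
  refine (hc.insert fun p hp _ => Or.inr ?_).mono hsub
  have := Finset.mem_product.1 (hz hp)
  exact ⟨ha _ this.1, hb _ this.2⟩

lemma support_sub_single_subset {X : Type*} {f : X →₀ ℝ} {s : Finset X} {a : X}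
    (hf : f.support ⊆ s) (ha : a ∈ s) (α : ℝ) : (f - Finsupp.single a α).support ⊆ s := by
  intro v hv
  rcases Finset.mem_union.1 (Finsupp.support_sub hv) with h | h
  · exact hf h
  · rw [Finset.mem_singleton.1 (Finsupp.support_single_subset h)]
    exact ha

lemma support_sub_single_subset_erase {X : Type*} {f : X →₀ ℝ} {s : Finset X} {a : X}
    (hf : f.support ⊆ s) : (f - Finsupp.single a (f a)).support ⊆ s.erase a := by
  intro y hy
  rw [Finsupp.mem_support_iff, Finsupp.sub_apply] at hy
  have hya : y ≠ a := by
    rintro rfl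
    simp at hy
  rw [Finsupp.single_eq_of_ne hya, sub_zero] at hy
  exact Finset.mem_erase.2 ⟨hya, hf (Finsupp.mem_support_iff.2 hy)⟩

lemma eq_zero_of_total {X : Type*} {f : X →₀ ℝ} (hf : ∀ x, 0 ≤ f x) (h0 : total f = 0) :
    f = 0 := by
  rw [total_eq_sum f subset_rfl] at h0
  ext x
  by_cases hx : x ∈ f.support
  · exact (Finset.sum_eq_zero_iff_of_nonneg fun y _ => hf y).1 h0 x hx
  · exact Finsupp.notMem_support_iff.1 hx

lemma sub_single_nonneg {X : Type*} {f : X →₀ ℝ} (hf : ∀ v, 0 ≤ f v) {a : X} {α : ℝ}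
    (hα : α ≤ f a) (v : X) : 0 ≤ (f - Finsupp.single a α) v := by
  rw [Finsupp.sub_apply, Finsupp.single_apply]
  split_ifs with h
  · rw [← h]
    linarith
  · rw [sub_zero]
    exact hf v

/-- Two weights of the same total on chains are the marginals of a weight on a chain of pairs. -/
lemma exists_coupling : ∀ (n : ℕ) (s : Finset V) (t : Finset W), s.card + t.card = n →
    IsChain (· ≤ ·) (s : Set V) → IsChain (· ≤ ·) (t : Set W) →
    ∀ (f : V →₀ ℝ) (g : W →₀ ℝ), f.support ⊆ s → g.support ⊆ t → (∀ v, 0 ≤ f v) →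
      (∀ w, 0 ≤ g w) → total f = total g →
      ∃ z : V × W →₀ ℝ, (∀ p, 0 ≤ z p) ∧ z.support ⊆ s ×ˢ t ∧
        IsChain (· ≤ ·) (z.support : Set (V × W)) ∧ z.mapDomain Prod.fst = f ∧
          z.mapDomain Prod.snd = g := by
  intro n
  induction n with
  | zero =>
    intro s t hn _ _ f g hf hg _ _ _
    have hs : s = ∅ := Finset.card_eq_zero.1 (by omega)
    have ht : t = ∅ := Finset.card_eq_zero.1 (by omega)
    subst hs ht
    rw [Finset.subset_empty, Finsupp.support_eq_empty] at hf hg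
    exact ⟨0, fun _ => le_rfl, by simp, by simp, by simp [hf], by simp [hg]⟩
  | succ n ih =>
    intro s t hn hs ht f g hf hg hf0 hg0 hfg
    rcases s.eq_empty_or_nonempty with rfl | hsn
    · rw [Finset.subset_empty, Finsupp.support_eq_empty] at hf
      have hg' : g = 0 := eq_zero_of_total hg0 (by rw [← hfg, hf, map_zero])
      exact ⟨0, fun _ => le_rfl, by simp, by simp, by simp [hf], by simp [hg']⟩
    rcases t.eq_empty_or_nonempty with rfl | htn
    · rw [Finset.subset_empty, Finsupp.support_eq_empty] at hg
      have hf' : f = 0 := eq_zero_of_total hf0 (by rw [hfg, hg, map_zero])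
      exact ⟨0, fun _ => le_rfl, by simp, by simp, by simp [hf'], by simp [hg]⟩
    obtain ⟨a, ha, hamax⟩ := exists_greatest hs hsn
    obtain ⟨b, hb, hbmax⟩ := exists_greatest ht htn
    -- the smaller of the two top weights is put on the top pair, which exhausts one of them
    have step : ∀ (s' : Finset V) (t' : Finset W) (α : ℝ), s' ⊆ s → t' ⊆ t →
        s'.card + t'.card = n → 0 ≤ α → α ≤ f a → α ≤ g b →
        (f - Finsupp.single a α).support ⊆ s' → (g - Finsupp.single b α).support ⊆ t' →
        ∃ z : V × W →₀ ℝ, (∀ p, 0 ≤ z p) ∧ z.support ⊆ s ×ˢ t ∧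
          IsChain (· ≤ ·) (z.support : Set (V × W)) ∧ z.mapDomain Prod.fst = f ∧
            z.mapDomain Prod.snd = g := by
      intro s' t' α hs' ht' hc hα hαf hαg hfs hgt
      obtain ⟨z, hz0, hzs, hzc, hzf, hzg⟩ := ih s' t' hc
        (hs.mono (by exact_mod_cast hs')) (ht.mono (by exact_mod_cast ht')) _ _ hfs hgt
        (sub_single_nonneg hf0 hαf) (sub_single_nonneg hg0 hαg) (by
          rw [map_sub, map_sub, hfg]
          simp [total])
      have hzs' := hzs.trans (Finset.product_subset_product hs' ht')
      refine ⟨z + Finsupp.single (a, b) α, fun p => ?_, ?_,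
        isChain_insert_top hamax hbmax hzs' hzc α, ?_, ?_⟩
      · rw [Finsupp.add_apply, Finsupp.single_apply]
        split_ifs
        · exact add_nonneg (hz0 p) hα
        · rw [add_zero]
          exact hz0 p
      · refine Finsupp.support_add.trans (Finset.union_subset hzs' ?_)
        refine Finsupp.support_single_subset.trans (Finset.singleton_subset_iff.2 ?_)
        exact Finset.mem_product.2 ⟨ha, hb⟩
      · rw [Finsupp.mapDomain_add, hzf, Finsupp.mapDomain_single, sub_add_cancel]
      · rw [Finsupp.mapDomain_add, hzg, Finsupp.mapDomain_single, sub_add_cancel]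
    rcases le_total (f a) (g b) with h | h
    · refine step (s.erase a) t (f a) (Finset.erase_subset _ _) subset_rfl ?_ (hf0 a) le_rfl h
        (support_sub_single_subset_erase hf) (support_sub_single_subset hg hb _)
      have := Finset.card_erase_add_one ha
      omega
    · refine step s (t.erase b) (g b) subset_rfl (Finset.erase_subset _ _) ?_ (hg0 b) h le_rfl
        (support_sub_single_subset hf ha _) (support_sub_single_subset_erase hg)
      have := Finset.card_erase_add_one hb
      omega

/-- The projection of a product of complexes to the first factor. -/
def projFst (K : Complex V) (L : Complex W) : SimplicialMap (prod K L) K where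
  toFun := Prod.fst
  image_mem s hs := by convert hs.2.1

/-- The projection of a product of complexes to the second factor. -/
def projSnd (K : Complex V) (L : Complex W) : SimplicialMap (prod K L) L where
  toFun := Prod.snd
  image_mem s hs := by convert hs.2.2

/-- The weight below a pair of a weight on a chain of pairs is the smaller of the weights below its
two entries. -/
lemma sum_filter_le {z : V × W →₀ ℝ} (hz : ∀ p, 0 ≤ z p)
    (hc : IsChain (· ≤ ·) (z.support : Set (V × W))) (p : V × W) :
    ∑ q ∈ z.support.filter (fun q => q ≤ p), z q
      = min (∑ q ∈ z.support.filter (fun q => q.1 ≤ p.1), z q)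
        (∑ q ∈ z.support.filter (fun q => q.2 ≤ p.2), z q) := by
  have hle : ∀ q, q ≤ p ↔ q.1 ≤ p.1 ∧ q.2 ≤ p.2 := fun q => Iff.rfl
  by_cases h : ∀ q ∈ z.support, q.1 ≤ p.1 → q.2 ≤ p.2
  · have e1 : z.support.filter (fun q => q ≤ p) = z.support.filter (fun q => q.1 ≤ p.1) :=
      Finset.filter_congr fun q hq => ⟨fun hqp => hqp.1, fun hq1 => ⟨hq1, h q hq hq1⟩⟩
    rw [e1, min_eq_left]
    refine Finset.sum_le_sum_of_subset_of_nonneg (fun q hq => ?_) fun q _ _ => hz q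
    rw [Finset.mem_filter] at hq ⊢
    exact ⟨hq.1, h q hq.1 hq.2⟩
  · push Not at h
    obtain ⟨r, hr, hr1, hr2⟩ := h
    have h' : ∀ q ∈ z.support, q.2 ≤ p.2 → q.1 ≤ p.1 := by
      intro q hq hq2
      rcases hc.total hq hr with hqr | hqr
      · exact hqr.1.trans hr1
      · exact absurd (hqr.2.trans hq2) hr2
    have e1 : z.support.filter (fun q => q ≤ p) = z.support.filter (fun q => q.2 ≤ p.2) :=
      Finset.filter_congr fun q hq => ⟨fun hqp => hqp.2, fun hq2 => ⟨h' q hq hq2, hq2⟩⟩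
    rw [e1, min_eq_right]
    refine Finset.sum_le_sum_of_subset_of_nonneg (fun q hq => ?_) fun q _ _ => hz q
    rw [Finset.mem_filter] at hq ⊢
    exact ⟨hq.1, h' q hq.1 hq.2⟩

lemma sum_filter_comp {X Y : Type*} (z : X →₀ ℝ) (f : X → Y) (P : Y → Prop) :
    ∑ q ∈ z.support.filter (fun q => P (f q)), z q
      = Finsupp.linearCombination ℝ (fun y => if P y then (1 : ℝ) else 0) (z.mapDomain f) := by
  rw [Finsupp.linearCombination_mapDomain, Finsupp.linearCombination_apply, Finsupp.sum,
    Finset.sum_filter]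
  simp

/-- A point of the product is determined by its projections. -/
lemma eq_of_proj {z z' : Realization (prod K L)}
    (h₁ : (projFst K L).realize z = (projFst K L).realize z')
    (h₂ : (projSnd K L).realize z = (projSnd K L).realize z') : z = z' := by
  have e1 : z.1.mapDomain Prod.fst = z'.1.mapDomain Prod.fst := congrArg Subtype.val h₁
  have e2 : z.1.mapDomain Prod.snd = z'.1.mapDomain Prod.snd := congrArg Subtype.val h₂
  -- the weights below any pair agree, so a minimal pair where the weights differ cannot exist
  have hcum : ∀ p, ∑ q ∈ z.1.support.filter (fun q => q ≤ p), z.1 q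
      = ∑ q ∈ z'.1.support.filter (fun q => q ≤ p), z'.1 q := by
    intro p
    rw [sum_filter_le z.nonneg z.support_mem.1, sum_filter_le z'.nonneg z'.support_mem.1,
      sum_filter_comp z.1 Prod.fst (· ≤ p.1), sum_filter_comp z.1 Prod.snd (· ≤ p.2),
      sum_filter_comp z'.1 Prod.fst (· ≤ p.1), sum_filter_comp z'.1 Prod.snd (· ≤ p.2), e1, e2]
  have hlin : ∀ (y : V × W →₀ ℝ) p, ∑ q ∈ y.support.filter (fun q => q ≤ p), y q
      = Finsupp.linearCombination ℝ (fun q => if q ≤ p then (1 : ℝ) else 0) y := by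
    intro y p
    rw [Finsupp.linearCombination_apply, Finsupp.sum, Finset.sum_filter]
    simp
  refine Subtype.ext (sub_eq_zero.1 ?_)
  by_contra hne
  obtain ⟨p, hp⟩ := (z.1 - z'.1).support.exists_minimal (Finsupp.support_nonempty_iff.2 hne)
  have h0 : Finsupp.linearCombination ℝ (fun q => if q ≤ p then (1 : ℝ) else 0) (z.1 - z'.1)
      = 0 := by
    rw [map_sub, ← hlin, ← hlin, hcum, sub_self]
  rw [← hlin, Finset.sum_eq_single p] at h0
  · exact Finsupp.mem_support_iff.1 hp.1 h0
  · intro q hq hqp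
    obtain ⟨hq1, hq2⟩ := Finset.mem_filter.1 hq
    exact absurd (le_antisymm hq2 (hp.2 hq1 hq2)) hqp
  · intro h
    refine absurd ?_ h
    exact Finset.mem_filter.2 ⟨hp.1, le_refl p⟩

/-- The points of the product are the pairs of points of the factors. -/
lemma exists_pair (hK : IsOrdered K) (hL : IsOrdered L) (x : Realization K) (y : Realization L) :
    ∃ z : Realization (prod K L), (projFst K L).realize z = x ∧ (projSnd K L).realize z = y := by
  have tx : total x.1 = 1 := (total_eq_sum x.1 subset_rfl).trans (x.sum_eq_one subset_rfl)
  have ty : total y.1 = 1 := (total_eq_sum y.1 subset_rfl).trans (y.sum_eq_one subset_rfl)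
  obtain ⟨z, hz0, hzs, hzc, hzf, hzg⟩ := exists_coupling _ _ _ rfl (hK _ x.support_mem)
    (hL _ y.support_mem) x.1 y.1 subset_rfl subset_rfl x.nonneg y.nonneg (tx.trans ty.symm)
  have htot : (z.sum fun _ t => t) = 1 := by
    rw [← tx, ← hzf, total_eq, Finsupp.sum_mapDomain_index (fun _ => rfl) fun _ _ _ => rfl]
  have hn : z.support.Nonempty := by
    rw [Finsupp.support_nonempty_iff]
    rintro rfl
    simp at htot
  refine ⟨⟨z, hz0, htot, hzc, ?_, ?_⟩, Subtype.ext hzf, Subtype.ext hzg⟩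
  · refine faces_subset x.support_mem (fun v hv => ?_) (hn.image _)
    obtain ⟨p, hp, rfl⟩ := Finset.mem_image.1 hv
    exact (Finset.mem_product.1 (hzs hp)).1
  · refine faces_subset y.support_mem (fun v hv => ?_) (hn.image _)
    obtain ⟨p, hp, rfl⟩ := Finset.mem_image.1 hv
    exact (Finset.mem_product.1 (hzs hp)).2

end Product

section ProductTopology

open scoped Classical

variable {V W Z : Type*} [PartialOrder V] [PartialOrder W] {K : Complex V} {L : Complex W}

lemma support_realize {V W : Type*} {K : Complex V} {L : Complex W} (f : SimplicialMap K L)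
    (x : Realization K) : (f.realize x).1.support = x.1.support.image f.toFun := by
  refine Finset.Subset.antisymm (f.support_realize_subset x subset_rfl) fun w hw => ?_
  obtain ⟨v, hv, rfl⟩ := Finset.mem_image.1 hw
  rw [← Realization.pos_iff, f.realize_apply x subset_rfl]
  refine Finset.sum_pos' (fun u _ => ?_) ⟨v, hv, ?_⟩
  · split_ifs
    · exact x.nonneg u
    · exact le_rfl
  · rw [if_pos rfl]
    exact (x.pos_iff v).2 hv

/-- A function from a compact space to a product of complexes is continuous if its projections
are: only finitely many simplices matter, and a continuous injection of a finite complex is an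
embedding. -/
lemma continuous_of_proj [TopologicalSpace Z] [CompactSpace Z] {g : Z → Realization (prod K L)}
    (h₁ : Continuous fun z => (projFst K L).realize (g z))
    (h₂ : Continuous fun z => (projSnd K L).realize (g z)) : Continuous g := by
  have hΦ₁ := Realization.finite_supports h₁
  have hΦ₂ := Realization.finite_supports h₂
  set Φ₁ := Set.range fun z => ((projFst K L).realize (g z)).1.support
  set Φ₂ := Set.range fun z => ((projSnd K L).realize (g z)).1.support
  -- all values lie in the finite subcomplex `P`, whose realization is compact
  let P : Complex (V × W) :=
    { faces := {s | s ∈ (prod K L).faces ∧ ∃ t₁ ∈ Φ₁, ∃ t₂ ∈ Φ₂, s ⊆ t₁ ×ˢ t₂}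
      isRelLowerSet_faces := fun _ ⟨hs, t₁, ht₁, t₂, ht₂, hst⟩ =>
        ⟨faces_nonempty hs, fun _ hrs hr =>
          ⟨faces_subset hs hrs hr, t₁, ht₁, t₂, ht₂, Finset.Subset.trans hrs hst⟩⟩ }
  have hP : P.faces.Finite := by
    refine ((hΦ₁.prod hΦ₂).biUnion
      fun t _ => (t.1 ×ˢ t.2).powerset.finite_toSet).subset ?_
    rintro s ⟨-, t₁, ht₁, t₂, ht₂, hst⟩
    exact Set.mem_biUnion (x := (t₁, t₂)) ⟨ht₁, ht₂⟩
      (Finset.mem_coe.2 (Finset.mem_powerset.2 hst))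
  let j : SimplicialMap P (prod K L) := ⟨fun v => v, fun s hs => by
    have : s.image (fun v => v) ∈ (prod K L).faces := by
      rw [Finset.image_id']
      exact hs.1
    convert this⟩
  have hj : ∀ x, (j.realize x).1 = x.1 := fun x => Finsupp.mapDomain_id
  let g₀ : Z → Realization P := fun z => ⟨(g z).1, (g z).2.1, (g z).2.2.1, (g z).support_mem,
    _, ⟨z, rfl⟩, _, ⟨z, rfl⟩, by
      intro p hp
      rw [Finset.mem_product]
      dsimp only
      rw [support_realize, support_realize]
      exact ⟨Finset.mem_image_of_mem _ hp, Finset.mem_image_of_mem _ hp⟩⟩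
  have hjg : ∀ z, j.realize (g₀ z) = g z := fun z => Subtype.ext (hj _)
  have := Realization.compactSpace hP
  let ψ : Realization P → Realization K × Realization L := fun x =>
    ((projFst K L).realize (j.realize x), (projSnd K L).realize (j.realize x))
  have hψ : Topology.IsClosedEmbedding ψ := by
    refine Continuous.isClosedEmbedding ?_ fun x y hxy => ?_
    · exact ((projFst K L).continuous_realize.comp j.continuous_realize).prodMk
        ((projSnd K L).continuous_realize.comp j.continuous_realize)
    · have := eq_of_proj (Prod.ext_iff.1 hxy).1 (Prod.ext_iff.1 hxy).2
      exact Subtype.ext ((hj x).symm.trans ((congrArg Subtype.val this).trans (hj y)))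
  have hg₀ : Continuous g₀ := by
    rw [hψ.isInducing.continuous_iff]
    have : ψ ∘ g₀ = fun z => ((projFst K L).realize (g z), (projSnd K L).realize (g z)) := by
      funext z
      simp only [Function.comp_apply, ψ, hjg]
    rw [this]
    exact h₁.prodMk h₂
  have : g = fun z => j.realize (g₀ z) := funext fun z => (hjg z).symm
  rw [this]
  exact j.continuous_realize.comp hg₀

/-- Continuous maps from a compact space to the factors lift to the product of complexes. -/
lemma exists_pair_map [TopologicalSpace Z] [CompactSpace Z] (hK : IsOrdered K)
    (hL : IsOrdered L) (g₁ : C(Z, Realization K)) (g₂ : C(Z, Realization L)) :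
    ∃ g : C(Z, Realization (prod K L)), ∀ z, (projFst K L).realize (g z) = g₁ z ∧
      (projSnd K L).realize (g z) = g₂ z := by
  choose g hg using fun z => exists_pair hK hL (g₁ z) (g₂ z)
  refine ⟨⟨g, continuous_of_proj ?_ ?_⟩, hg⟩
  · simp only [hg]
    exact g₁.continuous
  · simp only [hg]
    exact g₂.continuous

/-- The product of two contractible ordered complexes is contractible. The homotopy is continuous
because it is so on each closed simplex, and the unit interval is locally compact. -/
theorem contractibleSpace_prod (hK : IsOrdered K) (hL : IsOrdered L)
    [ContractibleSpace (Realization K)] [ContractibleSpace (Realization L)] :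
    ContractibleSpace (Realization (prod K L)) := by
  obtain ⟨x₀, ⟨H⟩⟩ := id_nullhomotopic (Realization K)
  obtain ⟨y₀, ⟨H'⟩⟩ := id_nullhomotopic (Realization L)
  choose P hP₁ hP₂ using exists_pair hK hL
  let F : Realization (prod K L) → unitInterval → Realization (prod K L) := fun z t =>
    P (H (t, (projFst K L).realize z)) (H' (t, (projSnd K L).realize z))
  have hF : ∀ {Z : Type _} [TopologicalSpace Z] [CompactSpace Z] (z : Z → Realization (prod K L))
      (t : Z → unitInterval), Continuous z → Continuous t → Continuous fun w => F (z w) (t w) := by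
    intro Z _ _ z t hz ht
    refine continuous_of_proj ?_ ?_
    · simp only [F, hP₁]
      exact H.continuous.comp (ht.prodMk ((projFst K L).continuous_realize.comp hz))
    · simp only [F, hP₂]
      exact H'.continuous.comp (ht.prodMk ((projSnd K L).continuous_realize.comp hz))
  have hF' : ∀ z, Continuous (F z) := by
    intro z
    refine continuous_of_proj ?_ ?_
    · simp only [F, hP₁]
      exact H.continuous.comp (continuous_id.prodMk continuous_const)
    · simp only [F, hP₂]
      exact H'.continuous.comp (continuous_id.prodMk continuous_const)
  -- the weak topology of the product with the interval is avoided by currying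
  let C : Realization (prod K L) → C(unitInterval, Realization (prod K L)) := fun z =>
    ⟨F z, hF' z⟩
  have hC : Continuous C := by
    rw [Realization.continuous_dom_iff]
    intro s hs
    have := Realization.compactSpace_cell hs
    refine ContinuousMap.continuous_of_continuous_uncurry _ ?_
    exact hF (fun w : Cell (prod K L) s × unitInterval => w.1.1) (fun w => w.2)
      ((Realization.continuous_of_cell hs).comp continuous_fst) continuous_snd
  have hunc := ContinuousMap.continuous_uncurry_of_continuous ⟨C, hC⟩
  refine (contractible_iff_id_nullhomotopic _).2 ⟨P x₀ y₀, ⟨⟨⟨fun w => F w.2 w.1,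
    hunc.comp continuous_swap⟩, fun z => ?_, fun z => ?_⟩⟩⟩
  · refine eq_of_proj ?_ ?_
    · exact (hP₁ _ _).trans (H.apply_zero _)
    · exact (hP₂ _ _).trans (H'.apply_zero _)
  · change P (H (1, _)) (H' (1, _)) = P x₀ y₀
    rw [H.apply_one, H'.apply_one]
    rfl

end ProductTopology

/-! ### Tubular neighborhoods -/

section Tubular

open scoped Classical

variable {V W : Type*} {K L : Complex V} {K' L' : Complex W}

lemma starNbhd_subset {s : Finset V} (hs : s ∈ (starNbhd K L).faces) : s ∈ K.faces := by
  obtain ⟨hn, t, ht, hst, -⟩ := hs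
  exact faces_subset ht hst hn

lemma tubularNbhd_succ (r : ℕ) : tubularNbhd K L (r + 1) = starNbhd K (tubularNbhd K L r) :=
  Function.iterate_succ_apply' _ _ _

lemma tubularNbhd_subset (hL : ∀ s ∈ L.faces, s ∈ K.faces) (r : ℕ) {s : Finset V}
    (hs : s ∈ (tubularNbhd K L r).faces) : s ∈ K.faces := by
  cases r with
  | zero => exact hL s hs
  | succ r =>
    rw [tubularNbhd_succ] at hs
    exact starNbhd_subset hs

/-- Simplicial maps respect tubular neighborhoods. -/
lemma image_mem_tubularNbhd [DecidableEq W] (f : SimplicialMap K K')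
    (hf : ∀ s ∈ L.faces, s.image f.toFun ∈ L'.faces) (r : ℕ) :
    ∀ s ∈ (tubularNbhd K L r).faces, s.image f.toFun ∈ (tubularNbhd K' L' r).faces := by
  induction r with
  | zero => exact hf
  | succ r ih =>
    intro s hs
    rw [tubularNbhd_succ] at hs ⊢
    obtain ⟨hn, t, ht, hst, v, hv, hvL⟩ := hs
    refine ⟨hn.image _, _, f.image_mem' ht, Finset.image_subset_image hst, f.toFun v,
      Finset.mem_image_of_mem _ hv, ?_⟩
    have := ih _ hvL
    rwa [Finset.image_singleton] at this

lemma realize_mem_tubularNbhd [DecidableEq W] (f : SimplicialMap K K')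
    (hf : ∀ s ∈ L.faces, s.image f.toFun ∈ L'.faces) (r : ℕ) {x : Realization K}
    (hx : x ∈ underlyingSet K (tubularNbhd K L r)) :
    f.realize x ∈ underlyingSet K' (tubularNbhd K' L' r) := by
  change (f.realize x).1.support ∈ (tubularNbhd K' L' r).faces
  rw [support_realize]
  convert image_mem_tubularNbhd f hf r _ hx

/-- Subcomplexes are closed. -/
lemma isClosed_underlyingSet : IsClosed (underlyingSet K L) := by
  rw [Realization.isClosed_iff]
  intro s _
  -- in a closed simplex, a subcomplex is a finite union of closed faces
  have h : {x : Cell K s | x.1 ∈ underlyingSet K L}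
      = ⋃ t ∈ {t | t ∈ s.powerset ∧ t ∈ L.faces}, {x : Cell K s | x.1.1.support ⊆ t} := by
    ext x
    simp only [Set.mem_iUnion, Set.mem_ofPred_eq, exists_prop]
    constructor
    · intro hx
      exact ⟨x.1.1.support, ⟨Finset.mem_powerset.2 x.2, hx⟩, subset_rfl⟩
    · rintro ⟨t, ⟨-, ht⟩, hxt⟩
      exact faces_subset ht hxt (faces_nonempty x.1.support_mem)
  rw [h]
  refine Set.Finite.isClosed_biUnion
    ((s.powerset.finite_toSet).subset fun t ht => Finset.mem_coe.2 ht.1) fun t _ => ?_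
  have h2 : {x : Cell K s | x.1.1.support ⊆ t}
      = ⋂ v ∈ {v | v ∉ t}, {x : Cell K s | x.1.1 v = 0} := by
    ext x
    simp only [Set.mem_iInter, Set.mem_ofPred_eq]
    constructor
    · intro hx v hv
      by_contra h0
      exact hv (hx (Finsupp.mem_support_iff.2 h0))
    · intro hx v hv
      by_contra h0
      exact Finsupp.mem_support_iff.1 hv (hx v h0)
  rw [h2]
  exact isClosed_biInter fun v _ =>
    isClosed_eq (Realization.continuous_cell_coord s v) continuous_const

/-- A point of a subcomplex is in the interior of its star neighborhood. -/
lemma closure_compl_starNbhd_subset :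
    closure (underlyingSet K (starNbhd K L))ᶜ ⊆ (underlyingSet K L)ᶜ := by
  intro x hx hxL
  obtain ⟨v, hv⟩ := x.exists_pos
  have hvx := (x.pos_iff v).1 hv
  have hsub : (underlyingSet K (starNbhd K L))ᶜ ⊆ {y : Realization K | 0 < y.1 v}ᶜ := by
    intro y hy hyv
    refine hy ⟨faces_nonempty y.support_mem, _, y.support_mem, subset_rfl, v,
      (y.pos_iff v).1 hyv, ?_⟩
    exact singleton_mem_faces (K := L) hxL hvx
  have hcl : IsClosed {y : Realization K | 0 < y.1 v}ᶜ :=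
    (isOpen_lt continuous_const (Realization.continuous_coord v)).isClosed_compl
  exact closure_minimal hsub hcl hx hv

lemma mem_starNbhd_of_edge [DecidableEq V] {u v : V} (h : {u, v} ∈ K.faces) (hv : {v} ∈ L.faces) :
    {u} ∈ (starNbhd K L).faces :=
  ⟨Finset.singleton_nonempty u, _, h, by simp, v, by simp, hv⟩

lemma exists_edge [DecidableEq V] {u : V} (h : {u} ∈ (starNbhd K L).faces) :
    ∃ v, {u, v} ∈ K.faces ∧ {v} ∈ L.faces := by
  obtain ⟨-, t, ht, hut, v, hv, hvL⟩ := h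
  refine ⟨v, faces_subset ht ?_ (Finset.insert_nonempty _ _), hvL⟩
  intro w hw
  rcases Finset.mem_insert.1 hw with rfl | hw
  · exact hut (Finset.mem_singleton_self w)
  · rwa [Finset.mem_singleton.1 hw]

end Tubular

section TubularProduct

open scoped Classical

variable {V₁ V₂ : Type*} [PartialOrder V₁] [PartialOrder V₂] {X₁ : Complex V₁} {X₂ : Complex V₂}

lemma mem_prod_iff {V W : Type*} [PartialOrder V] [PartialOrder W] [DecidableEq V]
    [DecidableEq W] {K : Complex V} {L : Complex W} {s : Finset (V × W)} :
    s ∈ (prod K L).faces ↔ IsChain (· ≤ ·) (s : Set (V × W)) ∧ s.image Prod.fst ∈ K.faces ∧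
      s.image Prod.snd ∈ L.faces := by
  constructor
  · rintro ⟨h, h1, h2⟩
    refine ⟨h, ?_, ?_⟩
    · convert h1
    · convert h2
  · rintro ⟨h, h1, h2⟩
    refine ⟨h, ?_, ?_⟩
    · convert h1
    · convert h2

lemma isChain_image {P Q : Type*} [PartialOrder P] [PartialOrder Q] [DecidableEq Q]
    {s : Finset P} (hs : IsChain (· ≤ ·) (s : Set P)) {f : P → Q} (hf : Monotone f) :
    IsChain (· ≤ ·) ((s.image f : Finset Q) : Set Q) := by
  rw [Finset.coe_image]
  rintro _ ⟨x, hx, rfl⟩ _ ⟨y, hy, rfl⟩ _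
  rcases hs.total hx hy with h | h
  · exact Or.inl (hf h)
  · exact Or.inr (hf h)

/-- The projection of the square of a product to the square of the first factor. -/
def squareFst (X₁ : Complex V₁) (X₂ : Complex V₂) :
    SimplicialMap (prod (prod X₁ X₂) (prod X₁ X₂)) (prod X₁ X₁) where
  toFun p := (p.1.1, p.2.1)
  image_mem s hs := by
    obtain ⟨hc, h1, h2⟩ := mem_prod_iff.1 hs
    have hmem : (s.image fun p => (p.1.1, p.2.1)) ∈ (prod X₁ X₁).faces := by
      refine mem_prod_iff.2 ⟨isChain_image hc fun p q h => ⟨h.1.1, h.2.1⟩, ?_, ?_⟩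
      · have := (mem_prod_iff.1 h1).2.1
        rw [Finset.image_image] at this ⊢
        exact this
      · have := (mem_prod_iff.1 h2).2.1
        rw [Finset.image_image] at this ⊢
        exact this
    convert hmem

/-- The projection of the square of a product to the square of the second factor. -/
def squareSnd (X₁ : Complex V₁) (X₂ : Complex V₂) :
    SimplicialMap (prod (prod X₁ X₂) (prod X₁ X₂)) (prod X₂ X₂) where
  toFun p := (p.1.2, p.2.2)
  image_mem s hs := by
    obtain ⟨hc, h1, h2⟩ := mem_prod_iff.1 hs
    have hmem : (s.image fun p => (p.1.2, p.2.2)) ∈ (prod X₂ X₂).faces := by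
      refine mem_prod_iff.2 ⟨isChain_image hc fun p q h => ⟨h.1.2, h.2.2⟩, ?_, ?_⟩
      · have := (mem_prod_iff.1 h1).2.2
        rw [Finset.image_image] at this ⊢
        exact this
      · have := (mem_prod_iff.1 h2).2.2
        rw [Finset.image_image] at this ⊢
        exact this
    convert hmem

lemma squareFst_diagonal : ∀ s ∈ (diagonal (prod X₁ X₂)).faces,
    s.image (squareFst X₁ X₂).toFun ∈ (diagonal X₁).faces := by
  intro s hs
  refine ⟨(squareFst X₁ X₂).image_mem' hs.1, fun z hz => ?_⟩
  obtain ⟨p, hp, rfl⟩ := Finset.mem_image.1 hz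
  exact congrArg Prod.fst (hs.2 p hp)

lemma squareSnd_diagonal : ∀ s ∈ (diagonal (prod X₁ X₂)).faces,
    s.image (squareSnd X₁ X₂).toFun ∈ (diagonal X₂).faces := by
  intro s hs
  refine ⟨(squareSnd X₁ X₂).image_mem' hs.1, fun z hz => ?_⟩
  obtain ⟨p, hp, rfl⟩ := Finset.mem_image.1 hz
  exact congrArg Prod.snd (hs.2 p hp)

lemma swap_diagonal : ∀ s ∈ (diagonal X₁).faces,
    s.image (swap X₁).toFun ∈ (diagonal X₁).faces := by
  intro s hs
  refine ⟨(swap X₁).image_mem' hs.1, fun z hz => ?_⟩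
  obtain ⟨p, hp, rfl⟩ := Finset.mem_image.1 hz
  exact (hs.2 p hp).symm

/-- The vertex of the square of a product with given projections. -/
def shuffle (x : V₁ × V₁) (y : V₂ × V₂) : (V₁ × V₂) × (V₁ × V₂) := ((x.1, y.1), (x.2, y.2))

lemma image_shuffle_left_mem {s : Finset (V₁ × V₁)} (hs : s ∈ (prod X₁ X₁).faces)
    {y : V₂ × V₂} (hy : {y} ∈ (prod X₂ X₂).faces) :
    (s.image fun x => shuffle x y) ∈ (prod (prod X₁ X₂) (prod X₁ X₂)).faces := by
  obtain ⟨hc, h1, h2⟩ := mem_prod_iff.1 hs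
  obtain ⟨-, hy1, hy2⟩ := mem_prod_iff.1 hy
  have hn := faces_nonempty hs
  rw [Finset.image_singleton] at hy1 hy2
  refine mem_prod_iff.2 ⟨isChain_image hc fun p q h => ⟨⟨h.1, le_rfl⟩, ⟨h.2, le_rfl⟩⟩,
    mem_prod_iff.2 ⟨?_, ?_, ?_⟩, mem_prod_iff.2 ⟨?_, ?_, ?_⟩⟩
  · rw [Finset.image_image]
    exact isChain_image hc fun p q h => ⟨h.1, le_rfl⟩
  · rw [Finset.image_image, Finset.image_image]
    exact h1
  · rw [Finset.image_image, Finset.image_image]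
    convert hy1
    exact Finset.image_const hn y.1
  · rw [Finset.image_image]
    exact isChain_image hc fun p q h => ⟨h.2, le_rfl⟩
  · rw [Finset.image_image, Finset.image_image]
    exact h2
  · rw [Finset.image_image, Finset.image_image]
    convert hy2
    exact Finset.image_const hn y.2

lemma image_shuffle_right_mem {s : Finset (V₂ × V₂)} (hs : s ∈ (prod X₂ X₂).faces)
    {x : V₁ × V₁} (hx : {x} ∈ (prod X₁ X₁).faces) :
    (s.image fun y => shuffle x y) ∈ (prod (prod X₁ X₂) (prod X₁ X₂)).faces := by
  obtain ⟨hc, h1, h2⟩ := mem_prod_iff.1 hs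
  obtain ⟨-, hx1, hx2⟩ := mem_prod_iff.1 hx
  have hn := faces_nonempty hs
  rw [Finset.image_singleton] at hx1 hx2
  refine mem_prod_iff.2 ⟨isChain_image hc fun p q h => ⟨⟨le_rfl, h.1⟩, ⟨le_rfl, h.2⟩⟩,
    mem_prod_iff.2 ⟨?_, ?_, ?_⟩, mem_prod_iff.2 ⟨?_, ?_, ?_⟩⟩
  · rw [Finset.image_image]
    exact isChain_image hc fun p q h => ⟨le_rfl, h.1⟩
  · rw [Finset.image_image, Finset.image_image]
    convert hx1
    exact Finset.image_const hn x.1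
  · rw [Finset.image_image, Finset.image_image]
    exact h1
  · rw [Finset.image_image]
    exact isChain_image hc fun p q h => ⟨le_rfl, h.2⟩
  · rw [Finset.image_image, Finset.image_image]
    convert hx2
    exact Finset.image_const hn x.2
  · rw [Finset.image_image, Finset.image_image]
    exact h2

/-- Paths of vertices to the diagonals of the factors combine to a path to the diagonal of the
product. -/
lemma shuffle_mem_tubularNbhd (r₁ : ℕ) : ∀ (r₂ : ℕ) (x : V₁ × V₁) (y : V₂ × V₂),
    {x} ∈ (tubularNbhd (prod X₁ X₁) (diagonal X₁) r₁).faces →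
    {y} ∈ (tubularNbhd (prod X₂ X₂) (diagonal X₂) r₂).faces →
    {shuffle x y} ∈ (tubularNbhd (prod (prod X₁ X₂) (prod X₁ X₂)) (diagonal (prod X₁ X₂))
      (r₁ + r₂)).faces := by
  induction r₁ with
  | zero =>
    intro r₂
    induction r₂ with
    | zero =>
      intro x y hx hy
      have := image_shuffle_left_mem hx.1 hy.1
      rw [Finset.image_singleton] at this
      refine ⟨this, fun z hz => ?_⟩
      rw [Finset.mem_singleton.1 hz]
      exact Prod.ext (hx.2 x (Finset.mem_singleton_self x)) (hy.2 y (Finset.mem_singleton_self y))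
    | succ r₂ ih =>
      intro x y hx hy
      rw [tubularNbhd_succ] at hy
      obtain ⟨u, hu, huL⟩ := exists_edge hy
      have hedge := image_shuffle_right_mem hu hx.1
      rw [Finset.image_insert, Finset.image_singleton] at hedge
      rw [← Nat.add_assoc, tubularNbhd_succ]
      exact mem_starNbhd_of_edge hedge (ih x u hx huL)
  | succ r₁ ih =>
    intro r₂ x y hx hy
    rw [tubularNbhd_succ] at hx
    -- a step in one factor, with the other factor kept fixed, is a step in the product
    obtain ⟨u, hu, huL⟩ := exists_edge hx
    have hedge := image_shuffle_left_mem hu (tubularNbhd_subset (K := prod X₂ X₂)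
      (L := diagonal X₂) (fun s hs => hs.1) r₂ hy)
    rw [Finset.image_insert, Finset.image_singleton] at hedge
    rw [Nat.add_right_comm, tubularNbhd_succ]
    exact mem_starNbhd_of_edge hedge (ih r₂ u y huL hy)

/-- A point of the square of the product is near the diagonal if both of its projections are. -/
lemma mem_tubularNbhd_of_square {r₁ r₂ : ℕ}
    {z : Realization (prod (prod X₁ X₂) (prod X₁ X₂))}
    (h₁ : (squareFst X₁ X₂).realize z ∈
      underlyingSet (prod X₁ X₁) (tubularNbhd (prod X₁ X₁) (diagonal X₁) r₁))
    (h₂ : (squareSnd X₁ X₂).realize z ∈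
      underlyingSet (prod X₂ X₂) (tubularNbhd (prod X₂ X₂) (diagonal X₂) r₂)) :
    z ∈ underlyingSet _ (tubularNbhd (prod (prod X₁ X₂) (prod X₁ X₂)) (diagonal (prod X₁ X₂))
      (r₁ + r₂ + 1)) := by
  change ((squareFst X₁ X₂).realize z).1.support ∈
    (tubularNbhd (prod X₁ X₁) (diagonal X₁) r₁).faces at h₁
  change ((squareSnd X₁ X₂).realize z).1.support ∈
    (tubularNbhd (prod X₂ X₂) (diagonal X₂) r₂).faces at h₂
  rw [support_realize] at h₁ h₂
  obtain ⟨p, hp⟩ := faces_nonempty z.support_mem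
  change z.1.support ∈ (tubularNbhd (prod (prod X₁ X₂) (prod X₁ X₂)) (diagonal (prod X₁ X₂))
    (r₁ + r₂ + 1)).faces
  rw [tubularNbhd_succ]
  refine ⟨⟨p, hp⟩, _, z.support_mem, subset_rfl, p, hp, ?_⟩
  exact shuffle_mem_tubularNbhd r₁ r₂ (p.1.1, p.2.1) (p.1.2, p.2.2)
    (singleton_mem_faces h₁ (by convert Finset.mem_image_of_mem (squareFst X₁ X₂).toFun hp <;> rfl))
    (singleton_mem_faces h₂ (by convert Finset.mem_image_of_mem (squareSnd X₁ X₂).toFun hp <;> rfl))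

lemma compl_subset_farSet (r : ℕ) :
    (underlyingSet (prod X₁ X₁) (tubularNbhd (prod X₁ X₁) (diagonal X₁) r))ᶜ ⊆ farSet X₁ r :=
  subset_closure

lemma farSet_succ_subset (r : ℕ) :
    farSet X₁ (r + 1) ⊆
      (underlyingSet (prod X₁ X₁) (tubularNbhd (prod X₁ X₁) (diagonal X₁) r))ᶜ := by
  rw [farSet, tubularNbhd_succ]
  exact closure_compl_starNbhd_subset

end TubularProduct

/-! ### Products of proper obstructors -/

section ProductObstructor

open scoped Classical

variable {V₁ V₂ : Type*} [PartialOrder V₁] [PartialOrder V₂] {X₁ : Complex V₁} {X₂ : Complex V₂}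

lemma isOrdered_prod (X₁ : Complex V₁) (X₂ : Complex V₂) : IsOrdered (prod X₁ X₂) :=
  fun _ hs => hs.1

lemma realize_comm {U V V' W : Type*} {K : Complex U} {L : Complex V} {L' : Complex V'}
    {M : Complex W} {f : SimplicialMap K L} {g : SimplicialMap L M} {f' : SimplicialMap K L'}
    {g' : SimplicialMap L' M} (h : ∀ v, g.toFun (f.toFun v) = g'.toFun (f'.toFun v))
    (x : Realization K) : g.realize (f.realize x) = g'.realize (f'.realize x) := by
  refine Subtype.ext ((realize_comp f g x).trans (Eq.trans ?_ (realize_comp f' g' x).symm))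
  exact Finsupp.mapDomain_congr fun v _ => h v

lemma projFst_swap (z : Realization (prod X₁ X₁)) :
    (projFst X₁ X₁).realize ((swap X₁).realize z) = (projSnd X₁ X₁).realize z :=
  Subtype.ext (realize_comp (swap X₁) (projFst X₁ X₁) z)

lemma projSnd_swap (z : Realization (prod X₁ X₁)) :
    (projSnd X₁ X₁).realize ((swap X₁).realize z) = (projFst X₁ X₁).realize z :=
  Subtype.ext (realize_comp (swap X₁) (projSnd X₁ X₁) z)

/-- The pairs of points of `|T|` that are not in the `r`-tubular neighborhood of the diagonal, as a
subset of `|T| × |T|`. -/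
def farPairs (T : Complex V₁) (r : ℕ) : Set (Realization T × Realization T) :=
  {w | ∀ z : Realization (prod T T), (projFst T T).realize z = w.1 → (projSnd T T).realize z = w.2 →
    z ∉ underlyingSet (prod T T) (tubularNbhd (prod T T) (diagonal T) r)}

lemma hasEssentialCycleIn_farPairs {m r : ℕ}
    (h : HasEssentialCycleIn m (swap X₁).realize (farSet X₁ (r + 1))) :
    HasEssentialCycleIn m Prod.swap (farPairs X₁ r) := by
  refine h.comp ⟨fun z => ((projFst X₁ X₁).realize z, (projSnd X₁ X₁).realize z),
    (projFst X₁ X₁).continuous_realize.prodMk (projSnd X₁ X₁).continuous_realize⟩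
    (fun z => Prod.ext (projFst_swap z) (projSnd_swap z)) fun y hy z h₁ h₂ => ?_
  rw [eq_of_proj h₁ h₂]
  exact farSet_succ_subset r hy

/-- An equivariant map to pairs of points of the product, given by its coordinates, lifts to the
square of the product complex. -/
lemma hasEssentialCycleIn_prod (hX₁ : IsOrdered X₁) (hX₂ : IsOrdered X₂) {m r : ℕ}
    (h : HasEssentialCycleIn m
      (Prod.swap : (Realization X₁ × Realization X₂) × (Realization X₁ × Realization X₂) → _)
      {z | (z.1.1, z.2.1) ∈ farPairs X₁ r ∨ (z.1.2, z.2.2) ∈ farPairs X₂ r}) :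
    HasEssentialCycleIn m (swap (prod X₁ X₂)).realize (farSet (prod X₁ X₂) r) := by
  obtain ⟨V, S, a, hS, f, hf, hfF⟩ := h
  have := Realization.compactSpace hS.finite
  -- the two components of `f` lift to the product complex, and the pair of lifts to its square
  obtain ⟨u, hu⟩ := exists_pair_map hX₁ hX₂ ((ContinuousMap.fst.comp ContinuousMap.fst).comp f)
    ((ContinuousMap.snd.comp ContinuousMap.fst).comp f)
  obtain ⟨w, hw⟩ := exists_pair_map hX₁ hX₂ ((ContinuousMap.fst.comp ContinuousMap.snd).comp f)
    ((ContinuousMap.snd.comp ContinuousMap.snd).comp f)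
  obtain ⟨g, hg⟩ := exists_pair_map (isOrdered_prod X₁ X₂) (isOrdered_prod X₁ X₂) u w
  have huw : ∀ x, u (a.realize x) = w x := fun x => eq_of_proj
    (by rw [(hu _).1, (hw _).1]; simp [hf]) (by rw [(hu _).2, (hw _).2]; simp [hf])
  have hwu : ∀ x, w (a.realize x) = u x := fun x => eq_of_proj
    (by rw [(hu _).1, (hw _).1]; simp [hf]) (by rw [(hu _).2, (hw _).2]; simp [hf])
  refine ⟨V, S, a, hS, g, fun x => eq_of_proj ?_ ?_, fun x => compl_subset_farSet r fun hx => ?_⟩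
  · rw [projFst_swap, (hg _).1, (hg _).2, huw]
  · rw [projSnd_swap, (hg _).1, (hg _).2, hwu]
  · rcases hfF x with h | h
    · refine h ((squareFst X₁ X₂).realize (g x)) ?_ ?_
        (realize_mem_tubularNbhd _ squareFst_diagonal r hx)
      · exact (realize_comm (by exact fun _ => rfl) (g x)).trans
          ((congrArg (projFst X₁ X₂).realize (hg x).1).trans (hu x).1)
      · exact (realize_comm (by exact fun _ => rfl) (g x)).trans
          ((congrArg (projFst X₁ X₂).realize (hg x).2).trans (hw x).1)
    · refine h ((squareSnd X₁ X₂).realize (g x)) ?_ ?_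
        (realize_mem_tubularNbhd _ squareSnd_diagonal r hx)
      · exact (realize_comm (by exact fun _ => rfl) (g x)).trans
          ((congrArg (projSnd X₁ X₂).realize (hg x).1).trans (hu x).2)
      · exact (realize_comm (by exact fun _ => rfl) (g x)).trans
          ((congrArg (projSnd X₁ X₂).realize (hg x).2).trans (hw x).2)

/-- The product of two proper obstructors. A cycle of dimension above `m₁ + m₂ + 1` away from the
diagonal is covered by the two open sets where its first and its second projection is away from
the diagonal, so that it yields a cycle of dimension above `m₁` or above `m₂`. -/
theorem isProperObstructor_prod {m₁ m₂ : ℕ} (hX₁ : IsOrdered X₁) (hX₂ : IsOrdered X₂)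
    (h₁ : IsProperObstructor m₁ X₁) (h₂ : IsProperObstructor m₂ X₂) :
    IsProperObstructor (m₁ + m₂ + 1) (prod X₁ X₂) := by
  have := h₁.1
  have := h₂.1
  refine ⟨contractibleSpace_prod hX₁ hX₂, fun r _ => ?_, fun k hk => ?_⟩
  · exact hasEssentialCycleIn_prod hX₁ hX₂
      ((hasEssentialCycleIn_farPairs (h₁.2.1 (r + 1) r.succ_pos)).join
        (hasEssentialCycleIn_farPairs (h₂.2.1 (r + 1) r.succ_pos)))
  by_contra hlt
  obtain ⟨q, rfl⟩ : ∃ q, k = (m₁ + 1) + q := ⟨k - (m₁ + 1), by omega⟩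
  have hn₁ : ¬ ∀ r : ℕ, 0 < r →
      HasEssentialCycleIn (m₁ + 1) (swap X₁).realize (farSet X₁ r) := fun h => by
    have := h₁.2.2 h
    omega
  have hn₂ : ¬ ∀ r : ℕ, 0 < r →
      HasEssentialCycleIn q (swap X₂).realize (farSet X₂ r) := fun h => by
    have := h₂.2.2 h
    omega
  push Not at hn₁ hn₂
  obtain ⟨r₁, hr₁, hn₁⟩ := hn₁
  obtain ⟨r₂, hr₂, hn₂⟩ := hn₂
  -- two tubular neighborhoods of radii `r₁` and `r₂` combine to one of radius `r₁ + r₂ + 1`, and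
  -- one more step is lost on passing from the closure to the complement
  have := HasEssentialCycleIn.of_cover m₁.succ_pos (by omega) (hk (r₁ + r₂ + 1 + 1) (by omega))
    ⟨_, (squareFst X₁ X₂).continuous_realize⟩ ⟨_, (squareSnd X₁ X₂).continuous_realize⟩
    (σ₁ := (swap X₁).realize) (σ₂ := (swap X₂).realize)
    (realize_comm fun _ => rfl) (realize_comm fun _ => rfl)
    (isClosed_underlyingSet (K := prod X₁ X₁)
      (L := tubularNbhd (prod X₁ X₁) (diagonal X₁) r₁)).isOpen_compl
    (isClosed_underlyingSet (K := prod X₂ X₂)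
      (L := tubularNbhd (prod X₂ X₂) (diagonal X₂) r₂)).isOpen_compl
    (fun z hz hz' => hz (realize_mem_tubularNbhd _ swap_diagonal r₁ hz'))
    fun y hy => by
      by_contra! h
      exact farSet_succ_subset _ hy (mem_tubularNbhd_of_square (not_not.1 h.1) (not_not.1 h.2))
  rcases this with h | h
  · exact hn₁ (h.mono (compl_subset_farSet r₁))
  · exact hn₂ (h.mono (compl_subset_farSet r₂))

end ProductObstructor

end Obstructor

end

theorem mainTheorem6 :
    (∀ {V₁ : Type*} {V₂ : Type*} [PartialOrder V₁] [PartialOrder V₂]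
      (X₁ : Obstructor.Complex V₁) (X₂ : Obstructor.Complex V₂) (m₁ m₂ : ℕ),
      Obstructor.IsOrdered X₁ → Obstructor.IsOrdered X₂ →
      Obstructor.IsProperObstructor m₁ X₁ → Obstructor.IsProperObstructor m₂ X₂ →
      Obstructor.IsProperObstructor (m₁ + m₂ + 1) (Obstructor.prod X₁ X₂)) ∧
    (∀ {X₁ : Type*} {X₂ : Type*} [MetricSpace X₁] [MetricSpace X₂] (m₁ m₂ : ℕ),
      Obstructor.IsMetricProperObstructor m₁ X₁ → Obstructor.IsMetricProperObstructor m₂ X₂ →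
      -- `X₁ × X₂` carries the sup metric
      Obstructor.IsMetricProperObstructor (m₁ + m₂ + 1) (X₁ × X₂)) := by
  exact ⟨fun _ _ _ _ hX₁ hX₂ h₁ h₂ => Obstructor.isProperObstructor_prod hX₁ hX₂ h₁ h₂,
    fun _ _ h₁ h₂ => Obstructor.isMetricProperObstructor_prod h₁ h₂⟩
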